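/- Let $\mathbb F$ be a non-Archimedean local field with residue field of characteristic $p$, and let $R$ be a unital ring in which $p$ is invertible. Let $\mathcal G$ be a connected reductive linear algebraic group over $\mathbb F$, let $\mathcal P=\mathcal M\ltimes\mathcal U$ and $\bar{\mathcal P}=\mathcal M\ltimes\bar{\mathcal U}$ be opposite parabolic subgroups of $\mathcal G$ over $\mathbb F$ with common Levi subgroup $\mathcal M=\mathcal P\cap\bar{\mathcal P}$ and unipotent radicals $\mathcal U,\bar{\mathcal U}$, and let $G,P,\bar P,M,U,\bar U$ be the groups of $\mathbb F$-rational points. Fix left Haar measures on $G$ and $M$ whose values on open pro-$p$-subgroups belong to $p^{\mathbb Z}$. For a totally disconnected space $X$ let $C_c^\infty(X)$ be the $R$-module of locally constant, compactly supported functions $X\to R$. Let $\mathcal H(G)=C_c^\infty(G)$ and $\mathcal H(M)=C_c^\infty(M)$ with the convolution product. A left module $X$ over an algebra $A$ is called smooth if $A\otimes_A X\to X$, $a\otimes x\mapsto ax$, is an isomorphism, and similarly for right modules. A representation of $G$ on a left $R$-module is smooth if every vector is fixed by some open subgroup; its integrated form is the $\mathcal H(G)$-module structure $\varphi\cdot v=\int_G\varphi(g)\,gv\,dg$.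 A right representation of $G$ on a right $R$-module gives a right $\mathcal H(G)$-module by $y\cdot\varphi=\int_G (y\cdot g^{-1})\,\varphi(g^{-1})\,dg$; since $G$ is unimodular, this is $\int_G (y\cdot g)\,\varphi(g)\,dg$, and for functions on $G$ with $(y\cdot g)(x)=y(xg^{-1})$ it is right convolution. The same applies to $M$. For $m\in M$ let $\delta_P(m)$ and $\delta_{\bar P}(m)$ be the factors by which $x\mapsto mxm^{-1}$ scales Haar measure on $U$ and on $\bar U$, respectively; these are powers of $p$, viewed as elements of $R$. Let $\delta_P^{1/2}$ and $\delta_{\bar P}^{1/2}$ be locally constant homomorphisms from $M$ to the group of units of the centre of $R$ whose squares are $\delta_P$ and $\delta_{\bar P}$. (Assume that they exist; this is so, for instance, if $p$ has a square root in the centre of $R$. The two choices are arbitrary and independent.) Let $\mathrm r_G^{\bar P}$ be the functor that maps a smooth representation $V$ of $G$ on an $R$-module to the space of $\bar U$-coinvariants $V/\operatorname{span}_R\{\bar u v-v : \bar u\in\bar U,\ v\in V\}$ with the induced action of $M$ multiplied by $(\delta_{\bar P}^{1/2})^{-1}$. Let $\mathrm i_P^G$ be the functor that maps a smooth representation $W$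 of $M$ to the space of all functions $f\colon G\to W$ that are right invariant under some open subgroup of $G$ and satisfy $f(umg)=\delta_P^{1/2}(m)\,m\,f(g)$ for all $u\in U$, $m\in M$, $g\in G$, with $G$ acting by right translation. Then: 1. Taking integrated forms is an equivalence from the category of smooth representations of $G$ on $R$-modules to the category of smooth left $\mathcal H(G)$-modules, and likewise for $M$. (Hence $\mathrm r_G^{\bar P}$ and $\mathrm i_P^G$ may be viewed as functors between the categories of smooth modules over $\mathcal H(G)$ and $\mathcal H(M)$.) 2. $C_c^\infty(\bar U\backslash G)$ is a smooth $\mathcal H(M),\mathcal H(G)$-bimodule for the module structures that come from the left and right representations of $M$ and $G$ by $$(m\cdot f)(\bar Uh)=f(\bar Um^{-1}h)\,\delta_{\bar P}^{1/2}(m),\qquad (f\cdot g)(\bar Uh)=f(\bar Uhg^{-1}),$$ and there are isomorphisms of $\mathcal H(M)$-modules $C_c^\infty(\bar U\backslash G)\otimes_{\mathcal H(G)}V\cong \mathrm r_G^{\bar P}(V)$ that are natural in the smooth representation $V$ of $G$. 3. $C_c^\infty(G/U)$ is a smooth $\mathcal H(G),\mathcal H(M)$-bimodule for the module structures that come from the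 left and right representations of $G$ and $M$ by $$(g\cdot f)(hU)=f(g^{-1}hU),\qquad (f\cdot m)(hU)=f(hm^{-1}U)\,\delta_P^{1/2}(m)^{-1},$$ and there are isomorphisms of $\mathcal H(G)$-modules $C_c^\infty(G/U)\otimes_{\mathcal H(M)}W\cong \mathrm i_P^G(W)$ that are natural in the smooth representation $W$ of $M$. -/

import Mathlib

open CategoryTheory MeasureTheory
open scoped TensorProduct Matrix NNReal ValuativeRel

universe u

/-! ### Linear algebraic groups over a field

A closed subgroup scheme of `GL_n` over `K` is given by polynomial equations in the matrix entries
such that for every commutative `K`-algebra `S` the solutions in `GL_n(S)` form a subgroup. -/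

/-- The solutions in `GL_n(S)` of a system of polynomial equations over `K`. -/
def matrixZeros {K : Type u} [Field K] {n : ℕ} (I : Ideal (MvPolynomial (Fin n × Fin n) K))
    (S : Type u) [CommRing S] [Algebra K S] : Set (GL (Fin n) S) :=
  {g | ∀ f ∈ I, MvPolynomial.aeval (fun ij => (g : Matrix (Fin n) (Fin n) S) ij.1 ij.2) f = 0}

/-- A closed subgroup scheme of `GL_n` over the field `K`. -/
structure AlgGrp (K : Type u) [Field K] (n : ℕ) where
  eqs : Ideal (MvPolynomial (Fin n × Fin n) K)
  one_mem : ∀ (S : Type u) [CommRing S] [Algebra K S], 1 ∈ matrixZeros eqs S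
  mul_mem : ∀ (S : Type u) [CommRing S] [Algebra K S] (g h : GL (Fin n) S),
    g ∈ matrixZeros eqs S → h ∈ matrixZeros eqs S → g * h ∈ matrixZeros eqs S
  inv_mem : ∀ (S : Type u) [CommRing S] [Algebra K S] (g : GL (Fin n) S),
    g ∈ matrixZeros eqs S → g⁻¹ ∈ matrixZeros eqs S

namespace AlgGrp

variable {K : Type u} [Field K] {n : ℕ}

/-- The group of `S`-valued points. -/
def pts (G : AlgGrp K n) (S : Type u) [CommRing S] [Algebra K S] : Subgroup (GL (Fin n) S) where
  carrier := matrixZeros G.eqs S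
  one_mem' := G.one_mem S
  mul_mem' := fun {g h} hg hh => G.mul_mem S g h hg hh
  inv_mem' := fun {g} hg => G.inv_mem S g hg

/-- The coordinate ring `K[x_ij] / I` localised at the determinant. -/
abbrev CoordRing (G : AlgGrp K n) : Type u :=
  Localization.Away
    (Ideal.Quotient.mk G.eqs (Matrix.det (Matrix.mvPolynomialX (Fin n) (Fin n) K)))

/-- `G` is smooth, that is, a linear algebraic group defined over `K`. -/
def IsSmooth (G : AlgGrp K n) : Prop := Algebra.Smooth K G.CoordRing

/-- `G` is connected. -/
def IsConnected (G : AlgGrp K n) : Prop := ConnectedSpace (PrimeSpectrum G.CoordRing)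

/-- All elements over an algebraic closure are unipotent matrices. -/
def IsUnipotent (G : AlgGrp K n) : Prop :=
  ∀ g ∈ G.pts (AlgebraicClosure K),
    IsNilpotent ((g : Matrix (Fin n) (Fin n) (AlgebraicClosure K)) - 1)

/-- Inclusion of subgroup schemes. -/
def IsSubgroup (H G : AlgGrp K n) : Prop :=
  ∀ (S : Type u) [CommRing S] [Algebra K S], H.pts S ≤ G.pts S

/-- `G` is a connected reductive linear algebraic group over `K`: it is smooth and connected, and
over an algebraic closure it has no non-trivial smooth connected unipotent normal closed
subgroup. -/
structure IsConnectedReductive (G : AlgGrp K n) : Prop where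
  smooth : G.IsSmooth
  connected : G.IsConnected
  unipotentRadical_trivial : ∀ N : AlgGrp (AlgebraicClosure K) n,
    N.IsSmooth → N.IsConnected → N.IsUnipotent →
    N.pts (AlgebraicClosure K) ≤ G.pts (AlgebraicClosure K) →
    (∀ g ∈ G.pts (AlgebraicClosure K), ∀ h ∈ N.pts (AlgebraicClosure K),
      g * h * g⁻¹ ∈ N.pts (AlgebraicClosure K)) →
    N.pts (AlgebraicClosure K) = ⊥

/-- `w` solves a system of polynomial equations over `K`. -/
def SolvesEqs {m : ℕ} (E : Set (MvPolynomial (Fin m) K)) {S : Type u} [CommRing S] [Algebra K S]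
    (w : Fin m → S) : Prop :=
  ∀ f ∈ E, MvPolynomial.aeval w f = 0

/-- A realisation of the quotient `G / P` as a projective variety: a closed subscheme `X` of a
projective space over `K` (given by homogeneous equations), stable under a linear representation
of `G`, with a base point in `X(K)` whose stabiliser is `P`, such that `X` is homogeneous, that is,
the map `G × X → X × X`, `(g, x) ↦ (g x, x)`, is surjective (on points over an algebraic closure)
and smooth (infinitesimal lifting criterion). Points of `X` are represented by
unimodular vectors, and two of these give the same point if they differ by a unit. -/
structure ProjectiveQuotient (G P : AlgGrp K n) where
  /-- the number of homogeneous coordinates -/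
  dim : ℕ
  /-- the linear representation, as a natural transformation of group functors -/
  rep : ∀ (S : Type u) [CommRing S] [Algebra K S], G.pts S →* GL (Fin dim) S
  rep_natural : ∀ (S T : Type u) [CommRing S] [Algebra K S] [CommRing T] [Algebra K T]
    (f : S →ₐ[K] T) (g : G.pts S) (h : G.pts T),
    (h : GL (Fin n) T) = Matrix.GeneralLinearGroup.map (f : S →+* T) (g : GL (Fin n) S) →
    rep T h = Matrix.GeneralLinearGroup.map (f : S →+* T) (rep S g)
  /-- the equations of `X` -/
  eqs : Set (MvPolynomial (Fin dim) K)
  homogeneous : ∀ f ∈ eqs, ∃ d : ℕ, f.IsHomogeneous d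
  stable : ∀ (S : Type u) [CommRing S] [Algebra K S] (g : G.pts S) (w : Fin dim → S),
    SolvesEqs eqs w → SolvesEqs eqs ((rep S g : Matrix (Fin dim) (Fin dim) S) *ᵥ w)
  /-- the base point -/
  base : Fin dim → K
  base_ne_zero : base ≠ 0
  base_mem : SolvesEqs eqs base
  stabilizer : ∀ (S : Type u) [CommRing S] [Algebra K S] (g : G.pts S),
    (g : GL (Fin n) S) ∈ P.pts S ↔
      ∃ c : Sˣ, (rep S g : Matrix (Fin dim) (Fin dim) S) *ᵥ (fun i => algebraMap K S (base i)) =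
        c • (fun i => algebraMap K S (base i))
  transitive : ∀ w w' : Fin dim → AlgebraicClosure K, w ≠ 0 → w' ≠ 0 →
    SolvesEqs eqs w → SolvesEqs eqs w' →
    ∃ (g : G.pts (AlgebraicClosure K)) (c : (AlgebraicClosure K)ˣ),
      w' = c • ((rep (AlgebraicClosure K) g : Matrix (Fin dim) (Fin dim) _) *ᵥ w)
  smooth : ∀ (S : Type u) [CommRing S] [Algebra K S] (J : Ideal S), J ^ 2 = ⊥ →
    ∀ w w' : Fin dim → S, Ideal.span (Set.range w) = ⊤ → SolvesEqs eqs w → SolvesEqs eqs w' →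
    ∀ (g₀ : G.pts (S ⧸ J)) (c₀ : (S ⧸ J)ˣ),
      (fun i => Ideal.Quotient.mk J (w' i)) =
        c₀ • ((rep (S ⧸ J) g₀ : Matrix (Fin dim) (Fin dim) (S ⧸ J)) *ᵥ
          (fun i => Ideal.Quotient.mk J (w i))) →
      ∃ (g : G.pts S) (c : Sˣ),
        Matrix.GeneralLinearGroup.map (Ideal.Quotient.mk J) (g : GL (Fin n) S) =
          (g₀ : GL (Fin n) (S ⧸ J)) ∧
        Units.map (Ideal.Quotient.mk J : S →* S ⧸ J) c = c₀ ∧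
        w' = c • ((rep S g : Matrix (Fin dim) (Fin dim) S) *ᵥ w)

/-- `P` is a parabolic subgroup of `G` (over `K`): a smooth closed subgroup such that `G / P` is a
projective variety. -/
structure IsParabolic (G P : AlgGrp K n) : Prop where
  smooth : P.IsSmooth
  subgroup : P.IsSubgroup G
  projective : Nonempty (ProjectiveQuotient G P)

/-- `P = M ⋉ U` is a Levi decomposition: `U` is a smooth connected unipotent normal subgroup of
`P`, `M` is a connected reductive subgroup of `P`, and `P` is their semidirect product (as group
schemes). Then `U` is the unipotent radical of `P`. -/
structure IsLeviDecomposition (P M U : AlgGrp K n) : Prop where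
  levi_reductive : M.IsConnectedReductive
  levi_subgroup : M.IsSubgroup P
  unip_smooth : U.IsSmooth
  unip_connected : U.IsConnected
  unip_unipotent : U.IsUnipotent
  unip_subgroup : U.IsSubgroup P
  unip_normal : ∀ (S : Type u) [CommRing S] [Algebra K S], ∀ g ∈ P.pts S, ∀ h ∈ U.pts S,
    g * h * g⁻¹ ∈ U.pts S
  inf_eq_bot : ∀ (S : Type u) [CommRing S] [Algebra K S], M.pts S ⊓ U.pts S = ⊥
  exists_mul : ∀ (S : Type u) [CommRing S] [Algebra K S], ∀ g ∈ P.pts S,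
    ∃ m ∈ M.pts S, ∃ h ∈ U.pts S, g = m * h

/-- `P` and `P'` are opposite parabolic subgroups of `G` with common Levi subgroup `M` and
unipotent radicals `U` and `U'`. -/
structure IsOppositeParabolicPair (G P P' M U U' : AlgGrp K n) : Prop where
  parabolic : G.IsParabolic P
  parabolic' : G.IsParabolic P'
  levi : P.IsLeviDecomposition M U
  levi' : P'.IsLeviDecomposition M U'
  inf_eq : ∀ (S : Type u) [CommRing S] [Algebra K S], P.pts S ⊓ P'.pts S = M.pts S

/-- The rational points of `H` as a subgroup of the group of rational points of `G`. -/
abbrev sub (G H : AlgGrp K n) : Subgroup (G.pts K) := (H.pts K).subgroupOf (G.pts K)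

theorem IsLeviDecomposition.normalizes {P M U : AlgGrp K n} (h : P.IsLeviDecomposition M U)
    (G : AlgGrp K n) (m : G.sub M) (x : G.pts K) (hx : x ∈ G.sub U) :
    (m : G.pts K) * x * (m : G.pts K)⁻¹ ∈ G.sub U :=
  h.unip_normal K _ (h.levi_subgroup K m.2) _ hx

theorem isClosed_pts [TopologicalSpace K] [IsTopologicalRing K] [T1Space K]
    (G : AlgGrp K n) : IsClosed (G.pts K : Set (GL (Fin n) K)) := by
  have : (G.pts K : Set (GL (Fin n) K)) = ⋂ f ∈ G.eqs, (fun g : GL (Fin n) K =>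
      MvPolynomial.aeval (fun ij => (g : Matrix (Fin n) (Fin n) K) ij.1 ij.2) f) ⁻¹' {0} := by
    ext g
    simp only [Set.mem_iInter, Set.mem_preimage, Set.mem_singleton_iff]
    exact Iff.rfl
  rw [this]
  refine isClosed_biInter fun f _ => isClosed_singleton.preimage ?_
  have h1 : Continuous fun x : Fin n × Fin n → K => MvPolynomial.eval x f :=
    MvPolynomial.continuous_eval f
  simp only [MvPolynomial.aeval_eq_eval]
  refine h1.comp (continuous_pi fun ij => ?_)
  exact (Units.continuous_val.matrix_elem ij.1 ij.2)

theorem t1Space_localField [ValuativeRel K] [TopologicalSpace K]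
    [IsNonarchimedeanLocalField K] : T1Space K := by
  let := IsTopologicalAddGroup.rightUniformSpace K
  have := isUniformAddGroup_of_addCommGroup (G := K)
  have : T0Space K := inferInstance
  infer_instance

instance locallyCompactSpace_sub [ValuativeRel K] [TopologicalSpace K]
    [IsNonarchimedeanLocalField K] (G H : AlgGrp K n) : LocallyCompactSpace (G.sub H) := by
  have : T1Space K := t1Space_localField
  have : LocallyCompactSpace (Matrix (Fin n) (Fin n) K) :=
    inferInstanceAs (LocallyCompactSpace (Fin n → Fin n → K))
  have : T1Space (Matrix (Fin n) (Fin n) K) :=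
    inferInstanceAs (T1Space (Fin n → Fin n → K))
  have : LocallyCompactSpace (GL (Fin n) K) :=
    inferInstanceAs (LocallyCompactSpace (Matrix (Fin n) (Fin n) K)ˣ)
  have : LocallyCompactSpace (G.pts K) := G.isClosed_pts.locallyCompactSpace
  have : IsClosed (G.sub H : Set (G.pts K)) := H.isClosed_pts.preimage continuous_subtype_val
  exact this.locallyCompactSpace

end AlgGrp

/-! ### Haar integration with values in modules -/

open Classical in
/-- The image in the ring `S` of a real number that is rational with denominator invertible
in `S`. -/
noncomputable def toRing (S : Type*) [Ring S] (x : ℝ) : S :=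
  if h : ∃ q : ℚ, (q : ℝ) = x then (h.choose.num : S) * Ring.inverse (h.choose.den : S) else 0

/-- The integral `∫ F dμ` of a locally constant, compactly supported function with values in an
`S`-module: the sum over all values `v` of `μ {F = v} • v`. -/
noncomputable def haarIntegral (S : Type*) [Ring S] {G V : Type*} [TopologicalSpace G]
    [AddCommGroup V] [Module S V] (μ : @Measure G (borel G)) (F : G → V) : V :=
  ∑ᶠ v : V, toRing S (μ (F ⁻¹' {v})).toReal • v

/-- The subgroup `K` of a totally disconnected group is a pro-`p`-group: it is compact and all its
open normal subgroups have `p`-power index. -/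
def IsProP (p : ℕ) {G : Type*} [Group G] [TopologicalSpace G] (K : Subgroup G) : Prop :=
  IsCompact (K : Set G) ∧
    ∀ N : Subgroup K, N.Normal → IsOpen (N : Set K) → ∃ k : ℕ, N.index = p ^ k

/-- `μ` is a left Haar measure on `G` with `μ K ∈ p ^ ℤ` for all open pro-`p`-groups `K ⊆ G`. -/
def IsNormalizedHaar (p : ℕ) {G : Type*} [Group G] [TopologicalSpace G]
    (μ : @Measure G (borel G)) : Prop :=
  @Measure.IsHaarMeasure G _ _ (borel G) μ ∧
    ∀ K : Subgroup G, IsOpen (K : Set G) → IsProP p K →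
      ∃ k : ℤ, μ (K : Set G) = ENNReal.ofReal ((p : ℝ) ^ k)

/-! ### Locally constant functions with compact support -/

/-- The `R`-module of locally constant, compactly supported functions `X → R`. -/
def CcInf (X : Type*) [TopologicalSpace X] (R : Type*) [Ring R] : Submodule R (X → R) where
  carrier := {f | IsLocallyConstant f ∧ HasCompactSupport f}
  zero_mem' := ⟨IsLocallyConstant.const 0, HasCompactSupport.zero⟩
  add_mem' := fun hf hg => ⟨hf.1.add hg.1, hf.2.add hg.2⟩
  smul_mem' := fun r _ hf =>
    ⟨hf.1.comp (fun x => r * x), hf.2.comp_left (g := fun x => r * x) (mul_zero r)⟩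

namespace CcInf

variable {X : Type*} [TopologicalSpace X] {R : Type*} [Ring R]

instance : CoeFun (CcInf X R) fun _ => X → R := ⟨fun f => f.1⟩

theorem op_smul_mem (r : Rᵐᵒᵖ) (f : CcInf X R) : r • (f : X → R) ∈ CcInf X R :=
  ⟨f.2.1.comp (fun x => x * r.unop),
    f.2.2.comp_left (g := fun x => x * r.unop) (zero_mul _)⟩

/-- Pointwise multiplication from the right. -/
instance : SMul Rᵐᵒᵖ (CcInf X R) := ⟨fun r f => ⟨r • (f : X → R), op_smul_mem r f⟩⟩

instance : Module Rᵐᵒᵖ (CcInf X R) :=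
  Function.Injective.module Rᵐᵒᵖ (CcInf X R).subtype.toAddMonoidHom Subtype.val_injective
    (fun _ _ => rfl)

/-- Composition with a homeomorphism. -/
def comp (e : X ≃ₜ X) : CcInf X R →ₗ[R] CcInf X R where
  toFun f := ⟨fun x => f (e x), f.2.1.comp_continuous e.continuous, f.2.2.comp_homeomorph e⟩
  map_add' _ _ := rfl
  map_smul' _ _ := rfl

@[simp] theorem comp_apply (e : X ≃ₜ X) (f : CcInf X R) (x : X) : comp e f x = f (e x) := rfl

end CcInf

/-- The homeomorphism of a quotient space induced by a homeomorphism. -/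
def quotHomeo {X : Type*} [TopologicalSpace X] (s : Setoid X) (e : X ≃ₜ X)
    (h : ∀ a b, s a b → s (e a) (e b)) (h' : ∀ a b, s a b → s (e.symm a) (e.symm b)) :
    Quotient s ≃ₜ Quotient s where
  toFun := Quotient.map e h
  invFun := Quotient.map e.symm h'
  left_inv := by rintro ⟨x⟩; exact congrArg (Quotient.mk s) (e.symm_apply_apply x)
  right_inv := by rintro ⟨x⟩; exact congrArg (Quotient.mk s) (e.apply_symm_apply x)
  continuous_toFun := e.continuous.quotient_map' h
  continuous_invFun := e.symm.continuous.quotient_map' h'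

/-! ### Smooth representations and their integrated forms -/

/-- A smooth representation of `G` on an `R`-module. -/
structure SmoothRep (R : Type u) [Ring R] (G : Type u) [Group G] [TopologicalSpace G] where
  carrier : Type u
  [grp : AddCommGroup carrier]
  [mod : Module R carrier]
  ρ : G →* Module.End R carrier
  smooth : ∀ v, ∃ K : Subgroup G, IsOpen (K : Set G) ∧ ∀ k ∈ K, ρ k v = v

namespace SmoothRep

attribute [instance] grp mod

variable {R : Type u} [Ring R] {G : Type u} [Group G] [TopologicalSpace G]

instance : CoeSort (SmoothRep R G) (Type u) := ⟨carrier⟩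

/-- `G`-equivariant `R`-linear maps. -/
@[ext] structure Hom (V W : SmoothRep R G) where
  toLin : V →ₗ[R] W
  comm : ∀ g v, toLin (V.ρ g v) = W.ρ g (toLin v)

instance : Category (SmoothRep R G) where
  Hom := Hom
  id V := ⟨LinearMap.id, fun _ _ => rfl⟩
  comp f g := ⟨g.toLin ∘ₗ f.toLin, fun x v => by simp [f.comm, g.comm]⟩

/-- The linear map underlying a morphism. -/
def lin {V W : SmoothRep R G} (f : V ⟶ W) : V →ₗ[R] W := Hom.toLin f

/-- The action `φ · v = ∫ φ(g) (g · v) dμ(g)` of functions on `G`. -/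
noncomputable def heckeAct (μ : @Measure G (borel G)) (V : SmoothRep R G) (φ : CcInf G R)
    (v : V) : V :=
  haarIntegral R μ fun g => φ g • V.ρ g v

end SmoothRep

/-- The multiplication of the Hecke algebra `H(G) = CcInf G R`: convolution
`(φ * ψ)(x) = ∫ φ(g) ψ(g⁻¹ x) dμ(g)`, the integral being formed in `CcInf G R`. -/
noncomputable def heckeMul {R : Type u} [Ring R] {G : Type u} [Group G] [TopologicalSpace G]
    [IsTopologicalGroup G] (μ : @Measure G (borel G)) (φ ψ : CcInf G R) : CcInf G R :=
  haarIntegral R μ fun g => φ g • CcInf.comp (Homeomorph.mulLeft g⁻¹) ψ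

/-! ### Balanced tensor products, smooth modules and bimodules -/

/-- The tensor product `Y ⊗_A V` of a right `A`-module `Y` and a left `A`-module `V`. -/
abbrev BalTensor {A Y V : Type*} [AddCommGroup Y] [AddCommGroup V] (ra : Y → A → Y)
    (la : A → V → V) : Type _ :=
  (Y ⊗[ℤ] V) ⧸ Submodule.span ℤ {z : Y ⊗[ℤ] V | ∃ y a v, z = ra y a ⊗ₜ[ℤ] v - y ⊗ₜ[ℤ] la a v}

/-- The elementary tensor `y ⊗ v` in `Y ⊗_A V`. -/
def BalTensor.tmul {A Y V : Type*} [AddCommGroup Y] [AddCommGroup V] (ra : Y → A → Y)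
    (la : A → V → V) (y : Y) (v : V) : BalTensor ra la :=
  Submodule.Quotient.mk (y ⊗ₜ[ℤ] v)

/-- `act` is a left module structure of the algebra `(A, mul)` on `X`, and it is smooth: the map
`A ⊗_A X → X`, `a ⊗ x ↦ a x`, is an isomorphism. -/
structure IsSmoothLeftModule {A X : Type*} [AddCommGroup A] [AddCommGroup X] (mul : A → A → A)
    (act : A → X → X) : Prop where
  add_act : ∀ a b x, act (a + b) x = act a x + act b x
  act_add : ∀ a x y, act a (x + y) = act a x + act a y
  mul_act : ∀ a b x, act (mul a b) x = act a (act b x)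
  smooth : ∃ e : BalTensor mul act ≃+ X, ∀ a x, e (BalTensor.tmul mul act a x) = act a x

/-- `act` is a smooth right module structure of the algebra `(A, mul)` on `X`. -/
structure IsSmoothRightModule {A X : Type*} [AddCommGroup A] [AddCommGroup X] (mul : A → A → A)
    (act : X → A → X) : Prop where
  act_add : ∀ x a b, act x (a + b) = act x a + act x b
  add_act : ∀ x y a, act (x + y) a = act x a + act y a
  act_mul : ∀ x a b, act x (mul a b) = act (act x a) b
  smooth : ∃ e : BalTensor act mul ≃+ X, ∀ x a, e (BalTensor.tmul act mul x a) = act x a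

/-- An `R`-bimodule with a left representation of `H` and a right representation of `G`. -/
structure BiRep (R : Type u) [Ring R] (H G : Type u) [Group H] [Group G] where
  carrier : Type u
  [grp : AddCommGroup carrier]
  [mod : Module R carrier]
  [modOp : Module Rᵐᵒᵖ carrier]
  left : H →* AddMonoid.End carrier
  right : Gᵐᵒᵖ →* AddMonoid.End carrier

namespace BiRep

attribute [instance] grp mod modOp

variable {R : Type u} [Ring R] {H G : Type u} [Group H] [TopologicalSpace H] [Group G]
  [TopologicalSpace G]

instance : CoeSort (BiRep R H G) (Type u) := ⟨carrier⟩

/-- The left action `φ · y = ∫ φ(h) (h · y) dμ(h)` of functions on `H`. -/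
noncomputable def heckeLeft (μ : @Measure H (borel H)) (Y : BiRep R H G) (φ : CcInf H R)
    (y : Y) : Y :=
  haarIntegral R μ fun h => φ h • Y.left h y

/-- The right action `y · φ = ∫ (y · g⁻¹) φ(g⁻¹) dμ(g)` of functions on `G`. If `G` is unimodular,
this is `∫ (y · g) φ(g) dμ(g)`. For the right regular representation `(y · g)(x) = y (x g⁻¹)` on
functions on `G`, it is right convolution, `(y * φ)(x) = ∫ y(x g) φ(g⁻¹) dμ(g)`. -/
noncomputable def heckeRight (μ : @Measure G (borel G)) (Y : BiRep R H G) (y : Y)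
    (φ : CcInf G R) : Y :=
  haarIntegral Rᵐᵒᵖ μ fun g => MulOpposite.op (φ g⁻¹) • Y.right (MulOpposite.op g⁻¹) y

/-- `Y` is a smooth `H(H), H(G)`-bimodule. -/
structure IsSmoothBimodule [IsTopologicalGroup H] [IsTopologicalGroup G]
    (μH : @Measure H (borel H)) (μG : @Measure G (borel G)) (Y : BiRep R H G) : Prop where
  left : IsSmoothLeftModule (heckeMul (R := R) μH) (Y.heckeLeft μH)
  right : IsSmoothRightModule (heckeMul (R := R) μG) (Y.heckeRight μG)
  comm : ∀ φ y ψ, Y.heckeRight μG (Y.heckeLeft μH φ y) ψ = Y.heckeLeft μH φ (Y.heckeRight μG y ψ)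

/-- The functor `Φ` is the tensor product functor `V ↦ Y ⊗_{H(G)} V`: there are isomorphisms
`Y ⊗_{H(G)} V ≅ Φ(V)` of left `H(H)`-modules, natural in `V`. -/
def IsTensorFunctor (μH : @Measure H (borel H)) (μG : @Measure G (borel G)) (Y : BiRep R H G)
    (Φ : SmoothRep R G ⥤ SmoothRep R H) : Prop :=
  ∃ T : ∀ V : SmoothRep R G, BalTensor (Y.heckeRight μG) (V.heckeAct μG) ≃+ Φ.obj V,
    (∀ (V : SmoothRep R G) (φ : CcInf H R) (y : Y) (v : V),
      T V (BalTensor.tmul _ _ (Y.heckeLeft μH φ y) v) =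
        (Φ.obj V).heckeAct μH φ (T V (BalTensor.tmul _ _ y v))) ∧
    (∀ (V W : SmoothRep R G) (f : V ⟶ W) (y : Y) (v : V),
      T W (BalTensor.tmul _ _ y (SmoothRep.lin f v)) =
        SmoothRep.lin (Φ.map f) (T V (BalTensor.tmul _ _ y v)))

end BiRep

/-- Passing from smooth representations of `G` to smooth left `H(G)`-modules is an equivalence of
categories: it is well defined on objects and morphisms, essentially surjective and full (it is
faithful because it does not change the underlying maps). -/
structure IntegrationIsEquivalence (R : Type u) [Ring R] {G : Type u} [Group G]
    [TopologicalSpace G] [IsTopologicalGroup G] (μ : @Measure G (borel G)) : Prop where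
  obj : ∀ V : SmoothRep R G, IsSmoothLeftModule (heckeMul μ) (V.heckeAct μ)
  map : ∀ (V W : SmoothRep R G) (f : V ⟶ W) (φ : CcInf G R) (v : V),
    SmoothRep.lin f (V.heckeAct μ φ v) = W.heckeAct μ φ (SmoothRep.lin f v)
  full : ∀ (V W : SmoothRep R G) (f : V →+ W),
    (∀ (φ : CcInf G R) (v : V), f (V.heckeAct μ φ v) = W.heckeAct μ φ (f v)) →
    ∃ f' : V ⟶ W, ∀ v, SmoothRep.lin f' v = f v
  essSurj : ∀ (X : Type u) [AddCommGroup X] (act : CcInf G R → X → X),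
    IsSmoothLeftModule (heckeMul μ) act →
    ∃ (V : SmoothRep R G) (e : V ≃+ X), ∀ φ v, e (V.heckeAct μ φ v) = act φ (e v)

/-! ### Jacquet functors -/

/-- A locally constant character of `M` with values in the units of the centre of `R`. -/
structure SmoothChar (R : Type u) [Ring R] (M : Type u) [Group M] [TopologicalSpace M] where
  toHom : M →* (Subring.center R)ˣ
  isOpen_ker : IsOpen (toHom.ker : Set M)

namespace Jacquet

variable {R : Type u} [Ring R] {G : Type u} [Group G] [TopologicalSpace G] [IsTopologicalGroup G]
  {M U : Subgroup G}

/-- The value of a character as an element of `R`. -/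
def val {M : Type u} [Group M] [TopologicalSpace M] (χ : SmoothChar R M) (m : M) : R :=
  ((χ.toHom m : Subring.center R) : R)

section val

variable {M : Type u} [Group M] [TopologicalSpace M] (χ : SmoothChar R M)

theorem val_one : val χ 1 = 1 := by simp [val]

theorem val_mul (a b : M) : val χ (a * b) = val χ a * val χ b := by simp [val]

theorem val_comm (m : M) (r : R) : r * val χ m = val χ m * r :=
  Subring.mem_center_iff.mp (χ.toHom m : Subring.center R).2 r

end val

/-- Conjugation by `m ∈ M` as an automorphism `u ↦ m u m⁻¹` of `U`. -/
def conjEquiv (hMU : ∀ (m : M), ∀ x ∈ U, (m : G) * x * (m : G)⁻¹ ∈ U) (m : M) : U ≃ₜ* U where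
  toFun x := ⟨m * x * (m : G)⁻¹, hMU m x x.2⟩
  invFun x := ⟨(m : G)⁻¹ * x * m, by simpa using hMU m⁻¹ x x.2⟩
  left_inv x := by ext; simp [mul_assoc]
  right_inv x := by ext; simp [mul_assoc]
  map_mul' x y := by ext; simp [mul_assoc]
  continuous_toFun := by fun_prop
  continuous_invFun := by fun_prop

/-- The modular function `δ(m)` of the semidirect product `M ⋉ U`: the factor by which
`u ↦ m u m⁻¹` scales Haar measure on `U`, that is, `vol (m A m⁻¹) = δ(m) vol A` for `A ⊆ U`. -/
noncomputable def modulus [LocallyCompactSpace U]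
    (hMU : ∀ (m : M), ∀ x ∈ U, (m : G) * x * (m : G)⁻¹ ∈ U) (m : M) : ℝ≥0 :=
  letI : MeasurableSpace U := borel U
  haveI : BorelSpace U := ⟨rfl⟩
  mulEquivHaarChar (conjEquiv hMU m)

/-- `χ` is a square root of the modular function of `M ⋉ U` in `R`. -/
def IsModulusSqrt [LocallyCompactSpace U]
    (hMU : ∀ (m : M), ∀ x ∈ U, (m : G) * x * (m : G)⁻¹ ∈ U) (χ : SmoothChar R M) : Prop :=
  ∀ m : M, val χ m ^ 2 = toRing R (modulus hMU m : ℝ)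

/-! #### Jacquet restriction -/

/-- The submodule generated by all `u v - v`; the quotient by it is the space of
`U`-coinvariants. -/
def coinvKer (U : Subgroup G) (V : SmoothRep R G) : Submodule R V :=
  Submodule.span R {w | ∃ x ∈ U, ∃ v : V, w = V.ρ x v - v}

theorem coinvKer_le (hMU : ∀ (m : M), ∀ x ∈ U, (m : G) * x * (m : G)⁻¹ ∈ U) (V : SmoothRep R G)
    (m : M) : coinvKer U V ≤ (coinvKer U V).comap (V.ρ m) := by
  refine Submodule.span_le.2 ?_
  rintro _ ⟨x, hx, v, rfl⟩
  refine Submodule.subset_span ⟨m * x * (m : G)⁻¹, hMU m x hx, V.ρ m v, ?_⟩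
  simp [map_sub, ← Module.End.mul_apply, ← map_mul]

/-- The action of `M` on the `U`-coinvariants, twisted by `χ⁻¹`. -/
def coinvAct (hMU : ∀ (m : M), ∀ x ∈ U, (m : G) * x * (m : G)⁻¹ ∈ U) (χ : SmoothChar R M)
    (V : SmoothRep R G) : M →* Module.End R (V ⧸ coinvKer U V) where
  toFun m :=
    { toFun := fun v => val χ m⁻¹ • (coinvKer U V).mapQ _ (V.ρ m) (coinvKer_le hMU V m) v
      map_add' := fun v w => by simp
      map_smul' := fun r v => by simp [smul_smul, val_comm] }
  map_one' := by
    ext v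
    simp [val_one]
  map_mul' a b := by
    ext v
    simp [mul_inv_rev, val_mul, smul_smul]

theorem coinvAct_mk (hMU : ∀ (m : M), ∀ x ∈ U, (m : G) * x * (m : G)⁻¹ ∈ U) (χ : SmoothChar R M)
    (V : SmoothRep R G) (m : M) (v : V) :
    coinvAct hMU χ V m ((coinvKer U V).mkQ v) = (coinvKer U V).mkQ (val χ m⁻¹ • V.ρ m v) := rfl

/-- The functor from smooth representations of `G` to smooth representations of `M` that restricts
to `M ⋉ U`, takes `U`-coinvariants and twists the action of `M` by `χ⁻¹`. -/
def restriction (hMU : ∀ (m : M), ∀ x ∈ U, (m : G) * x * (m : G)⁻¹ ∈ U) (χ : SmoothChar R M) :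
    SmoothRep R G ⥤ SmoothRep R M where
  obj V :=
    { carrier := V ⧸ coinvKer U V
      ρ := coinvAct hMU χ V
      smooth := by
        intro v
        obtain ⟨v, rfl⟩ := Submodule.Quotient.mk_surjective _ v
        obtain ⟨K, hK, h⟩ := V.smooth v
        refine ⟨K.subgroupOf M ⊓ χ.toHom.ker,
          (hK.preimage continuous_subtype_val).inter χ.isOpen_ker, ?_⟩
        rintro k ⟨hk, hk'⟩
        have h1 : val χ k⁻¹ = 1 := by
          have : χ.toHom k = 1 := hk'
          simp [val, this]
        exact (coinvAct_mk hMU χ V k v).trans (by rw [h1, one_smul]; exact congrArg _ (h (k : G) hk)) }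
  map {V W} f :=
    { toLin := (coinvKer U V).mapQ (coinvKer U W) f.toLin (by
        refine Submodule.span_le.2 ?_
        rintro _ ⟨x, hx, v, rfl⟩
        exact Submodule.subset_span ⟨x, hx, f.toLin v, by simp [f.comm]⟩)
      comm := by
        intro m v
        obtain ⟨v, rfl⟩ := Submodule.Quotient.mk_surjective _ v
        change (coinvKer U W).mkQ (f.toLin (val χ m⁻¹ • V.ρ m v)) =
          (coinvKer U W).mkQ (val χ m⁻¹ • W.ρ m (f.toLin v))
        rw [map_smul, f.comm] }
  map_id V := by
    apply SmoothRep.Hom.ext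
    ext v
    rfl
  map_comp f g := by
    apply SmoothRep.Hom.ext
    ext v
    rfl

/-! #### Parabolic induction -/

/-- The space of the representation of `G` induced from `M ⋉ U`, where `U` acts trivially on `W`
and the action of `M` is twisted by `χ`: functions `f : G → W` with
`f (x m g) = χ(m) m f(g)` for `x ∈ U`, `m ∈ M`, invariant under right translation by some open
subgroup. -/
def indSpace (U : Subgroup G) (χ : SmoothChar R M) (W : SmoothRep R M) :
    Submodule R (G → W) where
  carrier := {f | (∀ x ∈ U, ∀ g, f (x * g) = f g) ∧
    (∀ (m : M) (g : G), f (m * g) = val χ m • W.ρ m (f g)) ∧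
    ∃ K : Subgroup G, IsOpen (K : Set G) ∧ ∀ k ∈ K, ∀ g, f (g * k) = f g}
  zero_mem' := ⟨by simp, by simp, ⊤, isOpen_univ, by simp⟩
  add_mem' := by
    rintro f f' ⟨h1, h2, K, hK, h3⟩ ⟨h1', h2', K', hK', h3'⟩
    refine ⟨fun x hx g => by simp [h1 x hx, h1' x hx], fun m g => by simp [h2, h2'],
      K ⊓ K', hK.inter hK', fun k hk g => by simp [h3 k hk.1, h3' k hk.2]⟩
  smul_mem' := by
    rintro r f ⟨h1, h2, K, hK, h3⟩
    refine ⟨fun x hx g => by simp [h1 x hx], fun m g => by simp [h2, smul_smul, val_comm],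
      K, hK, fun k hk g => by simp [h3 k hk]⟩

/-- `G` acts on the induced representation by right translation. -/
def indAct (U : Subgroup G) (χ : SmoothChar R M) (W : SmoothRep R M) :
    G →* Module.End R (indSpace U χ W) where
  toFun x :=
    { toFun := fun f => ⟨fun g => f.1 (g * x), by
        obtain ⟨f, h1, h2, K, hK, h3⟩ := f
        refine ⟨fun y hy g => by simp [mul_assoc, h1 y hy], fun m g => by simp [mul_assoc, h2],
          K.comap (MulAut.conj x⁻¹).toMonoidHom, hK.preimage ?_, fun k hk g => ?_⟩
        · change Continuous fun y : G => x⁻¹ * y * x⁻¹⁻¹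
          fun_prop
        · have := h3 _ hk (g * x)
          simpa [mul_assoc] using this⟩
      map_add' := fun _ _ => rfl
      map_smul' := fun _ _ => rfl }
  map_one' := by
    ext f g
    simp
  map_mul' x y := by
    ext f g
    simp [mul_assoc]

/-- The functor from smooth representations of `M` to smooth representations of `G` that extends
a representation to `M ⋉ U` by letting `U` act trivially, twists it by `χ` and induces to `G`. -/
def induction (U : Subgroup G) (χ : SmoothChar R M) : SmoothRep R M ⥤ SmoothRep R G where
  obj W :=
    { carrier := indSpace U χ W
      ρ := indAct U χ W
      smooth := by
        rintro ⟨f, h1, h2, K, hK, h3⟩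
        exact ⟨K, hK, fun k hk => Subtype.ext (funext fun g => h3 k hk g)⟩ }
  map {V W} f :=
    { toLin :=
        { toFun := fun F => ⟨fun g => f.toLin (F.1 g), by
            obtain ⟨F, h1, h2, K, hK, h3⟩ := F
            exact ⟨fun y hy g => by simp [h1 y hy], fun m g => by simp [h2, f.comm],
              K, hK, fun k hk g => by simp [h3 k hk]⟩⟩
          map_add' := fun F F' => by ext g; simp
          map_smul' := fun r F => by ext g; simp }
      comm := fun _ _ => rfl }
  map_id V := rfl
  map_comp f g := rfl

/-! #### The bimodules -/

/-- `U x ↦ U m⁻¹ x` on `U \ G` for `m ∈ M`. -/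
def leftMove (hMU : ∀ (m : M), ∀ x ∈ U, (m : G) * x * (m : G)⁻¹ ∈ U) (m : M) :
    Quotient (QuotientGroup.rightRel U) ≃ₜ Quotient (QuotientGroup.rightRel U) :=
  quotHomeo _ (Homeomorph.mulLeft (m : G)⁻¹)
    (fun a b hab => by
      rw [QuotientGroup.rightRel_apply] at hab ⊢
      simpa [mul_assoc] using hMU m⁻¹ _ hab)
    (fun a b hab => by
      rw [QuotientGroup.rightRel_apply] at hab ⊢
      simpa [mul_assoc, Homeomorph.mulLeft_symm] using hMU m _ hab)

/-- `U x ↦ U x g⁻¹` on `U \ G` for `g ∈ G`. -/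
def rightMove (U : Subgroup G) (g : G) :
    Quotient (QuotientGroup.rightRel U) ≃ₜ Quotient (QuotientGroup.rightRel U) :=
  quotHomeo _ (Homeomorph.mulRight g⁻¹)
    (fun a b hab => by
      rw [QuotientGroup.rightRel_apply] at hab ⊢
      simpa [mul_assoc] using hab)
    (fun a b hab => by
      rw [QuotientGroup.rightRel_apply] at hab ⊢
      simpa [mul_assoc, Homeomorph.mulRight_symm] using hab)

/-- `x U ↦ g⁻¹ x U` on `G / U` for `g ∈ G`. -/
def leftMove' (U : Subgroup G) (g : G) : G ⧸ U ≃ₜ G ⧸ U :=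
  quotHomeo (QuotientGroup.leftRel U) (Homeomorph.mulLeft g⁻¹)
    (fun a b hab => by
      rw [QuotientGroup.leftRel_apply] at hab ⊢
      simpa [mul_assoc] using hab)
    (fun a b hab => by
      rw [QuotientGroup.leftRel_apply] at hab ⊢
      simpa [mul_assoc, Homeomorph.mulLeft_symm] using hab)

/-- `x U ↦ x m⁻¹ U` on `G / U` for `m ∈ M`. -/
def rightMove' (hMU : ∀ (m : M), ∀ x ∈ U, (m : G) * x * (m : G)⁻¹ ∈ U) (m : M) :
    G ⧸ U ≃ₜ G ⧸ U :=
  quotHomeo (QuotientGroup.leftRel U) (Homeomorph.mulRight (m : G)⁻¹)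
    (fun a b hab => by
      rw [QuotientGroup.leftRel_apply] at hab ⊢
      simpa [mul_assoc] using hMU m _ hab)
    (fun a b hab => by
      rw [QuotientGroup.leftRel_apply] at hab ⊢
      simpa [mul_assoc, Homeomorph.mulRight_symm] using hMU m⁻¹ _ hab)

/-- `Cc^∞(U \ G, R)` with the left representation `(m · f)(U h) = f(U m⁻¹ h) χ(m)` of `M` and the
right representation `(f · g)(U h) = f(U h g⁻¹)` of `G`. -/
def restrictionBimodule (hMU : ∀ (m : M), ∀ x ∈ U, (m : G) * x * (m : G)⁻¹ ∈ U)
    (χ : SmoothChar R M) : BiRep R M G where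
  carrier := CcInf (Quotient (QuotientGroup.rightRel U)) R
  left :=
    { toFun := fun m =>
        { toFun := fun f => MulOpposite.op (val χ m) • CcInf.comp (leftMove hMU m) f
          map_zero' := by simp
          map_add' := fun f f' => by simp }
      map_one' := by
        ext f x
        obtain ⟨x, rfl⟩ := Quotient.exists_rep x
        change f (Quotient.mk _ ((((1 : M) : G))⁻¹ * x)) * val χ 1 = f (Quotient.mk _ x)
        simp [val_one]
      map_mul' := fun a b => by
        ext f x
        obtain ⟨x, rfl⟩ := Quotient.exists_rep x
        change f (Quotient.mk _ ((((a * b : M) : G))⁻¹ * x)) * val χ (a * b) =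
          f (Quotient.mk _ ((b : G)⁻¹ * ((a : G)⁻¹ * x))) * val χ b * val χ a
        rw [val_mul, Subgroup.coe_mul, mul_inv_rev, mul_assoc, mul_assoc, val_comm] }
  right :=
    { toFun := fun g =>
        { toFun := fun f => CcInf.comp (rightMove U g.unop) f
          map_zero' := by simp
          map_add' := fun f f' => by simp }
      map_one' := by
        ext f x
        obtain ⟨x, rfl⟩ := Quotient.exists_rep x
        change f (Quotient.mk _ (x * (1 : G)⁻¹)) = f (Quotient.mk _ x)
        simp
      map_mul' := fun a b => by
        ext f x
        obtain ⟨x, rfl⟩ := Quotient.exists_rep x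
        change f (Quotient.mk _ (x * (b.unop * a.unop)⁻¹)) =
          f (Quotient.mk _ ((x * a.unop⁻¹) * b.unop⁻¹))
        simp [mul_assoc] }

/-- `Cc^∞(G / U, R)` with the left representation `(g · f)(h U) = f(g⁻¹ h U)` of `G` and the
right representation `(f · m)(h U) = f(h m⁻¹ U) χ(m)⁻¹` of `M`. -/
def inductionBimodule (hMU : ∀ (m : M), ∀ x ∈ U, (m : G) * x * (m : G)⁻¹ ∈ U)
    (χ : SmoothChar R M) : BiRep R G M where
  carrier := CcInf (G ⧸ U) R
  left :=
    { toFun := fun g =>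
        { toFun := fun f => CcInf.comp (leftMove' U g) f
          map_zero' := by simp
          map_add' := fun f f' => by simp }
      map_one' := by
        ext f x
        obtain ⟨x, rfl⟩ := Quotient.exists_rep x
        change f (Quotient.mk _ ((1 : G)⁻¹ * x)) = f (Quotient.mk _ x)
        simp
      map_mul' := fun a b => by
        ext f x
        obtain ⟨x, rfl⟩ := Quotient.exists_rep x
        change f (Quotient.mk _ ((a * b)⁻¹ * x)) = f (Quotient.mk _ (b⁻¹ * (a⁻¹ * x)))
        simp [mul_assoc] }
  right :=
    { toFun := fun m =>
        { toFun := fun f =>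
            MulOpposite.op (val χ m.unop⁻¹) • CcInf.comp (rightMove' hMU m.unop) f
          map_zero' := by simp
          map_add' := fun f f' => by simp }
      map_one' := by
        ext f x
        obtain ⟨x, rfl⟩ := Quotient.exists_rep x
        change f (Quotient.mk _ (x * ((1 : M) : G)⁻¹)) * val χ (1 : M)⁻¹ = f (Quotient.mk _ x)
        simp [val_one]
      map_mul' := fun a b => by
        ext f x
        obtain ⟨x, rfl⟩ := Quotient.exists_rep x
        change f (Quotient.mk _ (x * ((b.unop * a.unop : M) : G)⁻¹)) *
            val χ (b.unop * a.unop)⁻¹ =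
          f (Quotient.mk _ ((x * (a.unop : G)⁻¹) * (b.unop : G)⁻¹)) * val χ b.unop⁻¹ *
            val χ a.unop⁻¹
        rw [mul_inv_rev, val_mul, Subgroup.coe_mul, mul_inv_rev, mul_assoc, mul_assoc, val_comm] }

end Jacquet

/-! The proof isolates a few topological properties of the groups and argues with these alone. All
groups involved are locally pro-`p`: small compact open pro-`p`-subgroups exist, namely congruence
subgroups of `GL_n` (`locallyProP_GL`) intersected with closed subgroups. Their volumes are powers
of `p`, hence central units of `R`, and an integral of a locally constant, compactly supported
function is such a unit times a finite sum over cosets (`haarIntegral_eq_sum`). Therefore every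
additive map can be moved under the integral (`map_haarIntegral`), which takes the place of Fubini
arguments.

Hecke algebras. Let e_K be the indicator function of K divided by vol(K). It acts as the identity on
K-fixed vectors, so every element of H(G) ⊗ V equals e_K ⊗ (its image in V) for small K, and V is a
smooth module. Conversely, a smooth module X ≅ H(G) ⊗ X inherits actions of R and G from the left
factor (`integrationIsEquivalence`). Right modules are treated as left modules over the opposite
ring.

Restriction. Integration over the cosets of Ū is a surjection π from C_c(G) to C_c(Ū\G), linear for
the right H(G)-action. Since Ū is a union of compact open pro-`p`-subgroups, it is unimodular, and a
function in the kernel of π is killed by averaging over a large compact subgroup of Ū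
(`map_eq_zero_of_fibreIntegral_eq_zero`). So π(φ) ⊗ v ↦ [φ v] is a well defined map to the
coinvariants. It is bijective because every tensor has the form π(e_L) ⊗ v for all small L, and this
tensor vanishes if v is trivial in the coinvariants. Left translation by m scales π by the modulus;
the square root splits this factor evenly between bimodule and functor.

Induction. The map sends f ⊗ w to the function g ↦ ∫ f(g⁻¹ m U) δ^{1/2}(m) m w dm over M, which
makes sense because M is closed in G/U. For a compact open subgroup K the set K\G/P is finite,
because G/P is compact. With representatives γ_s, every tensor is a finite sum of tensors 1_{K γ_s
U} ⊗ w_s, and the value of its image at γ_s⁻¹ involves w_s only. This gives injectivity;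
surjectivity follows because a K-invariant element of the induced representation is determined by
its values at the points γ_s⁻¹ (`isTensorFunctor_induction`).

Three facts about algebraic groups over local fields remain. M is closed in G/U, since the
projection from P to M is given by polynomials, as one sees at the universal point of P. Ū is a
union of compact open pro-`p`-subgroups by Kolchin's theorem: long products of elements u - 1
vanish, so a compact set generates a bounded ring. Finally G/P is compact: by smoothness of the
action on the projective variety, approximate solutions of y = c • g w improve quadratically, so
near each point w of the variety all points are translates of w by a fixed compact set, and finitely
many such neighbourhoods cover the variety (`AlgGrp.ProjectiveQuotient.exists_isCompact`). -/

open Filter Topology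

set_option linter.unusedSectionVars false

/-! ### The image in a ring of a real number in `ℤ[1/p]` -/

/-- The real number `x` belongs to `ℤ[1/p]`. -/
def IsPFraction (p : ℕ) (x : ℝ) : Prop := ∃ (m : ℕ) (a : ℤ), x * (p : ℝ) ^ m = a

namespace IsPFraction

variable {p : ℕ} {x y : ℝ}

theorem natCast (a : ℕ) : IsPFraction p a := ⟨0, a, by simp⟩

theorem mul (hx : IsPFraction p x) (hy : IsPFraction p y) : IsPFraction p (x * y) := by
  obtain ⟨m, a, ha⟩ := hx
  obtain ⟨l, b, hb⟩ := hy
  exact ⟨m + l, a * b, by push_cast; rw [← ha, ← hb, pow_add]; ring⟩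

theorem zpow [hp : Fact p.Prime] (k : ℤ) : IsPFraction p ((p : ℝ) ^ k) := by
  have hp0 : (p : ℝ) ≠ 0 := by exact_mod_cast hp.out.ne_zero
  obtain ⟨n, rfl | rfl⟩ := k.eq_nat_or_neg
  · exact ⟨0, (p : ℤ) ^ n, by simp⟩
  · exact ⟨n, 1, by simp [hp0]⟩

end IsPFraction

section toRing

variable {p : ℕ} [hprime : Fact p.Prime] {R : Type*} [Ring R] {x y : ℝ}

/-- The definition of `toRing` uses `Ring.inverse` of a reduced denominator, which is meaningful
only for a unit. Here the denominator divides `p ^ m`. All other facts about `toRing` follow by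
cancelling the unit `p ^ m`. -/
theorem pow_mul_toRing (hp : IsUnit (p : R)) {m : ℕ} {a : ℤ} (h : x * (p : ℝ) ^ m = a) :
    (p : R) ^ m * toRing R x = a := by
  have hp0 : (p : ℝ) ≠ 0 := by exact_mod_cast hprime.out.ne_zero
  have hp0' : (p : ℚ) ≠ 0 := by exact_mod_cast hprime.out.ne_zero
  have hex : ∃ q : ℚ, (q : ℝ) = x := by
    refine ⟨a / (p : ℚ) ^ m, ?_⟩
    push_cast
    rw [← h]
    field_simp
  rw [toRing, dif_pos hex]
  obtain ⟨q, hq, hqx⟩ : ∃ q, hex.choose = q ∧ (q : ℝ) = x := ⟨_, rfl, hex.choose_spec⟩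
  rw [hq]
  have h1 : q * (p : ℚ) ^ m = a := by
    have : ((q * (p : ℚ) ^ m : ℚ) : ℝ) = ((a : ℚ) : ℝ) := by push_cast; rw [hqx, h]
    exact_mod_cast this
  have h2 : (q.num : ℤ) * (p : ℤ) ^ m = a * q.den := by
    have h3 : (q.num : ℚ) * (p : ℚ) ^ m = a * q.den := by
      rw [← h1, ← Rat.mul_den_eq_num]; ring
    exact_mod_cast h3
  have hden : q.den ∣ p ^ m := by
    have h4 : (q.den : ℤ) ∣ q.num * (p : ℤ) ^ m := ⟨a, by rw [h2]; ring⟩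
    have h5 : IsCoprime (q.den : ℤ) q.num := by
      rw [Int.isCoprime_iff_gcd_eq_one]
      have := q.reduced
      rw [Nat.Coprime, Nat.gcd_comm] at this
      simpa [Int.gcd] using this
    exact_mod_cast h5.dvd_of_dvd_mul_left h4
  have hu : IsUnit (q.den : R) := by
    obtain ⟨j, -, hj⟩ := (Nat.dvd_prime_pow hprime.out).1 hden
    rw [hj, Nat.cast_pow]
    exact hp.pow j
  have h6 : (p : R) ^ m * (q.num : R) = a * q.den := by
    have : ((q.num * (p : ℤ) ^ m : ℤ) : R) = ((a * q.den : ℤ) : R) := by rw [h2]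
    push_cast at this
    rw [← this]
    exact ((Nat.cast_commute p (q.num : R)).pow_left m).eq
  rw [← mul_assoc, h6, mul_assoc, Ring.mul_inverse_cancel _ hu, mul_one]

theorem toRing_mul (hp : IsUnit (p : R)) (hx : IsPFraction p x) (hy : IsPFraction p y) :
    toRing R (x * y) = toRing R x * toRing R y := by
  obtain ⟨m, a, ha⟩ := hx
  obtain ⟨l, b, hb⟩ := hy
  have hab : x * y * (p : ℝ) ^ (m + l) = (a * b : ℤ) := by
    push_cast; rw [← ha, ← hb, pow_add]; ring
  have h1 := pow_mul_toRing hp ha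
  have h2 := pow_mul_toRing hp hb
  have h3 := pow_mul_toRing hp hab
  refine (hp.pow (m + l)).mul_left_cancel ?_
  rw [h3, pow_add, mul_assoc, ← mul_assoc _ (toRing R x),
    ((Nat.cast_commute p (toRing R x)).pow_left l).eq, mul_assoc (toRing R x), h2, ← mul_assoc, h1]
  push_cast
  rfl

theorem toRing_natCast (hp : IsUnit (p : R)) (n : ℕ) : toRing R (n : ℝ) = n := by
  have h : (n : ℝ) * (p : ℝ) ^ 0 = (n : ℤ) := by simp
  simpa using pow_mul_toRing hp h

theorem toRing_one (hp : IsUnit (p : R)) : toRing R 1 = 1 := by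
  simpa using toRing_natCast hp 1

theorem toRing_commute (hp : IsUnit (p : R)) (hx : IsPFraction p x) (r : R) :
    Commute (toRing R x) r := by
  obtain ⟨m, a, ha⟩ := hx
  refine (hp.pow m).mul_left_cancel ?_
  have h := pow_mul_toRing hp ha
  have h' := ((Nat.cast_commute p r).pow_left m).eq
  rw [← mul_assoc, h, ← mul_assoc, h', mul_assoc, h]
  exact (Int.cast_commute a r).eq

theorem toRing_zpow_mul_neg (hp : IsUnit (p : R)) (k : ℤ) :
    toRing R ((p : ℝ) ^ k) * toRing R ((p : ℝ) ^ (-k)) = 1 := by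
  have hp0 : (p : ℝ) ≠ 0 := by exact_mod_cast hprime.out.ne_zero
  rw [← toRing_mul hp (.zpow k) (.zpow (-k)), ← zpow_add₀ hp0, add_neg_cancel, zpow_zero,
    toRing_one hp]

theorem isUnit_toRing_zpow (hp : IsUnit (p : R)) (k : ℤ) : IsUnit (toRing R ((p : ℝ) ^ k)) :=
  ⟨⟨_, _, toRing_zpow_mul_neg hp k, by
    simpa using toRing_zpow_mul_neg hp (-k)⟩, rfl⟩

/-- An additive map commutes with integers, hence with division by powers of `p` once `p` is
invertible on both sides. No linearity over `R` is needed, and the two rings may differ; later they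
are often `R` and `Rᵐᵒᵖ`. -/
theorem map_toRing_smul (hp : IsUnit (p : R)) {S : Type*} [Ring S] (hS : IsUnit (p : S))
    {V W : Type*} [AddCommGroup V] [AddCommGroup W] [Module R V] [Module S W] (f : V →+ W)
    (hx : IsPFraction p x) (v : V) : f (toRing R x • v) = toRing S x • f v := by
  obtain ⟨m, a, ha⟩ := hx
  have h1 := pow_mul_toRing hp ha
  have h2 := pow_mul_toRing hS ha
  have key : (p ^ m : ℕ) • f (toRing R x • v) = (p ^ m : ℕ) • (toRing S x • f v) := by
    rw [← map_nsmul, ← Nat.cast_smul_eq_nsmul R, ← Nat.cast_smul_eq_nsmul S, smul_smul, smul_smul,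
      Nat.cast_pow, Nat.cast_pow, h1, h2, Int.cast_smul_eq_zsmul, Int.cast_smul_eq_zsmul,
      map_zsmul]
  rw [← Nat.cast_smul_eq_nsmul S, ← Nat.cast_smul_eq_nsmul S, Nat.cast_pow] at key
  exact ((hS.pow m).smul_left_cancel).1 key

theorem isUnit_natCast_mulOpposite (hp : IsUnit (p : R)) : IsUnit (p : Rᵐᵒᵖ) := by
  have := hp.op
  rwa [MulOpposite.op_natCast] at this

end toRing

/-! ### Groups with arbitrarily small compact open pro-`p`-subgroups -/

/-- A compact open subgroup in which the `p ^ j`-th powers of every element tend to `1`. -/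
structure IsCompactOpenProP (p : ℕ) {G : Type*} [Group G] [TopologicalSpace G] (K : Subgroup G) :
    Prop where
  isOpen : IsOpen (K : Set G)
  isCompact : IsCompact (K : Set G)
  tendsto : ∀ x ∈ K, Tendsto (fun j : ℕ => x ^ p ^ j) atTop (𝓝 1)

/-- Every neighbourhood of `1` contains a compact open pro-`p`-subgroup. -/
def LocallyProP (p : ℕ) (G : Type*) [Group G] [TopologicalSpace G] : Prop :=
  ∀ V ∈ 𝓝 (1 : G), ∃ K : Subgroup G, IsCompactOpenProP p K ∧ (K : Set G) ⊆ V

namespace IsCompactOpenProP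

variable {p : ℕ} {G : Type*} [Group G] [TopologicalSpace G] [IsTopologicalGroup G] {K L : Subgroup G}

theorem of_le (hK : IsCompactOpenProP p K) (hL : IsOpen (L : Set G)) (h : L ≤ K) :
    IsCompactOpenProP p L :=
  ⟨hL, hK.isCompact.of_isClosed_subset (L.isClosed_of_isOpen hL) h,
    fun x hx => hK.tendsto x (h hx)⟩

theorem inf (hK : IsCompactOpenProP p K) (hL : IsCompactOpenProP p L) :
    IsCompactOpenProP p (K ⊓ L) :=
  hK.of_le (hK.isOpen.inter hL.isOpen) inf_le_left

/-- Convergence of `x ^ p ^ j` to `1` makes every discrete quotient of `K` a `p`-group, finite by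
compactness. The convergence condition is easier to handle than `IsProP`: it passes at once to
subgroups and images, and for matrices it is a valuation estimate. -/
theorem isProP [hprime : Fact p.Prime] (hK : IsCompactOpenProP p K) : IsProP p K := by
  refine ⟨hK.isCompact, fun N hN hNo => ?_⟩
  have : CompactSpace K := isCompact_iff_compactSpace.1 hK.isCompact
  have hfin : Finite (K ⧸ N) := Subgroup.quotient_finite_of_isOpen N hNo
  have hpg : IsPGroup p (K ⧸ N) := by
    intro q
    obtain ⟨x, rfl⟩ := QuotientGroup.mk_surjective q
    have h1 : Tendsto (fun j : ℕ => x ^ p ^ j) atTop (𝓝 (1 : K)) := by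
      rw [tendsto_subtype_rng]
      simpa using hK.tendsto x x.2
    obtain ⟨j, hj⟩ := (h1.eventually (hNo.mem_nhds N.one_mem)).exists
    refine ⟨j, ?_⟩
    rw [← QuotientGroup.mk_pow, QuotientGroup.eq_one_iff]
    exact hj
  obtain ⟨k, hk⟩ := IsPGroup.iff_card.1 hpg
  exact ⟨k, hk⟩

theorem map_conj (hK : IsCompactOpenProP p K) (g : G) :
    IsCompactOpenProP p (K.map (MulAut.conj g).toMonoidHom) := by
  have hc : Continuous fun x : G => g * x * g⁻¹ := by fun_prop
  have himg : (K.map (MulAut.conj g).toMonoidHom : Set G) = (fun x : G => g * x * g⁻¹) '' K := by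
    ext x; simp
  refine ⟨?_, ?_, ?_⟩
  · rw [himg]
    exact ((Homeomorph.mulLeft g).trans (Homeomorph.mulRight g⁻¹)).isOpenMap _ hK.isOpen
  · rw [himg]
    exact hK.isCompact.image hc
  · rintro _ ⟨x, hx, rfl⟩
    have := (hc.tendsto 1).comp (hK.tendsto x hx)
    simp only [mul_one, mul_inv_cancel] at this
    refine this.congr fun j => ?_
    simp [conj_pow]

/-- `IsProP` only speaks of normal subgroups. The normal core of `L ∩ K` in `K` is closed of finite
index, hence open, and the index of the larger subgroup divides its index. -/
theorem _root_.IsProP.relIndex_eq [hprime : Fact p.Prime] (hK : IsProP p K)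
    (hL : IsOpen (L : Set G)) : ∃ k, L.relIndex K = p ^ k := by
  have : CompactSpace K := isCompact_iff_compactSpace.1 hK.1
  have hLK : IsOpen (L.subgroupOf K : Set K) := hL.preimage continuous_subtype_val
  have hfin : (L.subgroupOf K).FiniteIndex := by
    have := Subgroup.quotient_finite_of_isOpen _ hLK
    exact Subgroup.finiteIndex_of_finite_quotient
  have hcore : IsOpen ((L.subgroupOf K).normalCore : Set K) := by
    have hcl : IsClosed ((L.subgroupOf K).normalCore : Set K) := 
      Subgroup.normalCore_isClosed _ (Subgroup.isClosed_of_isOpen _ hLK)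
    exact Subgroup.isOpen_of_isClosed_of_finiteIndex _ hcl
  obtain ⟨k, hk⟩ := hK.2 _ inferInstance hcore
  have : L.relIndex K ∣ p ^ k := hk ▸ Subgroup.index_dvd_of_le (Subgroup.normalCore_le _)
  obtain ⟨j, -, hj⟩ := (Nat.dvd_prime_pow hprime.out).1 this
  exact ⟨j, hj⟩

end IsCompactOpenProP

theorem LocallyProP.exists_le {p : ℕ} {G : Type*} [Group G] [TopologicalSpace G]
    [IsTopologicalGroup G] (hG : LocallyProP p G) {K : Subgroup G} (hK : IsOpen (K : Set G)) :
    ∃ L ≤ K, IsCompactOpenProP p L := by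
  obtain ⟨L, hL, h⟩ := hG K (hK.mem_nhds K.one_mem)
  exact ⟨L, h, hL⟩

/-- A locally constant function with compact support is invariant under a compact open
pro-`p`-subgroup of a group that acts continuously. -/
theorem LocallyProP.exists_forall_eq {p : ℕ} {H X V : Type*} [Group H] [TopologicalSpace H]
    [TopologicalSpace X] [Zero V] (hH : LocallyProP p H) (a : H → X → X)
    (ha : Continuous fun z : H × X => a z.1 z.2) (h1 : ∀ x, a 1 x = x)
    (hinv : ∀ h x, a h⁻¹ (a h x) = x) {F : X → V} (hF : IsLocallyConstant F)
    (hF' : HasCompactSupport F) :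
    ∃ K : Subgroup H, IsCompactOpenProP p K ∧ ∀ k ∈ K, ∀ x, F (a k x) = F x := by
  have hopen : IsOpen {z : H × X | F (a z.1 z.2) = F z.2} := by
    rw [isOpen_iff_mem_nhds]
    intro z hz
    have e1 := ((hF.comp_continuous ha).eventually_eq z)
    have e2 := ((hF.comp_continuous (continuous_snd (X := H))).eventually_eq z)
    filter_upwards [e1, e2] with w hw1 hw2
    have hz' : F (a z.1 z.2) = F z.2 := hz
    exact hw1.trans (hz'.trans hw2.symm)
  -- The open set contains `{1} × tsupport F` with compact factors, so the tube lemma gives a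
  -- neighbourhood of `1` whose elements do not change `F` on its support.
  obtain ⟨N, W, hN, -, h1N, hW, hNW⟩ := generalized_tube_lemma (isCompact_singleton (x := (1 : H)))
    hF' hopen (by rintro ⟨h, x⟩ ⟨rfl, -⟩; simp [h1])
  obtain ⟨K, hK, hKN⟩ := hH N (hN.mem_nhds (h1N rfl))
  refine ⟨K, hK, fun k hk x => ?_⟩
  -- If `x` lies outside the support and `a k x` inside, this is applied to `k⁻¹` at `a k x`; if
  -- both lie outside, both values are zero.
  have main : ∀ k ∈ K, ∀ x ∈ tsupport F, F (a k x) = F x := fun k hk x hx =>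
    hNW (Set.mk_mem_prod (hKN hk) (hW hx))
  by_cases hx : x ∈ tsupport F
  · exact main k hk x hx
  by_cases hx' : a k x ∈ tsupport F
  · have := main k⁻¹ (K.inv_mem hk) _ hx'
    rw [hinv] at this
    exact this.symm
  · rw [image_eq_zero_of_notMem_tsupport hx, image_eq_zero_of_notMem_tsupport hx']

/-! ### Integration of locally constant functions with compact support -/

/-- The volume of a set as an element of the ring `R`. -/
noncomputable def ringVol (R : Type*) [Ring R] {G : Type*} [TopologicalSpace G]
    (μ : @Measure G (borel G)) (A : Set G) : R := toRing R (μ A).toReal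

/-- Locally constant functions with compact support. -/
def IsLcc {X V : Type*} [TopologicalSpace X] [Zero V] (F : X → V) : Prop :=
  IsLocallyConstant F ∧ HasCompactSupport F

namespace IsLcc

variable {X Y V W : Type*} [TopologicalSpace X] [TopologicalSpace Y]

theorem comp_left [Zero V] [Zero W] {F : X → V} (hF : IsLcc F) {f : V → W} (hf : f 0 = 0) :
    IsLcc fun x => f (F x) :=
  ⟨hF.1.comp f, hF.2.comp_left hf⟩

theorem comp_homeomorph [Zero V] {F : X → V} (hF : IsLcc F) (e : Y ≃ₜ X) :
    IsLcc fun y => F (e y) :=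
  ⟨hF.1.comp_continuous e.continuous, hF.2.comp_homeomorph e⟩

theorem comp_isClosedEmbedding [Zero V] {F : X → V} (hF : IsLcc F) {e : Y → X}
    (he : IsClosedEmbedding e) : IsLcc fun y => F (e y) :=
  ⟨hF.1.comp_continuous he.continuous, hF.2.comp_isClosedEmbedding he⟩

theorem of_support_subset [Zero V] {F : X → V} (hF : IsLocallyConstant F) {C : Set X}
    (hC : IsCompact C) (h : ∀ x, F x ≠ 0 → x ∈ C) : IsLcc F := by
  refine ⟨hF, ?_⟩
  have hcl : IsClosed (Function.support F) := by
    rw [← isOpen_compl_iff, Function.compl_support]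
    exact hF {0}
  rw [HasCompactSupport, tsupport, hcl.closure_eq]
  exact hC.of_isClosed_subset hcl h

end IsLcc

theorem CcInf.isLcc {X : Type*} [TopologicalSpace X] {R : Type*} [Ring R] (f : CcInf X R) :
    IsLcc (f : X → R) := f.2

section

variable {p : ℕ} [hprime : Fact p.Prime] {G : Type*} [Group G] [TopologicalSpace G]
  [IsTopologicalGroup G] {μ : @Measure G (borel G)} {R : Type*} [Ring R]
  {V W : Type*} [AddCommGroup V] [Module R V] [AddCommGroup W]

theorem IsNormalizedHaar.measure_preimage_mul (hμ : IsNormalizedHaar p μ) (g : G) (A : Set G) :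
    μ ((fun x => g * x) ⁻¹' A) = μ A := by
  let _ : MeasurableSpace G := borel G
  have : BorelSpace G := ⟨rfl⟩
  have : Measure.IsHaarMeasure μ := hμ.1
  exact MeasureTheory.measure_preimage_mul μ g A

theorem IsNormalizedHaar.measure_eq (hμ : IsNormalizedHaar p μ) {K : Subgroup G}
    (hK : IsCompactOpenProP p K) : ∃ k : ℤ, μ (K : Set G) = ENNReal.ofReal ((p : ℝ) ^ k) :=
  hμ.2 K hK.isOpen hK.isProP

theorem IsNormalizedHaar.toReal_eq (hμ : IsNormalizedHaar p μ) {K : Subgroup G}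
    (hK : IsCompactOpenProP p K) : ∃ k : ℤ, (μ (K : Set G)).toReal = (p : ℝ) ^ k := by
  obtain ⟨k, hk⟩ := hμ.measure_eq hK
  exact ⟨k, by rw [hk, ENNReal.toReal_ofReal (by positivity)]⟩

theorem IsNormalizedHaar.isPFraction (hμ : IsNormalizedHaar p μ) {K : Subgroup G}
    (hK : IsCompactOpenProP p K) : IsPFraction p (μ (K : Set G)).toReal := by
  obtain ⟨k, hk⟩ := hμ.toReal_eq hK
  exact hk ▸ .zpow k

theorem isUnit_ringVol (hp : IsUnit (p : R)) (hμ : IsNormalizedHaar p μ) {K : Subgroup G}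
    (hK : IsCompactOpenProP p K) : IsUnit (ringVol R μ K) := by
  obtain ⟨k, hk⟩ := hμ.toReal_eq hK
  rw [ringVol, hk]
  exact isUnit_toRing_zpow hp k

theorem ringVol_commute (hp : IsUnit (p : R)) (hμ : IsNormalizedHaar p μ) {K : Subgroup G}
    (hK : IsCompactOpenProP p K) (r : R) : Commute (ringVol R μ K) r :=
  toRing_commute hp (hμ.isPFraction hK) r

theorem map_ringVol_smul (hp : IsUnit (p : R)) {S : Type*} [Ring S] (hS : IsUnit (p : S))
    [Module S W] (hμ : IsNormalizedHaar p μ) {K : Subgroup G}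
    (hK : IsCompactOpenProP p K) (f : V →+ W) (v : V) :
    f (ringVol R μ K • v) = ringVol S μ K • f v :=
  map_toRing_smul hp hS f (hμ.isPFraction hK) v

-- `A` is a disjoint union of left cosets of `K`, all of the same measure by left invariance. `T`
-- may contain superfluous cosets, which the filter removes.
omit hprime in
open Classical in
theorem measure_eq_card (hμ : @Measure.IsHaarMeasure G _ _ (borel G) μ) {K : Subgroup G}
    (hK : IsOpen (K : Set G)) {A : Set G} (hA : ∀ k ∈ K, ∀ g, g * k ∈ A ↔ g ∈ A)
    (T : Finset (G ⧸ K)) (hT : ∀ g ∈ A, (g : G ⧸ K) ∈ T) :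
    μ A = (T.filter fun q => q.out ∈ A).card * μ (K : Set G) := by
  let _ : MeasurableSpace G := borel G
  have : BorelSpace G := ⟨rfl⟩
  have hout : ∀ g : G, (g : G ⧸ K).out ∈ A ↔ g ∈ A := fun g => by
    obtain ⟨k, hk⟩ := QuotientGroup.mk_out_eq_mul K g
    rw [hk, hA _ k.2]
  have hvol : ∀ q : G ⧸ K, μ {g : G | (g : G ⧸ K) = q} = μ (K : Set G) := fun q => by
    rw [← measure_preimage_mul μ q.out⁻¹ (K : Set G)]
    congr 1
    ext g
    simp only [Set.mem_ofPred_eq, Set.mem_preimage, SetLike.mem_coe]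
    rw [← QuotientGroup.eq, QuotientGroup.out_eq', eq_comm]
  have h1 : A = ⋃ q ∈ T.filter fun q => q.out ∈ A, {g : G | (g : G ⧸ K) = q} := by
    ext g
    simp only [Finset.mem_filter, Set.mem_iUnion,
      Set.mem_ofPred_eq, exists_prop, exists_eq_right', hout]
    exact ⟨fun h => ⟨hT g h, h⟩, fun h => h.2⟩
  conv_lhs => rw [h1]
  rw [measure_biUnion_finset]
  · simp [hvol]
  · intro q _ q' _ hqq
    exact Set.disjoint_left.2 fun g hg hg' => hqq (hg.symm.trans hg')
  · intro q _
    have : IsOpen {g : G | (g : G ⧸ K) = q} := by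
      have hd : DiscreteTopology (G ⧸ K) := QuotientGroup.discreteTopology hK
      exact (isOpen_discrete {q}).preimage continuous_quotient_mk'
    exact this.measurableSet

/-- The integral of a function that is right invariant under a subgroup as a finite sum over
cosets. -/
theorem haarIntegral_eq_sum (hp : IsUnit (p : R)) (hμ : IsNormalizedHaar p μ) {K : Subgroup G}
    (hK : IsCompactOpenProP p K) {F : G → V} (hF : ∀ k ∈ K, ∀ g, F (g * k) = F g)
    (T : Finset (G ⧸ K)) (hT : ∀ g, F g ≠ 0 → (g : G ⧸ K) ∈ T) :
    haarIntegral R μ F = ringVol R μ K • ∑ q ∈ T, F q.out := by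
  classical
  -- The fibre over `0` need not have finite measure, but its coefficient multiplies the vector `0`;
  -- only the other fibres are unions of cosets from `T`.
  have hval : ∀ v : V, v ≠ 0 → toRing R (μ (F ⁻¹' {v})).toReal =
      (T.filter fun q => F q.out = v).card * ringVol R μ K := fun v hv => by
    rw [measure_eq_card hμ.1 hK.isOpen (A := F ⁻¹' {v}) (fun k hk g => by simp [hF k hk]) T
      (fun g hg => hT g (by rw [show F g = v from hg]; exact hv)), ENNReal.toReal_mul,
      ENNReal.toReal_natCast, toRing_mul hp (.natCast _) (hμ.isPFraction hK), toRing_natCast hp]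
    rfl
  have hsum : ∑ q ∈ T, F q.out =
      ∑ v ∈ T.image fun q => F q.out, (T.filter fun q => F q.out = v).card • v :=
    Finset.sum_comp (fun v => v) (fun q : G ⧸ K => F q.out)
  rw [haarIntegral, hsum, Finset.smul_sum, finsum_eq_sum_of_support_subset]
  · refine Finset.sum_congr rfl fun v _ => ?_
    by_cases hv : v = 0
    · simp [hv]
    · rw [hval v hv, ← Nat.cast_smul_eq_nsmul R, smul_smul]
      rw [(Nat.cast_commute _ (ringVol R μ (K : Set G))).eq]
  · intro v hv
    have hv0 : v ≠ 0 := by rintro rfl; simp at hv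
    by_contra hvT
    apply hv
    dsimp only
    have : (T.filter fun q => F q.out = v) = ∅ := by
      rw [Finset.filter_eq_empty_iff]
      intro q hq hqv
      exact hvT (by simpa using ⟨q, hq, hqv⟩)
    rw [hval v hv0, this]
    simp

/-- A compact set meets only finitely many cosets of an open subgroup. -/
theorem exists_finset_cosets {K : Subgroup G} (hK : IsOpen (K : Set G)) {C : Set G}
    (hC : IsCompact C) : ∃ T : Finset (G ⧸ K), ∀ g ∈ C, (g : G ⧸ K) ∈ T := by
  have hd : DiscreteTopology (G ⧸ K) := QuotientGroup.discreteTopology hK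
  have hfin : ((fun g : G => (g : G ⧸ K)) '' C).Finite :=
    (hC.image continuous_quotient_mk').finite_of_discrete
  exact ⟨hfin.toFinset, fun g hg => by simpa using ⟨g, hg, rfl⟩⟩

theorem IsLcc.exists_finset {F : G → V} (hF : IsLcc F) {K : Subgroup G} (hK : IsOpen (K : Set G)) :
    ∃ T : Finset (G ⧸ K), ∀ g, F g ≠ 0 → (g : G ⧸ K) ∈ T := by
  obtain ⟨T, hT⟩ := exists_finset_cosets hK hF.2
  exact ⟨T, fun g hg => hT g (subset_tsupport _ hg)⟩

omit hprime in
theorem IsLcc.exists_right_invariant {V : Type*} [Zero V] (hG : LocallyProP p G) {F : G → V}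
    (hF : IsLcc F) :
    ∃ K : Subgroup G, IsCompactOpenProP p K ∧ ∀ k ∈ K, ∀ g, F (g * k) = F g :=
  hG.exists_forall_eq (fun k g => g * k) (by fun_prop) (by simp) (by simp) hF.1 hF.2

omit hprime in
theorem IsLcc.exists_left_invariant {V : Type*} [Zero V] (hG : LocallyProP p G) {F : G → V}
    (hF : IsLcc F) :
    ∃ K : Subgroup G, IsCompactOpenProP p K ∧ ∀ k ∈ K, ∀ g, F (k * g) = F g :=
  hG.exists_forall_eq (fun k g => k * g) (by fun_prop) (by simp) (by simp) hF.1 hF.2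

variable (hp : IsUnit (p : R)) (hμ : IsNormalizedHaar p μ) (hG : LocallyProP p G)

include hp hμ hG

/-- Every additive map commutes with integration. -/
theorem map_haarIntegral {S : Type*} [Ring S] (hS : IsUnit (p : S)) [Module S W] (f : V →+ W)
    {F : G → V} (hF : IsLcc F) : f (haarIntegral R μ F) = haarIntegral S μ fun g => f (F g) := by
  obtain ⟨K, hK, hFK⟩ := hF.exists_right_invariant hG
  obtain ⟨T, hT⟩ := hF.exists_finset hK.isOpen
  rw [haarIntegral_eq_sum hp hμ hK hFK T hT, haarIntegral_eq_sum hS hμ hK (F := fun g => f (F g))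
    (fun k hk g => by rw [hFK k hk]) T (fun g hg => hT g fun h => hg (by simp [h])),
    map_ringVol_smul hp hS hμ hK, map_sum]

/-- The level sets of a sum are not related to those of the summands, so additivity is read off from
the coset sums for a subgroup under which both functions are invariant. -/
theorem haarIntegral_add {F F' : G → V} (hF : IsLcc F) (hF' : IsLcc F') :
    haarIntegral R μ (fun g => F g + F' g) = haarIntegral R μ F + haarIntegral R μ F' := by
  classical
  obtain ⟨K, hK, hFK⟩ := hF.exists_right_invariant hG
  obtain ⟨K', hK', hFK'⟩ := hF'.exists_right_invariant hG
  obtain ⟨T, hT⟩ := hF.exists_finset (hK.inf hK').isOpen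
  obtain ⟨T', hT'⟩ := hF'.exists_finset (hK.inf hK').isOpen
  have h1 : ∀ g, F g ≠ 0 → (g : G ⧸ (K ⊓ K')) ∈ T ∪ T' := fun g hg =>
    Finset.mem_union_left _ (hT g hg)
  have h2 : ∀ g, F' g ≠ 0 → (g : G ⧸ (K ⊓ K')) ∈ T ∪ T' := fun g hg =>
    Finset.mem_union_right _ (hT' g hg)
  rw [haarIntegral_eq_sum hp hμ (hK.inf hK') (fun k hk g => hFK k hk.1 g) _ h1,
    haarIntegral_eq_sum hp hμ (hK.inf hK') (fun k hk g => hFK' k hk.2 g) _ h2, ← smul_add,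
    ← Finset.sum_add_distrib]
  refine haarIntegral_eq_sum hp hμ (hK.inf hK')
    (fun k hk g => by rw [hFK k hk.1, hFK' k hk.2]) _ fun g hg => ?_
  by_cases h : F g = 0
  · exact h2 g fun h' => hg (by simp [h, h'])
  · exact h1 g h

omit hp hG in
theorem haarIntegral_mul_left (F : G → V) (x : G) :
    haarIntegral R μ (fun g => F (x * g)) = haarIntegral R μ F := by
  unfold haarIntegral
  congr 1
  ext v
  rw [← hμ.measure_preimage_mul x (F ⁻¹' {v})]
  rfl

omit hG in
/-- The integral of a function with one value on a coset and vanishing elsewhere. -/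
theorem haarIntegral_coset {K : Subgroup G} (hK : IsCompactOpenProP p K) (x : G) {F : G → V} {v : V}
    (h1 : ∀ k ∈ K, F (x * k) = v) (h0 : ∀ g, x⁻¹ * g ∉ K → F g = 0) :
    haarIntegral R μ F = ringVol R μ K • v := by
  classical
  have hF : ∀ k ∈ K, ∀ g, F (g * k) = F g := by
    intro k hk g
    by_cases hg : x⁻¹ * g ∈ K
    · have e1 := h1 _ hg
      have e2 := h1 _ (K.mul_mem hg hk)
      rw [← mul_assoc, mul_inv_cancel_left] at e2
      rw [mul_inv_cancel_left] at e1
      rw [e1, e2]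
    · rw [h0 g hg, h0 (g * k) fun h => hg ?_]
      rw [← mul_assoc] at h
      exact (K.mul_mem_cancel_right hk).1 h
  rw [haarIntegral_eq_sum hp hμ hK hF {(x : G ⧸ K)}, Finset.sum_singleton]
  · obtain ⟨k, hk⟩ := QuotientGroup.mk_out_eq_mul K x
    rw [hk, h1 _ k.2]
  · intro g hg
    rw [Finset.mem_singleton, eq_comm, QuotientGroup.eq]
    by_contra h
    exact hg (h0 g h)

omit hp hμ hG in
theorem haarIntegral_zero : haarIntegral R μ (fun _ => (0 : V)) = 0 := by
  classical
  unfold haarIntegral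
  refine finsum_eq_zero_of_forall_eq_zero fun v => ?_
  by_cases hv : v = 0
  · simp [hv]
  · have : (fun _ : G => (0 : V)) ⁻¹' {v} = ∅ := by
      ext; simp [Ne.symm hv]
    rw [this, measure_empty]
    have h0 : toRing R (0 : ENNReal).toReal = 0 := by
      rw [ENNReal.toReal_zero, toRing]
      have hex : ∃ q : ℚ, (q : ℝ) = 0 := ⟨0, by simp⟩
      rw [dif_pos hex]
      have : hex.choose = 0 := by exact_mod_cast hex.choose_spec
      rw [this]; simp
    rw [h0, zero_smul]

end

/-! ### Balanced tensor products -/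

namespace BalTensor

variable {A Y V Z : Type*} [AddCommGroup Y] [AddCommGroup V] [AddCommGroup Z] {ra : Y → A → Y}
  {la : A → V → V}

/-- Elementary tensors as a biadditive map. -/
def tmulHom (ra : Y → A → Y) (la : A → V → V) : Y →+ V →+ BalTensor ra la where
  toFun y :=
    { toFun := fun v => tmul ra la y v
      map_zero' := by simp [tmul]
      map_add' := fun v w => by simp [tmul, TensorProduct.tmul_add] }
  map_zero' := by ext v; simp [tmul]
  map_add' y y' := by ext v; simp [tmul, TensorProduct.add_tmul]

@[simp] theorem tmulHom_apply (y : Y) (v : V) : tmulHom ra la y v = tmul ra la y v := rfl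

theorem tmul_add (y : Y) (v v' : V) : tmul ra la y (v + v') = tmul ra la y v + tmul ra la y v' := by
  simp [← tmulHom_apply]

theorem tmul_zero (y : Y) : tmul ra la y 0 = 0 := by simp [← tmulHom_apply]

theorem tmul_sub (y : Y) (v v' : V) : tmul ra la y (v - v') = tmul ra la y v - tmul ra la y v' := by
  simp [← tmulHom_apply]

theorem sum_tmul {ι : Type*} (s : Finset ι) (y : ι → Y) (v : V) :
    tmul ra la (∑ i ∈ s, y i) v = ∑ i ∈ s, tmul ra la (y i) v := by
  simp [← tmulHom_apply]

theorem balanced (y : Y) (a : A) (v : V) : tmul ra la (ra y a) v = tmul ra la y (la a v) := by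
  rw [tmul, tmul, Submodule.Quotient.eq]
  exact Submodule.subset_span ⟨y, a, v, rfl⟩

theorem induction_on {P : BalTensor ra la → Prop} (z : BalTensor ra la) (h0 : P 0)
    (ht : ∀ y v, P (tmul ra la y v)) (ha : ∀ z w, P z → P w → P (z + w)) : P z := by
  obtain ⟨z, rfl⟩ := Submodule.Quotient.mk_surjective _ z
  induction z using TensorProduct.induction_on with
  | zero => exact h0
  | tmul y v => exact ht y v
  | add z w hz hw => exact ha _ _ hz hw

/-- The additive map defined by a balanced biadditive map. -/
def lift (t : Y →+ V →+ Z) (ht : ∀ y a v, t (ra y a) v = t y (la a v)) : BalTensor ra la →+ Z :=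
  ((Submodule.span ℤ _).liftQ
    (TensorProduct.liftAddHom t (by simp)).toIntLinearMap (by
      rw [Submodule.span_le]
      rintro _ ⟨y, a, v, rfl⟩
      simp [ht])).toAddMonoidHom

@[simp] theorem lift_tmul (t : Y →+ V →+ Z) (ht : ∀ y a v, t (ra y a) v = t y (la a v)) (y : Y)
    (v : V) : lift t ht (tmul ra la y v) = t y v := by
  simp [lift, tmul]

end BalTensor

/-! ### Functions with compact support -/

theorem IsLcc.smul {X R V : Type*} [TopologicalSpace X] [Ring R] [AddCommGroup V] [Module R V]
    {φ : X → R} (hφ : IsLcc φ) {F : X → V} (hF : IsLocallyConstant F) :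
    IsLcc fun x => φ x • F x := by
  refine IsLcc.of_support_subset ?_ hφ.2 fun x hx => subset_tsupport _ fun h => hx (by simp [h])
  rw [IsLocallyConstant.iff_eventually_eq]
  intro x
  filter_upwards [hφ.1.eventually_eq x, hF.eventually_eq x] with y h1 h2
  rw [h1, h2]

theorem isLocallyConstant_of_right_invariant {G V : Type*} [Group G] [TopologicalSpace G]
    [IsTopologicalGroup G] {K : Subgroup G} (hK : IsOpen (K : Set G)) {F : G → V}
    (h : ∀ k ∈ K, ∀ g, F (g * k) = F g) : IsLocallyConstant F := by
  rw [IsLocallyConstant.iff_eventually_eq]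
  intro x
  have : ∀ᶠ y in 𝓝 x, x⁻¹ * y ∈ K := by
    have hc : ContinuousAt (fun y => x⁻¹ * y) x := by fun_prop
    exact hc.eventually_mem (hK.mem_nhds (by simp))
  filter_upwards [this] with y hy
  simpa using h _ hy x

namespace CcInf

variable {X R : Type*} [TopologicalSpace X] [Ring R]

@[simp] theorem coe_mk (f : X → R) (hf : f ∈ CcInf X R) : ((⟨f, hf⟩ : CcInf X R) : X → R) = f := rfl

@[simp] theorem add_apply (f g : CcInf X R) (x : X) : (f + g) x = f x + g x := rfl

@[simp] theorem zero_apply (x : X) : (0 : CcInf X R) x = 0 := rfl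

@[simp] theorem smul_apply (r : R) (f : CcInf X R) (x : X) : (r • f) x = r * f x := rfl

@[simp] theorem op_smul_apply (r : Rᵐᵒᵖ) (f : CcInf X R) (x : X) :
    (r • f) x = f x * r.unop := rfl

theorem ext {f g : CcInf X R} (h : ∀ x, f x = g x) : f = g := Subtype.ext (funext h)

/-- Evaluation at a point. -/
def eval (x : X) : CcInf X R →+ R where
  toFun f := f x
  map_zero' := rfl
  map_add' _ _ := rfl

@[simp] theorem eval_apply (x : X) (f : CcInf X R) : eval x f = f x := rfl

@[simp] theorem sum_apply {ι : Type*} (s : Finset ι) (f : ι → CcInf X R) (x : X) :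
    (∑ i ∈ s, f i : CcInf X R) x = ∑ i ∈ s, f i x := by
  rw [← eval_apply, map_sum]; rfl

open Classical in
/-- The function with value `r` on the compact open set `A` and `0` elsewhere. -/
noncomputable def single (A : Set X) (ho : IsClopen A) (hc : IsCompact A) (r : R) : CcInf X R :=
  ⟨fun x => if x ∈ A then r else 0, by
    refine IsLcc.of_support_subset ?_ hc fun x hx => by_contra fun h => hx (if_neg h)
    rw [IsLocallyConstant.iff_eventually_eq]
    intro x
    by_cases hx : x ∈ A
    · filter_upwards [ho.isOpen.mem_nhds hx] with y hy
      rw [if_pos hy, if_pos hx]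
    · filter_upwards [ho.compl.isOpen.mem_nhds hx] with y hy
      rw [if_neg hy, if_neg hx]⟩

theorem single_of_mem {A : Set X} (ho : IsClopen A) (hc : IsCompact A) (r : R) {x : X}
    (hx : x ∈ A) : single A ho hc r x = r := if_pos hx

theorem single_of_notMem {A : Set X} (ho : IsClopen A) (hc : IsCompact A) (r : R) {x : X}
    (hx : x ∉ A) : single A ho hc r x = 0 := if_neg hx

end CcInf

namespace IsCompactOpenProP

variable {p : ℕ} {G : Type*} [Group G] [TopologicalSpace G] [IsTopologicalGroup G] {K : Subgroup G}
  (hK : IsCompactOpenProP p K) (x : G)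

include hK

theorem isClopen : IsClopen (K : Set G) := ⟨K.isClosed_of_isOpen hK.isOpen, hK.isOpen⟩

theorem isClopen_coset : IsClopen ((fun g => x⁻¹ * g) ⁻¹' (K : Set G)) :=
  hK.isClopen.preimage (by fun_prop)

theorem isCompact_coset : IsCompact ((fun g => x⁻¹ * g) ⁻¹' (K : Set G)) :=
  (Homeomorph.mulLeft x⁻¹).isCompact_preimage.2 hK.isCompact

end IsCompactOpenProP

/-- The function on `G` with value `vol(K)⁻¹ r` on `x K` and `0` elsewhere. -/
noncomputable def cosetFn {p : ℕ} {G : Type*} [Group G] [TopologicalSpace G]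
    [IsTopologicalGroup G] (μ : @Measure G (borel G)) {R : Type*} [Ring R] {K : Subgroup G}
    (hK : IsCompactOpenProP p K) (x : G) (r : R) : CcInf G R :=
  CcInf.single _ (hK.isClopen_coset x) (hK.isCompact_coset x) (Ring.inverse (ringVol R μ K) * r)

theorem cosetFn_of_mem {p : ℕ} {G : Type*} [Group G] [TopologicalSpace G]
    [IsTopologicalGroup G] (μ : @Measure G (borel G)) {R : Type*} [Ring R] {K : Subgroup G}
    (hK : IsCompactOpenProP p K) (x : G) (r : R) {g : G} (hg : x⁻¹ * g ∈ K) :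
    cosetFn μ hK x r g = Ring.inverse (ringVol R μ K) * r :=
  CcInf.single_of_mem _ _ _ hg

theorem cosetFn_of_notMem {p : ℕ} {G : Type*} [Group G] [TopologicalSpace G]
    [IsTopologicalGroup G] (μ : @Measure G (borel G)) {R : Type*} [Ring R] {K : Subgroup G}
    (hK : IsCompactOpenProP p K) (x : G) (r : R) {g : G} (hg : x⁻¹ * g ∉ K) :
    cosetFn μ hK x r g = 0 :=
  CcInf.single_of_notMem _ _ _ hg

/-! ### Smooth representations as modules over the Hecke algebra -/

/-- The additive group of functions with the left regular representation. -/
def leftRegular (p : ℕ) (R : Type u) [Ring R] (G : Type u) [Group G] [TopologicalSpace G]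
    [IsTopologicalGroup G] (hG : LocallyProP p G) : SmoothRep R G where
  carrier := CcInf G R
  ρ :=
    { toFun := fun g => CcInf.comp (Homeomorph.mulLeft g⁻¹)
      map_one' := by ext f x; simp
      map_mul' := fun g h => by ext f x; simp [mul_assoc] }
  smooth f := by
    obtain ⟨K, hK, h⟩ := (CcInf.isLcc f).exists_left_invariant hG
    exact ⟨K, hK.isOpen, fun k hk => CcInf.ext fun x => h _ (K.inv_mem hk) x⟩

namespace SmoothRep

variable {p : ℕ} [hprime : Fact p.Prime] {R : Type u} [Ring R] {G : Type u} [Group G]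
  [TopologicalSpace G] [IsTopologicalGroup G] {μ : @Measure G (borel G)} (V W : SmoothRep R G)

theorem isLocallyConstant_orbit (v : V) : IsLocallyConstant fun g => V.ρ g v := by
  obtain ⟨K, hK, h⟩ := V.smooth v
  exact isLocallyConstant_of_right_invariant hK fun k hk g => by simp [h k hk]

theorem isLcc_smul (φ : CcInf G R) (v : V) : IsLcc fun g => φ g • V.ρ g v :=
  (CcInf.isLcc φ).smul (V.isLocallyConstant_orbit v)

theorem exists_fixed (hG : LocallyProP p G) (v : V) :
    ∃ K : Subgroup G, IsCompactOpenProP p K ∧ ∀ k ∈ K, V.ρ k v = v := by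
  obtain ⟨K, hK, h⟩ := V.smooth v
  obtain ⟨L, hLK, hL⟩ := hG.exists_le hK
  exact ⟨L, hL, fun k hk => h k (hLK hk)⟩

variable (hp : IsUnit (p : R)) (hμ : IsNormalizedHaar p μ) (hG : LocallyProP p G)

include hp hμ

/-- The integrand is constant on `x K`, and the volume of `K` cancels. Thus the Hecke action
recovers scalars and group elements, and for `x = 1`, `r = 1` it contains local units. -/
theorem heckeAct_cosetFn {K : Subgroup G} (hK : IsCompactOpenProP p K) (x : G) (r : R) {v : V}
    (hv : ∀ k ∈ K, V.ρ k v = v) : V.heckeAct μ (cosetFn μ hK x r) v = r • V.ρ x v := by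
  rw [heckeAct, haarIntegral_coset hp hμ hK x
    (v := Ring.inverse (ringVol R μ K) • r • V.ρ x v), smul_smul,
    Ring.mul_inverse_cancel _ (isUnit_ringVol hp hμ hK), one_smul]
  · intro k hk
    rw [cosetFn_of_mem _ _ _ _ (by simpa using hk), map_mul, Module.End.mul_apply,
      hv k hk, smul_smul]
  · intro g hg
    rw [cosetFn_of_notMem _ _ _ _ hg, zero_smul]

include hG

theorem add_heckeAct (φ ψ : CcInf G R) (v : V) :
    V.heckeAct μ (φ + ψ) v = V.heckeAct μ φ v + V.heckeAct μ ψ v := by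
  rw [heckeAct, heckeAct, heckeAct, ← haarIntegral_add hp hμ hG (V.isLcc_smul φ v)
    (V.isLcc_smul ψ v)]
  simp [add_smul]

theorem heckeAct_add (φ : CcInf G R) (v w : V) :
    V.heckeAct μ φ (v + w) = V.heckeAct μ φ v + V.heckeAct μ φ w := by
  rw [heckeAct, heckeAct, heckeAct, ← haarIntegral_add hp hμ hG (V.isLcc_smul φ v)
    (V.isLcc_smul φ w)]
  simp

theorem map_heckeAct {S : Type*} [Ring S] (hS : IsUnit (p : S)) {X : Type*} [AddCommGroup X]
    [Module S X] (f : V →+ X) (φ : CcInf G R) (v : V) :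
    f (V.heckeAct μ φ v) = haarIntegral S μ fun g => f (φ g • V.ρ g v) :=
  map_haarIntegral hp hμ hG hS f (V.isLcc_smul φ v)

theorem smul_heckeAct (r : R) (φ : CcInf G R) (v : V) :
    V.heckeAct μ (r • φ) v = r • V.heckeAct μ φ v := by
  have := V.map_heckeAct hp hμ hG hp (DistribSMul.toAddMonoidHom V r) φ v
  simp only [DistribSMul.toAddMonoidHom_apply, smul_smul] at this
  rw [this]
  rfl

theorem ρ_heckeAct (g : G) (φ : CcInf G R) (v : V) :
    V.ρ g (V.heckeAct μ φ v) = V.heckeAct μ (CcInf.comp (Homeomorph.mulLeft g⁻¹) φ) v := by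
  have := V.map_heckeAct hp hμ hG hp (V.ρ g).toAddMonoidHom φ v
  simp only [LinearMap.toAddMonoidHom_coe] at this
  rw [this, heckeAct]
  refine Eq.trans ?_ (haarIntegral_mul_left hμ _ g)
  simp

/-- The action of the Hecke algebra as a biadditive map. -/
noncomputable def heckeActHom : CcInf G R →+ V →+ V where
  toFun φ := AddMonoidHom.mk' (V.heckeAct μ φ) (V.heckeAct_add hp hμ hG φ)
  map_zero' := by
    ext v
    have := V.add_heckeAct hp hμ hG 0 0 v
    simpa using this
  map_add' φ ψ := by
    ext v
    exact V.add_heckeAct hp hμ hG φ ψ v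

@[simp] theorem heckeActHom_apply (φ : CcInf G R) (v : V) :
    V.heckeActHom hp hμ hG φ v = V.heckeAct μ φ v := rfl

-- Convolution is by definition the Hecke action on the left regular representation, so the formula
-- for `heckeAct` applies.
omit hG in
theorem cosetFn_heckeMul (hG : LocallyProP p G) {K : Subgroup G} (hK : IsCompactOpenProP p K)
    (x : G) (r : R) {φ : CcInf G R} (h : ∀ k ∈ K, ∀ y, φ (k * y) = φ y) :
    heckeMul μ (cosetFn μ hK x r) φ = r • CcInf.comp (Homeomorph.mulLeft x⁻¹) φ :=
  (leftRegular p R G hG).heckeAct_cosetFn hp hμ hK x r (v := φ) fun _ hk =>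
    CcInf.ext fun y => h _ (K.inv_mem hk) y

theorem map_heckeMul {S : Type*} [Ring S] (hS : IsUnit (p : S)) {X : Type*} [AddCommGroup X]
    [Module S X] (f : CcInf G R →+ X) (φ ψ : CcInf G R) : f (heckeMul μ φ ψ) =
      haarIntegral S μ fun g => f (φ g • CcInf.comp (Homeomorph.mulLeft g⁻¹) ψ) :=
  (leftRegular p R G hG).map_heckeAct hp hμ hG hS f φ ψ

/-- The product is an integral of translates of `ψ` inside `CcInf G R`; the additive map that lets
functions act on `v` is moved under this integral. -/
theorem heckeMul_heckeAct (φ ψ : CcInf G R) (v : V) :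
    V.heckeAct μ (heckeMul μ φ ψ) v = V.heckeAct μ φ (V.heckeAct μ ψ v) := by
  have := map_heckeMul hp hμ hG hp ((V.heckeActHom hp hμ hG).flip v) φ ψ
  simp only [AddMonoidHom.flip_apply, heckeActHom_apply, V.smul_heckeAct hp hμ hG,
    ← V.ρ_heckeAct hp hμ hG] at this
  exact this

theorem exists_cosetFn_heckeAct (v : V) : ∃ K : Subgroup G, ∃ hK : IsCompactOpenProP p K,
    V.heckeAct μ (cosetFn μ hK 1 1) v = v := by
  obtain ⟨K, hK, h⟩ := V.exists_fixed hG v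
  exact ⟨K, hK, by rw [V.heckeAct_cosetFn hp hμ hK 1 1 h]; simp⟩

theorem isSmoothLeftModule : IsSmoothLeftModule (heckeMul μ) (V.heckeAct μ) where
  add_act := V.add_heckeAct hp hμ hG
  act_add := V.heckeAct_add hp hμ hG
  mul_act := V.heckeMul_heckeAct hp hμ hG
  smooth := by
    let f := BalTensor.lift (ra := heckeMul μ) (la := V.heckeAct μ) (V.heckeActHom hp hμ hG)
      (V.heckeMul_heckeAct hp hμ hG)
    have hf : ∀ a v, f (BalTensor.tmul _ _ a v) = V.heckeAct μ a v := fun a v =>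
      BalTensor.lift_tmul _ _ a v
    -- If `a` is left invariant under `L`, then `a ⊗ v = e_L a ⊗ v = e_L ⊗ a v`, where `e_L` is
    -- `cosetFn μ hL 1 1`. Hence `z` is determined by its image. All small `L` are allowed so that
    -- sums can be treated with a common `L`.
    have key : ∀ z : BalTensor (heckeMul μ) (V.heckeAct μ), ∃ K : Subgroup G,
        IsCompactOpenProP p K ∧ ∀ (L : Subgroup G) (hL : IsCompactOpenProP p L), L ≤ K →
          z = BalTensor.tmul _ _ (cosetFn μ hL 1 1) (f z) := by
      intro z
      induction z using BalTensor.induction_on with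
      | h0 =>
        obtain ⟨K, hK, -⟩ := hG _ univ_mem
        exact ⟨K, hK, fun L hL _ => by rw [map_zero, BalTensor.tmul_zero]⟩
      | ht a v =>
        obtain ⟨K, hK, h⟩ := (CcInf.isLcc a).exists_left_invariant hG
        refine ⟨K, hK, fun L hL hLK => ?_⟩
        have := cosetFn_heckeMul hp hμ hG hL 1 1 fun _ hk => h _ (hLK hk)
        rw [hf, ← BalTensor.balanced, this, one_smul]
        congr 1
        exact CcInf.ext fun y => by simp
      | ha z w hz hw =>
        obtain ⟨K, hK, h⟩ := hz
        obtain ⟨K', hK', h'⟩ := hw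
        refine ⟨K ⊓ K', hK.inf hK', fun L hL hLK => ?_⟩
        rw [map_add, BalTensor.tmul_add, ← h L hL (hLK.trans inf_le_left),
          ← h' L hL (hLK.trans inf_le_right)]
    refine ⟨AddEquiv.ofBijective f ⟨?_, ?_⟩, hf⟩
    · rw [injective_iff_map_eq_zero]
      intro z hz
      obtain ⟨K, hK, h⟩ := key z
      rw [h K hK le_rfl, hz, BalTensor.tmul_zero]
    · intro v
      obtain ⟨K, hK, h⟩ := V.exists_cosetFn_heckeAct hp hμ hG v
      exact ⟨BalTensor.tmul _ _ (cosetFn μ hK 1 1) v, by rw [hf, h]⟩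

theorem exists_hom (f : V →+ W)
    (hf : ∀ (φ : CcInf G R) (v : V), f (V.heckeAct μ φ v) = W.heckeAct μ φ (f v)) :
    ∃ f' : V ⟶ W, ∀ v, SmoothRep.lin f' v = f v := by
  -- For `K` fixing both `v` and `f v`, one element of the Hecke algebra acts as `r` times `g` on
  -- both vectors.
  have key : ∀ v, ∃ K : Subgroup G, ∃ hK : IsCompactOpenProP p K, ∀ (r : R) (g : G),
      f (r • V.ρ g v) = r • W.ρ g (f v) := by
    intro v
    obtain ⟨K, hK, h⟩ := V.exists_fixed hG v
    obtain ⟨K', hK', h'⟩ := W.exists_fixed hG (f v)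
    refine ⟨K ⊓ K', hK.inf hK', fun r g => ?_⟩
    rw [← V.heckeAct_cosetFn hp hμ (hK.inf hK') g r (fun k hk => h k hk.1), hf,
      W.heckeAct_cosetFn hp hμ (hK.inf hK') g r (fun k hk => h' k hk.2)]
  refine ⟨⟨{ f with map_smul' := fun r v => ?_ }, fun g v => ?_⟩, fun v => rfl⟩
  · obtain ⟨_, -, h⟩ := key v
    simpa using h r 1
  · obtain ⟨_, -, h⟩ := key v
    simpa using h 1 g

end SmoothRep

/-! ### Smooth modules as representations -/

namespace IsSmoothLeftModule

variable {A X : Type*} [AddCommGroup A] [AddCommGroup X] {mul : A → A → A} {act : A → X → X}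
  (h : IsSmoothLeftModule mul act)

include h

theorem hom_ext {Z : Type*} [AddCommGroup Z] {f g : X →+ Z}
    (hfg : ∀ a x, f (act a x) = g (act a x)) : f = g := by
  obtain ⟨e, he⟩ := h.smooth
  ext x
  obtain ⟨z, rfl⟩ := e.surjective x
  induction z using BalTensor.induction_on with
  | h0 => simp
  | ht a x => rw [he, hfg]
  | ha z w hz hw => rw [map_add, map_add, map_add, hz, hw]

theorem induction_on {P : X → Prop} (x : X) (h0 : P 0) (ht : ∀ a x, P (act a x))
    (ha : ∀ x y, P x → P y → P (x + y)) : P x := by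
  obtain ⟨e, he⟩ := h.smooth
  obtain ⟨z, rfl⟩ := e.surjective x
  induction z using BalTensor.induction_on with
  | h0 => simpa
  | ht a x => rw [he]; exact ht a x
  | ha z w hz hw => rw [map_add]; exact ha _ _ hz hw

/-- The action as a biadditive map. -/
def actHom : A →+ X →+ X where
  toFun a := AddMonoidHom.mk' (act a) (h.act_add a)
  map_zero' := by
    ext x
    have := h.add_act 0 0 x
    simpa using this
  map_add' a b := by
    ext x
    exact h.add_act a b x

@[simp] theorem actHom_apply (a : A) (x : X) : h.actHom a x = act a x := rfl

/-- `X` is the tensor product of `A` with `X`, and an endomorphism of `A` that commutes with right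
multiplications acts on the first factor. This is used for scalars from `R` and for left
translations by group elements. -/
theorem exists_extension (L : A →+ A) (hL : ∀ a b, L (mul a b) = mul (L a) b) :
    ∃ f : AddMonoid.End X, ∀ a x, f (act a x) = act (L a) x := by
  obtain ⟨e, he⟩ := h.smooth
  let t := BalTensor.lift (ra := mul) (la := act) (h.actHom.comp L)
    (fun a b x => by simp [hL, h.mul_act])
  refine ⟨t.comp e.symm.toAddMonoidHom, fun a x => ?_⟩
  change t (e.symm (act a x)) = _
  rw [← he, e.symm_apply_apply]
  exact BalTensor.lift_tmul _ _ a x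

/-- The endomorphism of a smooth module induced by a right linear endomorphism of the algebra. -/
noncomputable def extend (L : A →+ A) (hL : ∀ a b, L (mul a b) = mul (L a) b) :
    AddMonoid.End X :=
  (h.exists_extension L hL).choose

theorem extend_act (L : A →+ A) (hL : ∀ a b, L (mul a b) = mul (L a) b) (a : A) (x : X) :
    h.extend L hL (act a x) = act (L a) x :=
  (h.exists_extension L hL).choose_spec a x

end IsSmoothLeftModule

section EssSurj

variable {p : ℕ} [hprime : Fact p.Prime] {R : Type u} [Ring R] {G : Type u} [Group G]
  [TopologicalSpace G] [IsTopologicalGroup G] {μ : @Measure G (borel G)}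
  (hp : IsUnit (p : R)) (hμ : IsNormalizedHaar p μ) (hG : LocallyProP p G)

include hp hμ hG

theorem smul_heckeMul (r : R) (φ ψ : CcInf G R) : heckeMul μ (r • φ) ψ = r • heckeMul μ φ ψ :=
  (leftRegular p R G hG).smul_heckeAct hp hμ hG r φ ψ

theorem comp_heckeMul (g : G) (φ ψ : CcInf G R) :
    CcInf.comp (Homeomorph.mulLeft g⁻¹) (heckeMul μ φ ψ) =
      heckeMul μ (CcInf.comp (Homeomorph.mulLeft g⁻¹) φ) ψ :=
  (leftRegular p R G hG).ρ_heckeAct hp hμ hG g φ ψ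

/-- Elements `a x` span the module, and `R` and `G` act on them through `a`. Every axiom, smoothness
included, is checked on these elements, where it holds because it holds in the left regular
representation. -/
theorem IsSmoothLeftModule.exists_smoothRep (X : Type u) [AddCommGroup X]
    (act : CcInf G R → X → X) (h : IsSmoothLeftModule (heckeMul μ) act) :
    ∃ (V : SmoothRep R G) (e : V ≃+ X), ∀ φ v, e (V.heckeAct μ φ v) = act φ (e v) := by
  have ext : ∀ {f g : AddMonoid.End X}, (∀ a x, f (act a x) = g (act a x)) → f = g :=
    fun hfg => h.hom_ext hfg
  let Lr : R → CcInf G R →+ CcInf G R := fun r => DistribSMul.toAddMonoidHom _ r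
  have hLr : ∀ r a b, Lr r (heckeMul μ a b) = heckeMul μ (Lr r a) b := fun r a b =>
    (smul_heckeMul hp hμ hG r a b).symm
  let Lg : G → CcInf G R →+ CcInf G R := fun g =>
    (CcInf.comp (R := R) (Homeomorph.mulLeft g⁻¹)).toAddMonoidHom
  have hLg : ∀ g a b, Lg g (heckeMul μ a b) = heckeMul μ (Lg g a) b := comp_heckeMul hp hμ hG
  let σ : R →+* AddMonoid.End X :=
    { toFun := fun r => h.extend (Lr r) (hLr r)
      map_one' := ext fun a x => by
        rw [h.extend_act]; simp [Lr]
      map_mul' := fun r s => ext fun a x => by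
        change _ = h.extend (Lr r) (hLr r) (h.extend (Lr s) (hLr s) (act a x))
        rw [h.extend_act, h.extend_act, h.extend_act]
        simp [Lr, smul_smul]
      map_zero' := ext fun a x => by
        rw [h.extend_act]
        simp only [Lr, DistribSMul.toAddMonoidHom_apply, zero_smul, ← h.actHom_apply]
        simp
      map_add' := fun r s => ext fun a x => by
        change _ = h.extend (Lr r) (hLr r) (act a x) + h.extend (Lr s) (hLr s) (act a x)
        rw [h.extend_act, h.extend_act, h.extend_act, ← h.add_act]
        simp [Lr, add_smul] }
  let _ : Module R X := Module.compHom X σ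
  have hr : ∀ (r : R) (a : CcInf G R) (x : X), r • act a x = act (r • a) x := fun r a x =>
    h.extend_act (Lr r) (hLr r) a x
  have hg : ∀ (g : G) (a : CcInf G R) (x : X), h.extend (Lg g) (hLg g) (act a x) =
      act (CcInf.comp (Homeomorph.mulLeft g⁻¹) a) x := fun g a x => h.extend_act (Lg g) (hLg g) a x
  let V : SmoothRep R G :=
    { carrier := X
      ρ :=
        { toFun := fun g =>
            { toFun := h.extend (Lg g) (hLg g)
              map_add' := fun x y => map_add _ x y
              map_smul' := fun r x => by
                induction x using h.induction_on with
                | h0 => simp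
                | ht a x => rw [hr, hg, RingHom.id_apply, hg, hr, map_smul]
                | ha x y hx hy => rw [smul_add, map_add, hx, hy, map_add, smul_add] }
          map_one' := LinearMap.ext fun x => by
            change h.extend (Lg 1) (hLg 1) x = x
            induction x using h.induction_on with
            | h0 => simp
            | ht a x =>
              rw [hg]
              congr 1
              exact CcInf.ext fun y => by simp
            | ha x y hx hy => rw [map_add, hx, hy]
          map_mul' := fun g g' => LinearMap.ext fun x => by
            change h.extend (Lg (g * g')) (hLg _) x =
              h.extend (Lg g) (hLg g) (h.extend (Lg g') (hLg g') x)
            induction x using h.induction_on with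
            | h0 => simp
            | ht a x =>
              rw [hg, hg, hg]
              congr 1
              exact CcInf.ext fun y => by simp [mul_assoc]
            | ha x y hx hy => rw [map_add, hx, hy, map_add, map_add] }
      smooth := fun x => by
        change ∃ K : Subgroup G, _ ∧ ∀ k ∈ K, h.extend (Lg k) (hLg k) x = x
        induction x using h.induction_on with
        | h0 => exact ⟨⊤, isOpen_univ, fun k _ => map_zero _⟩
        | ht a x =>
          obtain ⟨K, hK, hKa⟩ := (leftRegular p R G hG).smooth a
          exact ⟨K, hK, fun k hk => by rw [hg]; congr 1; exact hKa k hk⟩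
        | ha x y hx hy =>
          obtain ⟨K, hK, h1⟩ := hx
          obtain ⟨K', hK', h2⟩ := hy
          exact ⟨K ⊓ K', hK.inter hK', fun k hk => by rw [map_add, h1 k hk.1, h2 k hk.2]⟩ }
  refine ⟨V, AddEquiv.refl X, fun φ v => ?_⟩
  change V.heckeAct μ φ v = act φ v
  have hadd := V.heckeAct_add hp hμ hG φ
  -- On `a x` the given action of `φ` is that of the product of `φ` and `a`, which is the integral
  -- of the translates of `a` weighted by `φ`; this is the integrated form.
  refine DFunLike.congr_fun (h.hom_ext (f := V.heckeActHom hp hμ hG φ) (g := h.actHom φ)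
    fun a x => ?_) v
  rw [SmoothRep.heckeActHom_apply, h.actHom_apply, ← h.mul_act]
  have := SmoothRep.map_heckeMul hp hμ hG hp (X := V) (h.actHom.flip x) φ a
  simp only [AddMonoidHom.flip_apply, h.actHom_apply] at this
  rw [this, SmoothRep.heckeAct]
  congr 1
  ext g
  rw [← hr, ← hg]
  rfl

theorem integrationIsEquivalence : IntegrationIsEquivalence R μ where
  obj V := V.isSmoothLeftModule hp hμ hG
  map V W f φ v := by
    have := V.map_heckeAct hp hμ hG hp (SmoothRep.lin f).toAddMonoidHom φ v
    simp only [LinearMap.toAddMonoidHom_coe, map_smul] at this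
    rw [this, SmoothRep.heckeAct]
    congr 1
    ext g
    congr 1
    exact f.comm g v
  full V W := V.exists_hom W hp hμ hG
  essSurj X _ act h := h.exists_smoothRep hp hμ hG X act

end EssSurj

/-! ### Right modules as left modules over the opposite ring -/

/-- The anti-isomorphism `φ ↦ (g ↦ op (φ g⁻¹))` between the Hecke algebras with coefficients in `R`
and in the opposite ring. -/
def heckeFlip {R : Type*} [Ring R] {G : Type*} [Group G] [TopologicalSpace G]
    [IsTopologicalGroup G] : CcInf G R ≃+ CcInf G Rᵐᵒᵖ where
  toFun φ := ⟨fun g => MulOpposite.op (φ g⁻¹),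
    ((CcInf.isLcc φ).comp_homeomorph (Homeomorph.inv G)).comp_left (f := MulOpposite.op) rfl⟩
  invFun φ := ⟨fun g => MulOpposite.unop (φ g⁻¹),
    ((CcInf.isLcc φ).comp_homeomorph (Homeomorph.inv G)).comp_left (f := MulOpposite.unop) rfl⟩
  left_inv φ := CcInf.ext fun g => by simp
  right_inv φ := CcInf.ext fun g => by simp
  map_add' φ ψ := CcInf.ext fun g => by simp

@[simp] theorem heckeFlip_apply {R : Type*} [Ring R] {G : Type*} [Group G] [TopologicalSpace G]
    [IsTopologicalGroup G] (φ : CcInf G R) (g : G) :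
    heckeFlip φ g = MulOpposite.op (φ g⁻¹) := rfl

/-- Exchanging the factors of a balanced tensor product. -/
theorem BalTensor.exists_swap {A B Y : Type*} [AddCommGroup A] [AddCommGroup B] [AddCommGroup Y]
    (θ : A ≃+ B) {mulA : A → A → A} {mulB : B → B → B}
    (hθ : ∀ a a', θ (mulA a a') = mulB (θ a') (θ a)) {ra : Y → A → Y} {la : B → Y → Y}
    (h : ∀ a y, ra y a = la (θ a) y) :
    ∃ s : BalTensor ra mulA ≃+ BalTensor mulB la, ∀ y a, s (tmul _ _ y a) = tmul _ _ (θ a) y := by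
  let s : BalTensor ra mulA →+ BalTensor mulB la :=
    lift (((tmulHom mulB la).comp θ.toAddMonoidHom).flip) fun y a a' => by
      change tmul _ _ (θ a') (ra y a) = tmul mulB la (θ (mulA a a')) y
      rw [hθ, balanced, h]
  have hs : ∀ y a, s (tmul _ _ y a) = tmul _ _ (θ a) y := fun y a => lift_tmul _ _ y a
  let t : BalTensor mulB la →+ BalTensor ra mulA :=
    lift ((tmulHom ra mulA).flip.comp θ.symm.toAddMonoidHom) fun b b' y => by
      change tmul ra mulA y (θ.symm (mulB b b')) = tmul ra mulA (la b' y) (θ.symm b)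
      obtain ⟨a, rfl⟩ := θ.surjective b
      obtain ⟨a', rfl⟩ := θ.surjective b'
      rw [← hθ, θ.symm_apply_apply, θ.symm_apply_apply, ← h, balanced]
  have ht : ∀ b y, t (tmul _ _ b y) = tmul ra mulA y (θ.symm b) := fun b y => lift_tmul _ _ b y
  refine ⟨{ s with invFun := t, left_inv := fun z => ?_, right_inv := fun z => ?_ }, hs⟩
  · change t (s z) = z
    induction z using induction_on with
    | h0 => simp
    | ht y a => rw [hs, ht, θ.symm_apply_apply]
    | ha z w hz hw => rw [map_add, map_add, hz, hw]
  · change s (t z) = z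
    induction z using induction_on with
    | h0 => simp
    | ht b y => rw [ht, hs, θ.apply_symm_apply]
    | ha z w hz hw => rw [map_add, map_add, hz, hw]

/-- The additive group of functions with the right regular representation `(x φ)(y) = φ(y x)`. -/
def rightRegular (p : ℕ) (R : Type u) [Ring R] (G : Type u) [Group G] [TopologicalSpace G]
    [IsTopologicalGroup G] (hG : LocallyProP p G) : SmoothRep Rᵐᵒᵖ G where
  carrier := CcInf G R
  ρ :=
    { toFun := fun g =>
        { toFun := CcInf.comp (Homeomorph.mulRight g)
          map_add' := fun _ _ => rfl
          map_smul' := fun _ _ => rfl }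
      map_one' := LinearMap.ext fun f => CcInf.ext fun x => by
        change f (x * 1) = f x
        rw [mul_one]
      map_mul' := fun g h => LinearMap.ext fun f => CcInf.ext fun x => by
        change f (x * (g * h)) = f (x * g * h)
        rw [mul_assoc] }
  smooth f := by
    obtain ⟨K, hK, h⟩ := (CcInf.isLcc f).exists_right_invariant hG
    exact ⟨K, hK.isOpen, fun k hk => CcInf.ext fun x => h _ hk x⟩

section

variable {p : ℕ} [hprime : Fact p.Prime] {R : Type u} [Ring R] {G : Type u} [Group G]
  [TopologicalSpace G] [IsTopologicalGroup G] {μ : @Measure G (borel G)}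
  (hp : IsUnit (p : R)) (hμ : IsNormalizedHaar p μ) (hG : LocallyProP p G)

include hp hμ hG

theorem heckeMul_apply (φ ψ : CcInf G R) (y : G) :
    heckeMul μ φ ψ y = haarIntegral R μ fun g => φ g * ψ (g⁻¹ * y) := by
  have := SmoothRep.map_heckeMul hp hμ hG hp (CcInf.eval y) φ ψ
  simpa using this

/-- The substitution `g ↦ y g` turns the product into an integral of right translates of `φ`, with
the values of `ψ` as scalars on the right. In this form, maps that commute with right translations
are seen to be right `H(G)`-linear. -/
theorem heckeMul_eq_rightRegular (φ ψ : CcInf G R) :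
    heckeMul μ φ ψ = (rightRegular p R G hG).heckeAct μ (heckeFlip ψ) φ := by
  refine CcInf.ext fun y => ?_
  have hp' := isUnit_natCast_mulOpposite hp
  have := (rightRegular p R G hG).map_heckeAct hp' hμ hG hp
    (CcInf.eval y : CcInf G R →+ R) (heckeFlip ψ) φ
  refine Eq.trans ?_ this.symm
  rw [heckeMul_apply hp hμ hG, ← haarIntegral_mul_left hμ _ y]
  congr 1
  ext g
  change _ = φ (y * g) * ψ g⁻¹
  simp

/-- After evaluation at `x`, the two sides differ by the substitution `g ↦ x⁻¹ g`. Only left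
invariance of the measure enters, so the group need not be unimodular. -/
theorem heckeFlip_heckeMul (φ ψ : CcInf G R) :
    heckeFlip (heckeMul μ φ ψ) = heckeMul μ (heckeFlip ψ) (heckeFlip φ) := by
  have hp' := isUnit_natCast_mulOpposite hp
  refine CcInf.ext fun x => ?_
  have := SmoothRep.map_heckeMul hp hμ hG hp'
    ((CcInf.eval x : CcInf G Rᵐᵒᵖ →+ Rᵐᵒᵖ).comp heckeFlip.toAddMonoidHom) φ ψ
  refine Eq.trans this ?_
  rw [heckeMul_apply hp' hμ hG, ← haarIntegral_mul_left hμ _ x⁻¹]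
  congr 1
  ext g
  simp

end

/-- The common form of all later linearity statements over Hecke algebras. The functions `c` and `a`
need no structure, because `f` is merely moved under the integral. -/
theorem SmoothRep.map_heckeAct_of_comm {p : ℕ} [hprime : Fact p.Prime] {R : Type u} [Ring R]
    {G : Type u} [Group G] [TopologicalSpace G] [IsTopologicalGroup G] {μ : @Measure G (borel G)}
    (hp : IsUnit (p : R)) (hμ : IsNormalizedHaar p μ) (hG : LocallyProP p G) (V : SmoothRep R G)
    {S : Type u} [Ring S] (hS : IsUnit (p : S)) {X : Type*} [AddCommGroup X] [Module S X]
    (c : R → S) (a : G → X → X) (f : V →+ X) (h : ∀ r g v, f (r • V.ρ g v) = c r • a g (f v))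
    (φ : CcInf G R) (v : V) :
    f (V.heckeAct μ φ v) = haarIntegral S μ fun g => c (φ g) • a g (f v) := by
  rw [V.map_heckeAct hp hμ hG hS]
  simp only [h]

namespace BiRep

variable {R : Type u} [Ring R] {H G : Type u} [Group H] [TopologicalSpace H]
  [IsTopologicalGroup H] [Group G] [TopologicalSpace G] [IsTopologicalGroup G]

/-- All structures on the bimodule commute and both representations are smooth. -/
structure IsSmooth (Y : BiRep R H G) : Prop where
  left_smul : ∀ h (r : R) (y : Y), Y.left h (r • y) = r • Y.left h y
  right_smul : ∀ g (r : R) (y : Y), Y.right g (r • y) = r • Y.right g y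
  left_op_smul : ∀ h (r : Rᵐᵒᵖ) (y : Y), Y.left h (r • y) = r • Y.left h y
  right_op_smul : ∀ g (r : Rᵐᵒᵖ) (y : Y), Y.right g (r • y) = r • Y.right g y
  smul_comm : ∀ (r : R) (s : Rᵐᵒᵖ) (y : Y), r • s • y = s • r • y
  left_right : ∀ h g (y : Y), Y.left h (Y.right g y) = Y.right g (Y.left h y)
  left_smooth : ∀ y : Y, ∃ K : Subgroup H, IsOpen (K : Set H) ∧ ∀ k ∈ K, Y.left k y = y
  right_smooth : ∀ y : Y, ∃ K : Subgroup G, IsOpen (K : Set G) ∧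
    ∀ k ∈ K, Y.right (MulOpposite.op k) y = y

namespace IsSmooth

variable {Y : BiRep R H G} (hY : Y.IsSmooth)

/-- The left representation. -/
def leftRep : SmoothRep R H where
  carrier := Y
  ρ :=
    { toFun := fun h =>
        { toFun := Y.left h
          map_add' := map_add _
          map_smul' := hY.left_smul h }
      map_one' := LinearMap.ext fun y => by
        change Y.left 1 y = y
        rw [map_one]; rfl
      map_mul' := fun h h' => LinearMap.ext fun y => by
        change Y.left (h * h') y = Y.left h (Y.left h' y)
        rw [map_mul]; rfl }
  smooth := hY.left_smooth

/-- The right representation as a left representation over the opposite ring. -/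
def rightRep : SmoothRep Rᵐᵒᵖ G where
  carrier := Y
  ρ :=
    { toFun := fun g =>
        { toFun := Y.right (MulOpposite.op g⁻¹)
          map_add' := map_add _
          map_smul' := hY.right_op_smul _ }
      map_one' := LinearMap.ext fun y => by
        change Y.right (MulOpposite.op 1⁻¹) y = y
        rw [inv_one, MulOpposite.op_one, map_one]; rfl
      map_mul' := fun g g' => LinearMap.ext fun y => by
        change Y.right (MulOpposite.op (g * g')⁻¹) y =
          Y.right (MulOpposite.op g⁻¹) (Y.right (MulOpposite.op g'⁻¹) y)
        rw [mul_inv_rev, MulOpposite.op_mul, map_mul]; rfl }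
  smooth y := by
    obtain ⟨K, hK, h⟩ := hY.right_smooth y
    exact ⟨K, hK, fun k hk => h _ (K.inv_mem hk)⟩

/-- This holds by definition thanks to the inverses in `heckeRight`, and it transfers all results on
left modules to right modules. -/
theorem heckeRight_eq (μ : @Measure G (borel G)) (φ : CcInf G R) (y : Y) :
    Y.heckeRight μ y φ = hY.rightRep.heckeAct μ (heckeFlip φ) y := rfl

variable {p : ℕ} [hprime : Fact p.Prime] {μH : @Measure H (borel H)} {μ : @Measure G (borel G)}
  (hp : IsUnit (p : R)) (hμ : IsNormalizedHaar p μ) (hG : LocallyProP p G)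
  (hμH : IsNormalizedHaar p μH) (hH : LocallyProP p H)

include hY hp hμ hG

/-- The right action of the Hecke algebra as a biadditive map. -/
noncomputable def heckeRightHom : Y →+ CcInf G R →+ Y :=
  AddMonoidHom.flip (((hY.rightRep.heckeActHom (isUnit_natCast_mulOpposite hp) hμ hG).comp
    heckeFlip.toAddMonoidHom : CcInf G R →+ Y →+ Y))

theorem heckeRight_heckeMul (y : Y) (φ ψ : CcInf G R) :
    Y.heckeRight μ y (heckeMul μ φ ψ) = Y.heckeRight μ (Y.heckeRight μ y φ) ψ := by
  rw [hY.heckeRight_eq, heckeFlip_heckeMul hp hμ hG]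
  exact hY.rightRep.heckeMul_heckeAct (isUnit_natCast_mulOpposite hp) hμ hG _ _ _

theorem isSmoothRightModule : IsSmoothRightModule (heckeMul μ) (Y.heckeRight μ) where
  act_add y φ ψ := map_add (hY.heckeRightHom hp hμ hG y) φ ψ
  add_act y z φ := by
    have := map_add (hY.heckeRightHom hp hμ hG) y z
    exact DFunLike.congr_fun this φ
  act_mul := hY.heckeRight_heckeMul hp hμ hG
  smooth := by
    have hp' := isUnit_natCast_mulOpposite hp
    obtain ⟨e, he⟩ := (hY.rightRep.isSmoothLeftModule hp' hμ hG).smooth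
    obtain ⟨s, hs⟩ := BalTensor.exists_swap (Y := Y) (heckeFlip (R := R) (G := G))
      (heckeFlip_heckeMul hp hμ hG) (la := fun φ y => hY.rightRep.heckeAct μ φ y)
      (hY.heckeRight_eq μ)
    exact ⟨s.trans e, fun y φ => (congrArg e (hs y φ)).trans (he _ _)⟩

omit hμ hG in
include hμH hH in
theorem heckeLeft_smul_comm (T : Y →+ Y) (hT : ∀ (r : R) h (y : Y), T (r • Y.left h y) =
    r • Y.left h (T y)) (φ : CcInf H R) (y : Y) :
    T (Y.heckeLeft μH φ y) = Y.heckeLeft μH φ (T y) :=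
  hY.leftRep.map_heckeAct_of_comm hp hμH hH hp id (fun h => Y.left h) T hT φ y

theorem heckeRight_comm (T : Y →+ Y) (hT : ∀ (r : Rᵐᵒᵖ) g (y : Y), T (r • Y.right g y) =
    r • Y.right g (T y)) (φ : CcInf G R) (y : Y) :
    T (Y.heckeRight μ y φ) = Y.heckeRight μ (T y) φ :=
  hY.rightRep.map_heckeAct_of_comm (isUnit_natCast_mulOpposite hp) hμ hG
    (isUnit_natCast_mulOpposite hp) id (fun g => Y.right (MulOpposite.op g⁻¹)) T
    (fun r g y => hT r (MulOpposite.op g⁻¹) y) (heckeFlip φ) y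

include hμH hH in
theorem isSmoothBimodule : Y.IsSmoothBimodule μH μ where
  left := hY.leftRep.isSmoothLeftModule hp hμH hH
  right := hY.isSmoothRightModule hp hμ hG
  comm φ y ψ := by
    -- The right action of `ψ` passes through the left integral as soon as it commutes with each `r`
    -- and `h`; these in turn pass through the right integral.
    refine hY.heckeLeft_smul_comm hp hμH hH ((hY.heckeRightHom hp hμ hG).flip ψ)
      (fun r h y => ?_) φ y
    refine (hY.heckeRight_comm hp hμ hG ((DistribSMul.toAddMonoidHom Y r).comp (Y.left h))
      (fun s g y => ?_) ψ y).symm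
    change r • Y.left h (s • Y.right g y) = s • Y.right g (r • Y.left h y)
    rw [hY.left_op_smul, hY.left_right, hY.smul_comm, hY.right_smul]

end IsSmooth

end BiRep

/-! ### Decomposition along an open partition -/

/-- A function that is constant on the members of an open partition is a finite sum of
functions that are each supported on one of them. -/
theorem CcInf.exists_eq_sum {X R ι : Type*} [TopologicalSpace X] [Ring R] {q : X → ι}
    (hq : IsLocallyConstant q) (f : CcInf X R) (hf : ∀ x y, q x = q y → f x = f y) :
    ∃ (T : Finset ι) (F : ι → CcInf X R), f = ∑ i ∈ T, F i ∧
      ∀ i ∈ T, ∃ x, q x = i ∧ (∀ y, q y = i → F i y = f x) ∧ ∀ y, q y ≠ i → F i y = 0 := by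
  classical
  have hfin : (q '' tsupport (f : X → R)).Finite := by
    let _ : TopologicalSpace ι := ⊥
    have : DiscreteTopology ι := ⟨rfl⟩
    exact ((CcInf.isLcc f).2.image hq.continuous).finite_of_discrete
  let F : ι → CcInf X R := fun i => ⟨fun y => if q y = i then f y else 0, by
    refine IsLcc.of_support_subset ?_ (CcInf.isLcc f).2 fun x hx => subset_tsupport _ fun h =>
      hx (by simp [h])
    rw [IsLocallyConstant.iff_eventually_eq]
    intro x
    filter_upwards [hq.eventually_eq x, (CcInf.isLcc f).1.eventually_eq x] with y h1 h2
    rw [h1, h2]⟩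
  have hF : ∀ i y, F i y = if q y = i then f y else 0 := fun _ _ => rfl
  refine ⟨hfin.toFinset, F, CcInf.ext fun y => ?_, fun i hi => ?_⟩
  · rw [CcInf.sum_apply]
    simp only [hF, Finset.sum_ite_eq]
    split_ifs with h
    · rfl
    · by_contra h'
      exact h (by simpa using ⟨y, subset_tsupport _ h', rfl⟩)
  · obtain ⟨x, -, hx⟩ := by simpa using hi
    exact ⟨x, hx, fun y hy => by rw [hF, if_pos hy, hf y x (hy.trans hx.symm)],
      fun y hy => by rw [hF, if_neg hy]⟩

/-! ### Haar measures on groups that are locally pro-`p` -/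

namespace IsCompactOpenProP

variable {p : ℕ} {G : Type*} [Group G] [TopologicalSpace G] [IsTopologicalGroup G] {K : Subgroup G}

theorem subgroupOf (hK : IsCompactOpenProP p K) {U : Subgroup G} (hU : IsClosed (U : Set G)) :
    IsCompactOpenProP p (K.subgroupOf U) where
  isOpen := hK.isOpen.preimage continuous_subtype_val
  isCompact := hU.isClosedEmbedding_subtypeVal.isCompact_preimage hK.isCompact
  tendsto x hx := by
    rw [tendsto_subtype_rng]
    simpa using hK.tendsto x hx

theorem map_equiv {H : Type*} [Group H] [TopologicalSpace H]
    (hK : IsCompactOpenProP p K) (e : G ≃ₜ* H) :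
    IsCompactOpenProP p (K.map (e : G →* H)) where
  isOpen := e.toHomeomorph.isOpenMap _ hK.isOpen
  isCompact := hK.isCompact.image e.continuous
  tendsto := by
    rintro _ ⟨x, hx, rfl⟩
    have := (e.continuous.tendsto 1).comp (hK.tendsto x hx)
    rw [show e.toHomeomorph 1 = 1 from map_one e] at this
    exact this.congr fun j => (map_pow e x _ :)

end IsCompactOpenProP

theorem LocallyProP.subgroup {p : ℕ} {G : Type*} [Group G] [TopologicalSpace G]
    [IsTopologicalGroup G] (hG : LocallyProP p G) {U : Subgroup G} (hU : IsClosed (U : Set G)) :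
    LocallyProP p U := by
  intro V hV
  obtain ⟨W, hW, hWV⟩ := mem_nhds_subtype _ _ _ |>.1 hV
  obtain ⟨K, hK, hKW⟩ := hG W hW
  exact ⟨_, hK.subgroupOf hU, fun x hx => hWV (hKW hx)⟩

section

variable {p : ℕ} [hprime : Fact p.Prime] {G : Type*} [Group G] [TopologicalSpace G]
  [IsTopologicalGroup G]

theorem measure_eq_relIndex_mul {μ : @Measure G (borel G)}
    (hμ : @Measure.IsHaarMeasure G _ _ (borel G) μ) {N H : Subgroup G} (hN : IsOpen (N : Set G))
    (hNH : N ≤ H) (hH : IsCompact (H : Set G)) :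
    μ (H : Set G) = N.relIndex H * μ (N : Set G) := by
  classical
  obtain ⟨T, hT⟩ := exists_finset_cosets hN hH
  have hout : ∀ g : G, (g : G ⧸ N).out ∈ H ↔ g ∈ H := fun g => by
    obtain ⟨k, hk⟩ := QuotientGroup.mk_out_eq_mul N g
    rw [hk, H.mul_mem_cancel_right (hNH k.2)]
  rw [measure_eq_card hμ hN (A := (H : Set G))
    (fun k hk g => H.mul_mem_cancel_right (hNH hk)) T hT]
  congr 2
  rw [Subgroup.relIndex, Subgroup.index, ← Fintype.card_coe, ← Nat.card_eq_fintype_card]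
  have hmem : ∀ x : H, ((x : G) : G ⧸ N) ∈ T.filter fun q => q.out ∈ (H : Set G) := fun x => by
    rw [Finset.mem_filter]
    exact ⟨hT x x.2, (hout x).2 x.2⟩
  let f : H ⧸ N.subgroupOf H → {q // q ∈ T.filter fun q => q.out ∈ (H : Set G)} :=
    Quotient.lift (fun x : H => ⟨((x : G) : G ⧸ N), hmem x⟩) fun x y hxy => by
      have hxy' : x⁻¹ * y ∈ N.subgroupOf H := QuotientGroup.leftRel_apply.1 hxy
      exact Subtype.ext (QuotientGroup.eq.2 hxy')
  refine (Nat.card_eq_of_bijective f ⟨?_, ?_⟩).symm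
  · rintro ⟨x⟩ ⟨y⟩ hxy
    have h1 : ((x : G) : G ⧸ N) = ((y : G) : G ⧸ N) := congrArg Subtype.val hxy
    have h2 : (x : G)⁻¹ * (y : G) ∈ N := QuotientGroup.eq.1 h1
    exact Quotient.sound (QuotientGroup.leftRel_apply.2 h2)
  · rintro ⟨q, hq⟩
    exact ⟨Quotient.mk _ ⟨q.out, (Finset.mem_filter.1 hq).2⟩,
      Subtype.ext (QuotientGroup.out_eq' q)⟩

/-- Give one compact open pro-`p`-subgroup `K` measure one. For another open pro-`p`-subgroup `L`,
the indices of `K ∩ L` in `L` and in `K` are `p ^ a` and `p ^ b`, so `L` has measure `p ^ (a - b)`.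
This supplies the auxiliary measure on the unipotent radical. -/
theorem LocallyProP.exists_isNormalizedHaar (hG : LocallyProP p G) :
    ∃ μ : @Measure G (borel G), IsNormalizedHaar p μ ∧ @Measure.Regular G (borel G) _ μ := by
  classical
  let _ : MeasurableSpace G := borel G
  have : BorelSpace G := ⟨rfl⟩
  obtain ⟨K, hK, -⟩ := hG _ univ_mem
  let K' : TopologicalSpace.PositiveCompacts G :=
    { carrier := K
      isCompact' := hK.isCompact
      interior_nonempty' := ⟨1, by rw [hK.isOpen.interior_eq]; exact K.one_mem⟩ }
  have hμK : Measure.haarMeasure K' (K : Set G) = 1 := Measure.haarMeasure_self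
  refine ⟨Measure.haarMeasure K', ⟨inferInstance, fun L hL hLp => ?_⟩, inferInstance⟩
  have hμ : Measure.IsHaarMeasure (Measure.haarMeasure K') := inferInstance
  obtain ⟨a, ha⟩ := hLp.relIndex_eq (L := K ⊓ L) (hK.isOpen.inter hL)
  obtain ⟨b, hb⟩ := hK.isProP.relIndex_eq (L := K ⊓ L) (hK.isOpen.inter hL)
  have h1 := measure_eq_relIndex_mul hμ (hK.isOpen.inter hL) (inf_le_right : K ⊓ L ≤ L) hLp.1
  have h2 := measure_eq_relIndex_mul hμ (hK.isOpen.inter hL) (inf_le_left : K ⊓ L ≤ K) hK.isCompact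
  rw [hμK, hb] at h2
  have hp0 : (p : ℝ) ≠ 0 := by exact_mod_cast hprime.out.ne_zero
  have hpe : ENNReal.ofReal (p : ℝ) = p := by simp
  have hp0' : (p : ENNReal) ≠ 0 := by exact_mod_cast hprime.out.ne_zero
  refine ⟨a - b, ?_⟩
  have h3 : Measure.haarMeasure K' ((K ⊓ L : Subgroup G) : Set G) = ((p : ENNReal) ^ b)⁻¹ := by
    refine ENNReal.eq_inv_of_mul_eq_one_left ?_
    rw [mul_comm, h2]
    push_cast
    rfl
  rw [h1, ha, h3, zpow_sub₀ hp0, zpow_natCast, zpow_natCast, div_eq_mul_inv,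
    ENNReal.ofReal_mul (by positivity), ENNReal.ofReal_inv_of_pos
      (by have := hprime.out.pos; positivity),
    ENNReal.ofReal_pow (by positivity), ENNReal.ofReal_pow (by positivity), hpe]
  push_cast
  rfl

section

variable {R : Type*} [Ring R] {V : Type*} [AddCommGroup V] [Module R V] {μ : @Measure G (borel G)}
  (hp : IsUnit (p : R)) (hμ : IsNormalizedHaar p μ) (hG : LocallyProP p G)

include hμ hG

theorem IsNormalizedHaar.isPFraction_of_isClopen {A : Set G} (hA : IsClopen A)
    (hA' : IsCompact A) : IsPFraction p (μ A).toReal := by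
  classical
  obtain ⟨K, hK, h⟩ := (CcInf.isLcc (CcInf.single A hA hA' (1 : ℤ))).exists_right_invariant hG
  obtain ⟨T, hT⟩ := exists_finset_cosets hK.isOpen hA'
  have hmem : ∀ g, g ∈ A ↔ CcInf.single A hA hA' (1 : ℤ) g = 1 := fun g => by
    by_cases hg : g ∈ A
    · simp [CcInf.single_of_mem hA hA' _ hg, hg]
    · simp [CcInf.single_of_notMem hA hA' _ hg, hg]
  rw [measure_eq_card hμ.1 hK.isOpen (A := A) (fun k hk g => by rw [hmem, hmem, h k hk]) T hT,
    ENNReal.toReal_mul, ENNReal.toReal_natCast]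
  exact (IsPFraction.natCast _).mul (hμ.isPFraction hK)

include hp

/-- Change of variables for a map that scales the Haar measure. -/
theorem haarIntegral_comp_of_measure {c : ℝ} (hc : IsPFraction p c) {e : G → G}
    (h : ∀ A, IsClopen A → IsCompact A → (μ (e ⁻¹' A)).toReal = c * (μ A).toReal) {F : G → V}
    (hF : IsLcc F) :
    haarIntegral R μ (fun g => F (e g)) = toRing R c • haarIntegral R μ F := by
  have hcl : ∀ v : V, v ≠ 0 → IsClopen (F ⁻¹' {v}) ∧ IsCompact (F ⁻¹' {v}) := fun v hv =>
    ⟨hF.1.isClopen_fiber v, hF.2.of_isClosed_subset (hF.1.isClopen_fiber v).isClosed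
      fun g hg => subset_tsupport _ (by rw [Function.mem_support, show F g = v from hg]; exact hv)⟩
  have hfin : (Set.range F).Finite := by
    have h1 : (F '' tsupport F).Finite := by
      let _ : TopologicalSpace V := ⊥
      have : DiscreteTopology V := ⟨rfl⟩
      exact (hF.2.image hF.1.continuous).finite_of_discrete
    refine (h1.insert 0).subset ?_
    rintro _ ⟨g, rfl⟩
    by_cases hg : F g = 0
    · exact Or.inl hg
    · exact Or.inr ⟨g, subset_tsupport _ hg, rfl⟩
  have hsupp : (Function.support fun v : V => toRing R (μ (F ⁻¹' {v})).toReal • v).Finite := by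
    refine hfin.subset fun v hv => ?_
    by_contra hv'
    apply hv
    have : F ⁻¹' {v} = ∅ := by
      ext g
      simp only [Set.mem_preimage, Set.mem_singleton_iff, Set.mem_empty_iff_false, iff_false]
      exact fun hg => hv' ⟨g, hg⟩
    have h0 : toRing R (0 : ℝ) = 0 := by simpa using toRing_natCast hp 0
    simp [this, h0]
  unfold haarIntegral
  rw [smul_finsum' _ hsupp]
  congr 1
  ext v
  by_cases hv : v = 0
  · simp [hv]
  · rw [show (fun g => F (e g)) ⁻¹' {v} = e ⁻¹' (F ⁻¹' {v}) from rfl, h _ (hcl v hv).1 (hcl v hv).2,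
      toRing_mul hp hc (hμ.isPFraction_of_isClopen hG (hcl v hv).1 (hcl v hv).2), mul_smul]

/-- A group that is a union of compact open subgroups is unimodular. -/
theorem haarIntegral_mul_right [LocallyCompactSpace G]
    (hex : ∀ g : G, ∃ K : Subgroup G, IsCompactOpenProP p K ∧ g ∈ K) {F : G → V} (hF : IsLcc F)
    (x : G) : haarIntegral R μ (fun g => F (g * x)) = haarIntegral R μ F := by
  have h1 := haarIntegral_comp_of_measure hp hμ hG (c := 1) (by simpa using IsPFraction.natCast (p := p) 1)
    (e := fun g => g * x) (fun A hA hA' => ?_) hF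
  · rwa [toRing_one hp, one_smul] at h1
  let _ : MeasurableSpace G := borel G
  have : BorelSpace G := ⟨rfl⟩
  have hμ1 : Measure.IsHaarMeasure μ := hμ.1
  obtain ⟨K, hK, hx⟩ := hex x
  -- The image of `μ` under right translation by `x` is again a left Haar measure, hence
  -- proportional to `μ` on compact sets. A compact open subgroup `K` containing `x` satisfies `K x
  -- = K`, so the factor is one.
  have hm : ∀ s : Set G, IsClosed s → IsCompact s → μ ((fun g => g * x) ⁻¹' s) =
      Measure.haarScalarFactor (Measure.map (fun g => g * x) μ) μ • μ s := fun s hs hs' => by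
    rw [← Measure.measure_isMulInvariant_eq_smul_of_isCompact_closure
      (Measure.map (fun g => g * x) μ) μ (by rwa [hs.closure_eq]),
      Measure.map_apply (by fun_prop) hs.measurableSet]
  have hK' := hm K hK.isClopen.isClosed hK.isCompact
  have hpre : (fun g => g * x) ⁻¹' (K : Set G) = K := by
    ext g
    exact K.mul_mem_cancel_right hx
  have hpos : μ (K : Set G) ≠ 0 := (hK.isOpen.measure_pos μ ⟨1, K.one_mem⟩).ne'
  have htop : μ (K : Set G) ≠ ⊤ := hK.isCompact.measure_lt_top.ne
  rw [hpre, ENNReal.smul_def, smul_eq_mul] at hK'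
  have hone : (Measure.haarScalarFactor (Measure.map (fun g => g * x) μ) μ : ENNReal) = 1 := by
    rw [← ENNReal.mul_left_inj hpos htop, ← hK', one_mul]
  rw [hm A hA.isClosed hA', ENNReal.smul_def, smul_eq_mul, hone, one_mul, one_mul]

end

end

section modulus

variable {p : ℕ} [hprime : Fact p.Prime] {G : Type u} [Group G] [TopologicalSpace G]
  [IsTopologicalGroup G] {M U : Subgroup G} [LocallyCompactSpace U]
  (hMU : ∀ (m : M), ∀ x ∈ U, (m : G) * x * (m : G)⁻¹ ∈ U) {ν : @Measure U (borel U)}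
  (hν : IsNormalizedHaar p ν) (hνr : @Measure.Regular U (borel U) _ ν) (hU : LocallyProP p U)

include hν hνr

/-- `mulEquivHaarChar` is defined by the pushforward of `ν`; evaluation on the conjugate of `A`
gives the factor in the form `vol (m A m⁻¹) = δ(m) vol A`. -/
theorem measure_conj_preimage (m : M) {A : Set U} (hA : IsOpen A) :
    (ν ((Jacquet.conjEquiv hMU m).symm ⁻¹' A)).toReal =
      (Jacquet.modulus hMU m : ℝ) * (ν A).toReal := by
  let _ : MeasurableSpace U := borel U
  have : BorelSpace U := ⟨rfl⟩
  have hν1 : Measure.IsHaarMeasure ν := hν.1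
  have h := mulEquivHaarChar_smul_map ν (Jacquet.conjEquiv hMU m)
  have hs : MeasurableSet ((Jacquet.conjEquiv hMU m).symm ⁻¹' A) :=
    (hA.preimage (Jacquet.conjEquiv hMU m).symm.continuous).measurableSet
  conv_lhs => rw [← h]
  rw [Measure.smul_apply, Measure.map_apply (by fun_prop) hs]
  have hpre : (Jacquet.conjEquiv hMU m) ⁻¹' ((Jacquet.conjEquiv hMU m).symm ⁻¹' A) = A := by
    ext x
    simp
  rw [hpre, ENNReal.smul_def, smul_eq_mul, ENNReal.toReal_mul]
  rfl

include hU

/-- The modulus is the quotient of the volumes of `m K m⁻¹` and `K`, both powers of `p`. -/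
theorem isPFraction_modulus (m : M) : IsPFraction p (Jacquet.modulus hMU m : ℝ) := by
  obtain ⟨K, hK, -⟩ := hU _ univ_mem
  have h := measure_conj_preimage hMU hν hνr m hK.isOpen
  have hpre : (Jacquet.conjEquiv hMU m).symm ⁻¹' (K : Set U) =
      (K.map (Jacquet.conjEquiv hMU m : U →* U) : Set U) := by
    ext x
    simp only [Set.mem_preimage, Subgroup.coe_map, Set.mem_image, SetLike.mem_coe]
    constructor
    · intro hx
      exact ⟨_, hx, (Jacquet.conjEquiv hMU m).apply_symm_apply x⟩
    · rintro ⟨y, hy, rfl⟩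
      have : (Jacquet.conjEquiv hMU m).symm ((Jacquet.conjEquiv hMU m) y) = y :=
        (Jacquet.conjEquiv hMU m).symm_apply_apply y
      exact this.symm ▸ hy
  rw [hpre] at h
  obtain ⟨a, ha⟩ := hν.toReal_eq (hK.map_equiv (Jacquet.conjEquiv hMU m))
  obtain ⟨b, hb⟩ := hν.toReal_eq hK
  have hp0 : (p : ℝ) ≠ 0 := by exact_mod_cast hprime.out.ne_zero
  rw [ha, hb] at h
  have : (Jacquet.modulus hMU m : ℝ) = (p : ℝ) ^ (a - b) := by
    rw [zpow_sub₀ hp0, h, mul_div_assoc, div_self (zpow_ne_zero _ hp0), mul_one]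
  exact this ▸ .zpow _

theorem haarIntegral_conj {R : Type*} [Ring R] {V : Type*} [AddCommGroup V] [Module R V]
    (hp : IsUnit (p : R)) (m : M) {F : U → V} (hF : IsLcc F) :
    haarIntegral R ν (fun x => F ((Jacquet.conjEquiv hMU m).symm x)) =
      toRing R (Jacquet.modulus hMU m : ℝ) • haarIntegral R ν F :=
  haarIntegral_comp_of_measure hp hν hU (isPFraction_modulus hMU hν hνr hU m)
    (fun _ hA _ => measure_conj_preimage hMU hν hνr m hA.isOpen) hF

end modulus

/-! ### Functions on quotients of groups -/

theorem Topology.IsQuotientMap.isLocallyConstant {X Y V : Type*} [TopologicalSpace X]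
    [TopologicalSpace Y] {q : X → Y} (hq : IsQuotientMap q) {f : Y → V}
    (h : IsLocallyConstant fun x => f (q x)) : IsLocallyConstant f := fun s =>
  hq.isOpen_preimage.1 (h s)

theorem isOpenQuotientMap_rightRel {G : Type*} [Group G] [TopologicalSpace G]
    [IsTopologicalGroup G] (U : Subgroup G) :
    IsOpenQuotientMap (Quotient.mk (QuotientGroup.rightRel U)) :=
  ⟨Quotient.mk_surjective, continuous_quot_mk, isOpenMap_quotient_mk'_mul⟩

theorem quotient_rightRel_mul {G : Type*} [Group G] {U : Subgroup G} {x : G} (hx : x ∈ U) (g : G) :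
    Quotient.mk (QuotientGroup.rightRel U) (x * g) = Quotient.mk _ g :=
  Quotient.sound (QuotientGroup.rightRel_apply.2 (by simpa using U.inv_mem hx))

/-- The induced action on `Y` is jointly continuous because the product of the identity with an open
quotient map is again a quotient map. -/
theorem LocallyProP.exists_forall_eq_quotient {p : ℕ} {H X Y V : Type*} [Group H]
    [TopologicalSpace H] [TopologicalSpace X] [TopologicalSpace Y] [Zero V] (hH : LocallyProP p H)
    {q : X → Y} (hq : IsOpenQuotientMap q) (a : H → Y → Y) (b : H → X → X)
    (hab : ∀ h x, a h (q x) = q (b h x)) (hb : Continuous fun z : H × X => b z.1 z.2)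
    (h1 : ∀ x, b 1 x = x) (hinv : ∀ h x, b h⁻¹ (b h x) = x) {F : Y → V} (hF : IsLcc F) :
    ∃ K : Subgroup H, IsCompactOpenProP p K ∧ ∀ k ∈ K, ∀ x, F (a k x) = F x := by
  refine hH.exists_forall_eq a ?_ ?_ ?_ hF.1 hF.2
  · rw [← (IsOpenQuotientMap.id.prodMap hq).continuous_comp_iff]
    have : (fun z : H × Y => a z.1 z.2) ∘ Prod.map id q = fun z : H × X => q (b z.1 z.2) := by
      ext z
      exact hab _ _
    rw [this]
    exact hq.continuous.comp hb
  · intro y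
    obtain ⟨x, rfl⟩ := hq.surjective y
    rw [hab, h1]
  · intro h y
    obtain ⟨x, rfl⟩ := hq.surjective y
    rw [hab, hab, hinv]

/-! ### Functions on `U \ G` and integration over the cosets of `U`. -/

namespace Jacquet

variable {p : ℕ} {R : Type u} [Ring R] {G : Type u} [Group G] [TopologicalSpace G]
  [IsTopologicalGroup G] {M U : Subgroup G}

theorem val_mul_inv {M : Type u} [Group M] [TopologicalSpace M] (χ : SmoothChar R M) (m : M) :
    val χ m * val χ m⁻¹ = 1 := by
  rw [← val_mul, mul_inv_cancel, val_one]

theorem val_inv_mul {M : Type u} [Group M] [TopologicalSpace M] (χ : SmoothChar R M) (m : M) :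
    val χ m⁻¹ * val χ m = 1 := by
  rw [← val_mul, inv_mul_cancel, val_one]

theorem val_eq_one {M : Type u} [Group M] [TopologicalSpace M] (χ : SmoothChar R M) {m : M}
    (hm : m ∈ χ.toHom.ker) : val χ m = 1 := by
  have : χ.toHom m = 1 := hm
  simp [val, this]

theorem isSmooth_restrictionBimodule (hG : LocallyProP p G) (hM : LocallyProP p M)
    (hMU : ∀ (m : M), ∀ x ∈ U, (m : G) * x * (m : G)⁻¹ ∈ U) (χ : SmoothChar R M) :
    (restrictionBimodule hMU χ).IsSmooth where
  left_smul m r f := CcInf.ext fun x => mul_assoc _ _ _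
  right_smul _ _ _ := rfl
  left_op_smul := fun m r (f : CcInf (Quotient (QuotientGroup.rightRel U)) R) => CcInf.ext fun x => by
    change f _ * r.unop * val χ m = f _ * val χ m * r.unop
    rw [mul_assoc, val_comm, mul_assoc]
  right_op_smul _ _ _ := rfl
  smul_comm r s f := CcInf.ext fun x => (mul_assoc _ _ _).symm
  left_right := fun m g (f : CcInf (Quotient (QuotientGroup.rightRel U)) R) => CcInf.ext fun x => by
    obtain ⟨x, rfl⟩ := Quotient.exists_rep x
    change f (Quotient.mk _ ((m : G)⁻¹ * x * g.unop⁻¹)) * val χ m =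
      f (Quotient.mk _ ((m : G)⁻¹ * (x * g.unop⁻¹))) * val χ m
    rw [mul_assoc]
  left_smooth := fun (f : CcInf (Quotient (QuotientGroup.rightRel U)) R) => by
    obtain ⟨K, hK, h⟩ := hM.exists_forall_eq_quotient (isOpenQuotientMap_rightRel U)
      (fun m => leftMove hMU m⁻¹) (fun m x => (m : G) * x)
      (fun m x => congrArg (Quotient.mk _) (show ((m⁻¹ : M) : G)⁻¹ * x = m * x by simp))
      (by fun_prop) (by simp) (by simp) (CcInf.isLcc f)
    refine ⟨K ⊓ χ.toHom.ker, hK.isOpen.inter χ.isOpen_ker, fun k hk => CcInf.ext fun x => ?_⟩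
    have := h _ (K.inv_mem hk.1) x
    rw [inv_inv] at this
    change f (leftMove hMU k x) * val χ k = f x
    rw [this, val_eq_one χ hk.2, mul_one]
  right_smooth := fun (f : CcInf (Quotient (QuotientGroup.rightRel U)) R) => by
    obtain ⟨K, hK, h⟩ := hG.exists_forall_eq_quotient (isOpenQuotientMap_rightRel U)
      (fun g => rightMove U g⁻¹) (fun g x => x * g)
      (fun m x => congrArg (Quotient.mk _) (show x * m⁻¹⁻¹ = x * m by simp))
      (by fun_prop) (by simp) (by simp) (CcInf.isLcc f)
    refine ⟨K, hK.isOpen, fun k hk => CcInf.ext fun x => ?_⟩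
    have := h _ (K.inv_mem hk) x
    rwa [inv_inv] at this

section fibreIntegral

variable [hprime : Fact p.Prime] (hUc : IsClosed (U : Set G)) {ν : @Measure U (borel U)}
  (hp : IsUnit (p : R)) (hν : IsNormalizedHaar p ν) (hU : LocallyProP p U) (hG : LocallyProP p G)

include hUc in
theorem isLcc_fibre (φ : CcInf G R) (g : G) : IsLcc fun x : U => φ ((x : G)⁻¹ * g) :=
  (CcInf.isLcc φ).comp_isClosedEmbedding (e := fun x : U => (x : G)⁻¹ * g)
    (((Homeomorph.inv G).trans (Homeomorph.mulRight g)).isClosedEmbedding.comp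
      hUc.isClosedEmbedding_subtypeVal)

include hν in
theorem haarIntegral_fibre_mul (φ : CcInf G R) (y : U) (g : G) :
    (haarIntegral R ν fun x : U => φ ((x : G)⁻¹ * (y * g))) =
      haarIntegral R ν fun x : U => φ ((x : G)⁻¹ * g) := by
  rw [← haarIntegral_mul_left hν _ y]
  simp [mul_assoc]

/-- The integral of a function over the cosets of `U`. -/
noncomputable def fibreIntegral (hν : IsNormalizedHaar p ν) (hG : LocallyProP p G) (φ : CcInf G R) : CcInf (Quotient (QuotientGroup.rightRel U)) R :=
  ⟨Quotient.lift (fun g => haarIntegral R ν fun x : U => φ ((x : G)⁻¹ * g)) (fun a b hab => by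
      have hab' : b * a⁻¹ ∈ U := QuotientGroup.rightRel_apply.1 hab
      have := haarIntegral_fibre_mul hν φ ⟨_, hab'⟩ a
      rw [← this]
      simp), by
    refine IsLcc.of_support_subset ?_ ((CcInf.isLcc φ).2.image
      (isOpenQuotientMap_rightRel U).continuous) ?_
    · refine (isOpenQuotientMap_rightRel U).isQuotientMap.isLocallyConstant ?_
      obtain ⟨K, hK, h⟩ := (CcInf.isLcc φ).exists_right_invariant hG
      refine isLocallyConstant_of_right_invariant hK.isOpen fun k hk g => ?_
      change (haarIntegral R ν fun x : U => φ ((x : G)⁻¹ * (g * k))) =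
        haarIntegral R ν fun x : U => φ ((x : G)⁻¹ * g)
      simp only [← mul_assoc, h k hk]
    · intro y hy
      obtain ⟨g, rfl⟩ := Quotient.exists_rep y
      by_contra hg
      apply hy
      change (haarIntegral R ν fun x : U => φ ((x : G)⁻¹ * g)) = 0
      have : (fun x : U => φ ((x : G)⁻¹ * g)) = fun _ => 0 := by
        ext x
        by_contra hx
        exact hg ⟨_, subset_tsupport _ hx, quotient_rightRel_mul (U.inv_mem x.2) g⟩
      rw [this, haarIntegral_zero]⟩

@[simp] theorem fibreIntegral_mk (φ : CcInf G R) (g : G) :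
    fibreIntegral hν hG φ (Quotient.mk _ g) = haarIntegral R ν fun x : U => φ ((x : G)⁻¹ * g) :=
  rfl

theorem comp_fibreIntegral (φ : CcInf G R) (g : G) :
    fibreIntegral hν hG (CcInf.comp (Homeomorph.mulRight g) φ) =
      CcInf.comp (rightMove U g⁻¹) (fibreIntegral hν hG φ) := by
  refine CcInf.ext fun x => ?_
  obtain ⟨x, rfl⟩ := Quotient.exists_rep x
  change (haarIntegral R ν fun y : U => φ ((y : G)⁻¹ * x * g)) =
    haarIntegral R ν fun y : U => φ ((y : G)⁻¹ * (x * g⁻¹⁻¹))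
  simp [mul_assoc]

include hUc hp hU

theorem fibreIntegral_add (φ ψ : CcInf G R) :
    fibreIntegral hν hG (φ + ψ) = fibreIntegral hν hG φ + fibreIntegral hν hG ψ := by
  refine CcInf.ext fun x => ?_
  obtain ⟨x, rfl⟩ := Quotient.exists_rep x
  exact haarIntegral_add hp hν hU (isLcc_fibre hUc φ x) (isLcc_fibre hUc ψ x)

theorem fibreIntegral_smul (r : R) (φ : CcInf G R) :
    fibreIntegral hν hG (r • φ) = r • fibreIntegral hν hG φ := by
  refine CcInf.ext fun x => ?_
  obtain ⟨x, rfl⟩ := Quotient.exists_rep x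
  exact (map_haarIntegral hp hν hU hp (AddMonoidHom.mulLeft r) (isLcc_fibre hUc φ x)).symm

theorem fibreIntegral_op_smul (r : Rᵐᵒᵖ) (φ : CcInf G R) :
    fibreIntegral hν hG (r • φ) = r • fibreIntegral hν hG φ := by
  refine CcInf.ext fun x => ?_
  obtain ⟨x, rfl⟩ := Quotient.exists_rep x
  exact (map_haarIntegral hp hν hU hp (AddMonoidHom.mulRight r.unop) (isLcc_fibre hUc φ x)).symm

/-- Integration over the cosets of `U` as an additive map. -/
noncomputable def fibreIntegralHom :
    CcInf G R →+ CcInf (Quotient (QuotientGroup.rightRel U)) R :=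
  AddMonoidHom.mk' (fibreIntegral hν hG) (fibreIntegral_add hUc hp hν hU hG)

@[simp] theorem fibreIntegralHom_apply (φ : CcInf G R) :
    fibreIntegralHom hUc hp hν hU hG φ = fibreIntegral hν hG φ := rfl

/-- Left translation of `φ` by `y` is right translation by `y` in the integration variable, and `U`
is unimodular, being a union of compact open subgroups. -/
theorem fibreIntegral_comp_mulLeft [LocallyCompactSpace U]
    (hex : ∀ x : U, ∃ K : Subgroup U, IsCompactOpenProP p K ∧ x ∈ K) (φ : CcInf G R) (y : U) :
    fibreIntegral hν hG (CcInf.comp (Homeomorph.mulLeft (y : G)⁻¹) φ) = fibreIntegral hν hG φ := by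
  refine CcInf.ext fun x => ?_
  obtain ⟨x, rfl⟩ := Quotient.exists_rep x
  have := haarIntegral_mul_right hp hν hU hex (isLcc_fibre hUc φ x) y
  rw [fibreIntegral_mk, fibreIntegral_mk, ← this]
  simp [mul_assoc]

/-- Since `m⁻¹ y⁻¹ x = (m⁻¹ y m)⁻¹ m⁻¹ x`, the claim is the change of variables for conjugation by
`m` on `U`. -/
theorem fibreIntegral_comp_levi [LocallyCompactSpace U]
    (hMU : ∀ (m : M), ∀ x ∈ U, (m : G) * x * (m : G)⁻¹ ∈ U)
    (hνr : @Measure.Regular U (borel U) _ ν) (φ : CcInf G R) (m : M) :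
    fibreIntegral hν hG (CcInf.comp (Homeomorph.mulLeft (m : G)⁻¹) φ) =
      toRing R (modulus hMU m : ℝ) • CcInf.comp (leftMove hMU m) (fibreIntegral hν hG φ) := by
  refine CcInf.ext fun x => ?_
  obtain ⟨x, rfl⟩ := Quotient.exists_rep x
  have := haarIntegral_conj hMU hν hνr hU hp m (isLcc_fibre hUc φ ((m : G)⁻¹ * x))
  refine Eq.trans ?_ this
  rw [fibreIntegral_mk]
  congr 1
  ext y
  change φ ((m : G)⁻¹ * ((y : G)⁻¹ * x)) = φ (((m : G)⁻¹ * y * m)⁻¹ * ((m : G)⁻¹ * x))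
  simp [mul_assoc]

/-- Here the square root enters: the modulus `χ(m)²` from the measure times the twist `χ(m)⁻¹` of
the coinvariants leaves the twist `χ(m)` of the bimodule. -/
theorem left_fibreIntegral [LocallyCompactSpace U]
    (hMU : ∀ (m : M), ∀ x ∈ U, (m : G) * x * (m : G)⁻¹ ∈ U)
    (hνr : @Measure.Regular U (borel U) _ ν) (χ : SmoothChar R M) (hχ : IsModulusSqrt hMU χ)
    (φ : CcInf G R) (m : M) :
    (restrictionBimodule hMU χ).left m (fibreIntegral hν hG φ) =
      fibreIntegral hν hG (val χ m⁻¹ • CcInf.comp (Homeomorph.mulLeft (m : G)⁻¹) φ) := by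
  rw [fibreIntegral_smul hUc hp hν hU hG, fibreIntegral_comp_levi hUc hp hν hU hG hMU hνr,
    ← hχ m, smul_smul, pow_two, ← mul_assoc, val_inv_mul, one_mul]
  refine CcInf.ext fun x => ?_
  exact val_comm _ _ _

/-- Integration over left cosets of the form `U g` commutes with right translations and right
scalars, hence with the integral of these that defines the right Hecke action. -/
theorem fibreIntegral_heckeMul {μ : @Measure G (borel G)} (hμ : IsNormalizedHaar p μ)
    (hMU : ∀ (m : M), ∀ x ∈ U, (m : G) * x * (m : G)⁻¹ ∈ U) (χ : SmoothChar R M)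
    (φ ψ : CcInf G R) : fibreIntegral hν hG (heckeMul μ φ ψ) =
      (restrictionBimodule hMU χ).heckeRight μ (fibreIntegral hν hG φ) ψ := by
  have hp' := isUnit_natCast_mulOpposite hp
  rw [heckeMul_eq_rightRegular hp hμ hG]
  exact (rightRegular p R G hG).map_heckeAct_of_comm hp' hμ hG hp'
    (X := (restrictionBimodule hMU χ).carrier) id
    (fun g => (restrictionBimodule hMU χ).right (MulOpposite.op g⁻¹))
    (fibreIntegralHom hUc hp hν hU hG) (fun r g (φ : CcInf G R) => by
      change fibreIntegral hν hG (r • CcInf.comp (Homeomorph.mulRight g) φ) =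
        r • CcInf.comp (rightMove U g⁻¹) (fibreIntegral hν hG φ)
      rw [fibreIntegral_op_smul hUc hp hν hU hG, comp_fibreIntegral]) (heckeFlip ψ) φ

end fibreIntegral

end Jacquet

namespace Jacquet

variable {p : ℕ} [hprime : Fact p.Prime] {R : Type u} [Ring R] {G : Type u} [Group G]
  [TopologicalSpace G] [IsTopologicalGroup G] {M U : Subgroup G} (hUc : IsClosed (U : Set G))
  {ν : @Measure U (borel U)} (hp : IsUnit (p : R)) (hν : IsNormalizedHaar p ν)
  (hU : LocallyProP p U) (hG : LocallyProP p G)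

-- `f` is right invariant under some `K`, hence a finite sum of functions supported on single double
-- cosets `U g K`. Such a function with value `r` is the integral of the function on `g K` with
-- value `vol(L)⁻¹ r`, where `L = U ∩ g K g⁻¹`: for `k ∈ K`, the condition `y⁻¹ g k ∈ g K` on `y ∈
-- U` means `y ∈ L`.
include hUc hp hU in
theorem exists_fibreIntegral_eq (f : CcInf (Quotient (QuotientGroup.rightRel U)) R) :
    ∃ φ, fibreIntegral hν hG φ = f := by
  classical
  obtain ⟨K, hK, hf⟩ := hG.exists_forall_eq_quotient (isOpenQuotientMap_rightRel U)
    (fun g => rightMove U g⁻¹) (fun g x => x * g)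
    (fun m x => congrArg (Quotient.mk _) (show x * m⁻¹⁻¹ = x * m by simp))
    (by fun_prop) (by simp) (by simp) (CcInf.isLcc f)
  have hf' : ∀ k ∈ K, ∀ x : G, f (Quotient.mk _ (x * k)) = f (Quotient.mk _ x) := fun k hk x => by
    refine Eq.trans ?_ (hf k hk (Quotient.mk _ x))
    exact congrArg f (congrArg (Quotient.mk _) (show x * k = x * k⁻¹⁻¹ by simp))
  -- The double coset itself, as a set, serves as index for the partition of `U \ G` into orbits of
  -- `K`.
  let q : Quotient (QuotientGroup.rightRel U) → Set G :=
    Quotient.lift (fun x => DoubleCoset.doubleCoset x (U : Set G) K) fun a b hab => by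
      have hab' : b * a⁻¹ ∈ U := QuotientGroup.rightRel_apply.1 hab
      refine (DoubleCoset.doubleCoset_eq_of_mem (DoubleCoset.mem_doubleCoset.2
        ⟨_, hab', 1, K.one_mem, by simp⟩)).symm
  have hqmk : ∀ x, q (Quotient.mk _ x) = DoubleCoset.doubleCoset x (U : Set G) K := fun _ => rfl
  have hq : IsLocallyConstant q := by
    refine (isOpenQuotientMap_rightRel U).isQuotientMap.isLocallyConstant ?_
    refine isLocallyConstant_of_right_invariant hK.isOpen fun k hk g => ?_
    rw [hqmk, hqmk]
    exact DoubleCoset.doubleCoset_eq_of_mem (DoubleCoset.mem_doubleCoset.2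
      ⟨1, U.one_mem, k, hk, by simp⟩)
  obtain ⟨T, F, rfl, hF⟩ := CcInf.exists_eq_sum hq f (fun x y hxy => by
    obtain ⟨x, rfl⟩ := Quotient.exists_rep x
    obtain ⟨y, rfl⟩ := Quotient.exists_rep y
    rw [hqmk, hqmk] at hxy
    have hx := DoubleCoset.mem_doubleCoset_self U K x
    rw [hxy] at hx
    obtain ⟨v, hv, k, hk, rfl⟩ := DoubleCoset.mem_doubleCoset.1 hx
    rw [hf' k hk, quotient_rightRel_mul hv])
  suffices h : ∀ i ∈ T, ∃ φ, fibreIntegral hν hG φ = F i by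
    choose! φ hφ using h
    refine ⟨∑ i ∈ T, φ i, ?_⟩
    rw [← fibreIntegralHom_apply hUc hp hν hU hG, map_sum]
    exact Finset.sum_congr rfl hφ
  intro i hi
  obtain ⟨x, rfl, h1, h0⟩ := hF i hi
  obtain ⟨g, rfl⟩ := Quotient.exists_rep x
  set r := (∑ i ∈ T, F i : CcInf _ R) (Quotient.mk _ g)
  let L : Subgroup U := (K.map (MulAut.conj g).toMonoidHom).subgroupOf U
  have hL : IsCompactOpenProP p L := (hK.map_conj g).subgroupOf hUc
  have hLmem : ∀ y : U, y ∈ L ↔ g⁻¹ * (y : G) * g ∈ K := fun y => by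
    rw [Subgroup.mem_subgroupOf, Subgroup.mem_map]
    constructor
    · rintro ⟨k, hk, hky⟩
      rw [← hky]
      simpa [mul_assoc] using hk
    · intro h
      exact ⟨_, h, by simp [mul_assoc]⟩
  let φ : CcInf G R := CcInf.single _ (hK.isClopen_coset g) (hK.isCompact_coset g)
    (Ring.inverse (ringVol R ν L) * r)
  have hφ1 : ∀ y, g⁻¹ * y ∈ K → φ y = Ring.inverse (ringVol R ν L) * r := fun y hy =>
    CcInf.single_of_mem _ _ _ hy
  have hφ0 : ∀ y, g⁻¹ * y ∉ K → φ y = 0 := fun y hy => CcInf.single_of_notMem _ _ _ hy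
  refine ⟨φ, CcInf.ext fun x => ?_⟩
  obtain ⟨x, rfl⟩ := Quotient.exists_rep x
  rw [fibreIntegral_mk]
  by_cases hx : q (Quotient.mk _ x) = q (Quotient.mk _ g)
  · rw [h1 _ hx]
    have hx' := DoubleCoset.mem_doubleCoset_self U K x
    rw [← hqmk, hx, hqmk] at hx'
    obtain ⟨v, hv, k, hk, rfl⟩ := DoubleCoset.mem_doubleCoset.1 hx'
    have e1 : (haarIntegral R ν fun y : U => φ ((y : G)⁻¹ * (v * g * k))) =
        haarIntegral R ν fun y : U => φ ((y : G)⁻¹ * (g * k)) := by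
      have := haarIntegral_fibre_mul hν φ ⟨v, hv⟩ (g * k)
      simpa [mul_assoc] using this
    rw [e1, haarIntegral_coset hp hν hL 1 (v := Ring.inverse (ringVol R ν L) * r), smul_eq_mul,
      ← mul_assoc, Ring.mul_inverse_cancel _ (isUnit_ringVol hp hν hL), one_mul]
    · intro l hl
      refine hφ1 _ ?_
      have := K.mul_mem ((hLmem _).1 (L.inv_mem hl)) hk
      simpa [mul_assoc] using this
    · intro y hy
      refine hφ0 _ fun h => hy ?_
      rw [inv_one, one_mul, ← L.inv_mem_iff, hLmem]
      have := K.mul_mem h (K.inv_mem hk)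
      simpa [mul_assoc] using this
  · rw [h0 _ hx]
    have : (fun y : U => φ ((y : G)⁻¹ * x)) = fun _ => 0 := by
      ext y
      refine hφ0 _ fun h => hx ?_
      rw [hqmk, hqmk]
      refine DoubleCoset.doubleCoset_eq_of_mem (DoubleCoset.mem_doubleCoset.2
        ⟨y, y.2, _, h, by simp [mul_assoc]⟩)
    rw [this, haarIntegral_zero]

open scoped Pointwise in
include hUc hp hU in
/-- An additive map that is invariant under left translation by `U` vanishes on the functions whose
integrals over all cosets of `U` vanish. -/
theorem map_eq_zero_of_fibreIntegral_eq_zero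
    (hex : ∀ C : Set U, IsCompact C → ∃ K : Subgroup U, IsCompactOpenProP p K ∧ C ⊆ K)
    {Z : Type*} [AddCommGroup Z] [Module R Z] (t : CcInf G R →+ Z)
    (ht : ∀ (x : U) (φ : CcInf G R), t (CcInf.comp (Homeomorph.mulLeft (x : G)⁻¹) φ) = t φ)
    {φ : CcInf G R} (hφ : fibreIntegral hν hG φ = 0) : t φ = 0 := by
  classical
  set C := tsupport (φ : G → R)
  have hC : IsCompact C := (CcInf.isLcc φ).2
  -- If `y⁻¹ g` and `x⁻¹ g` lie in the support of `φ`, then `y⁻¹ x` lies in `C C⁻¹`, hence in `K`.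
  -- So if `K` contains one point of `U` at which the fibre function over `g` is non-zero, it
  -- contains all of them.
  obtain ⟨K, hK, hKC⟩ := hex ((fun x : U => (x : G)) ⁻¹' (C * C⁻¹))
    (hUc.isClosedEmbedding_subtypeVal.isCompact_preimage (hC.mul hC.inv))
  obtain ⟨K', hK', h'⟩ := (CcInf.isLcc φ).exists_left_invariant hG
  set L := (K'.subgroupOf U) ⊓ K
  have hL : IsCompactOpenProP p L := (hK'.subgroupOf hUc).inf hK
  obtain ⟨T', hT'⟩ := exists_finset_cosets hL.isOpen hK.isCompact
  set T := T'.filter fun q => q.out ∈ (K : Set U)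
  -- The number of cosets is the index of `L` in `K`, a quotient of two powers of `p`.
  have hcard : IsUnit (T.card : R) := by
    have h1 := measure_eq_card hν.1 hL.isOpen (A := (K : Set U))
      (fun k hk g => K.mul_mem_cancel_right hk.2) T' hT'
    obtain ⟨a, ha⟩ := hν.toReal_eq hK
    obtain ⟨b, hb⟩ := hν.toReal_eq hL
    have h2 := congrArg ENNReal.toReal h1
    rw [ENNReal.toReal_mul, ENNReal.toReal_natCast, ha, hb] at h2
    have hp0 : (p : ℝ) ≠ 0 := by exact_mod_cast hprime.out.ne_zero
    have h3 : ((T.card : ℕ) : ℝ) = (p : ℝ) ^ (a - b) := by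
      rw [zpow_sub₀ hp0, h2, mul_div_assoc, div_self (zpow_ne_zero _ hp0), mul_one]
    rw [← toRing_natCast hp, h3]
    exact isUnit_toRing_zpow hp _
  -- The sum of the translates of `φ` over `K / L` vanishes: at `g` all terms are zero, or the sum
  -- is the whole fibre integral up to the unit `vol(L)`. Applying `t` then yields `T.card • t φ =
  -- 0`.
  have hsum : ∑ q ∈ T, CcInf.comp (Homeomorph.mulLeft ((q.out : U) : G)⁻¹) φ = 0 := by
    refine CcInf.ext fun g => ?_
    rw [CcInf.sum_apply]
    change ∑ q ∈ T, φ ((q.out : G)⁻¹ * g) = 0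
    by_cases h0 : ∀ x ∈ K, φ ((x : G)⁻¹ * g) = 0
    · exact Finset.sum_eq_zero fun q hq => h0 _ (Finset.mem_filter.1 hq).2
    push Not at h0
    obtain ⟨x, hx, hx0⟩ := h0
    have hinv : ∀ k ∈ L, ∀ y : U, φ (((y * k : U) : G)⁻¹ * g) = φ ((y : G)⁻¹ * g) :=
      fun k hk y => by
        have := h' _ (K'.inv_mem hk.1) ((y : G)⁻¹ * g)
        simpa [mul_assoc] using this
    have hTmem : ∀ y : U, φ ((y : G)⁻¹ * g) ≠ 0 → (y : U ⧸ L) ∈ T := fun y hy => by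
      have hyx : y⁻¹ * x ∈ K := by
        refine hKC ?_
        change ((y⁻¹ * x : U) : G) ∈ C * C⁻¹
        refine ⟨_, subset_tsupport _ hy, _, Set.inv_mem_inv.2 (subset_tsupport _ hx0), ?_⟩
        simp [mul_assoc]
      have hyK : y ∈ K := by
        rw [← K.inv_mem_iff]
        exact (K.mul_mem_cancel_right hx).1 hyx
      refine Finset.mem_filter.2 ⟨hT' y hyK, ?_⟩
      obtain ⟨k, hk⟩ := QuotientGroup.mk_out_eq_mul L y
      rw [hk]
      exact K.mul_mem hyK k.2.2
    have h1 := haarIntegral_eq_sum hp hν hL hinv T hTmem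
    have h2 := congrArg (fun f : CcInf _ R => f (Quotient.mk _ g)) hφ
    rw [fibreIntegral_mk] at h2
    rw [h2] at h1
    exact ((isUnit_ringVol hp hν hL).mul_right_eq_zero).1 h1.symm
  have h1 := congrArg t hsum
  rw [map_sum, map_zero] at h1
  simp only [ht, Finset.sum_const] at h1
  rw [← Nat.cast_smul_eq_nsmul R] at h1
  exact (hcard.smul_eq_zero).1 h1

end Jacquet

/-! ### Jacquet restriction as a tensor product. -/

namespace Jacquet

variable {p : ℕ} [hprime : Fact p.Prime] {R : Type u} [Ring R] {G : Type u} [Group G]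
  [TopologicalSpace G] [IsTopologicalGroup G] {M U : Subgroup G} (hUc : IsClosed (U : Set G))
  {ν : @Measure U (borel U)} {μ : @Measure G (borel G)} (hp : IsUnit (p : R))
  (hν : IsNormalizedHaar p ν) (hμ : IsNormalizedHaar p μ)
  (hU : LocallyProP p U) (hG : LocallyProP p G) (hM : LocallyProP p M)
  (hex : ∀ C : Set U, IsCompact C → ∃ K : Subgroup U, IsCompactOpenProP p K ∧ C ⊆ K)
  (hMU : ∀ (m : M), ∀ x ∈ U, (m : G) * x * (m : G)⁻¹ ∈ U) (χ : SmoothChar R M)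

-- The class of `φ v` in the coinvariants does not change when `φ` is translated from the left by
-- `U`. Hence it vanishes for `φ` in the kernel of the fibre integral, which is surjective, and so
-- depends on `fibreIntegral hν hG φ` only.
include hUc hp hν hμ hU hex in
theorem exists_restrictionPairing (V : SmoothRep R G) :
    ∃ s : CcInf (Quotient (QuotientGroup.rightRel U)) R →+ V →+ V ⧸ coinvKer U V,
      ∀ φ v, s (fibreIntegral hν hG φ) v = (coinvKer U V).mkQ (V.heckeAct μ φ v) := by
  let t : CcInf G R →+ V →+ V ⧸ coinvKer U V :=
    (AddMonoidHom.compHom (coinvKer U V).mkQ.toAddMonoidHom).comp (V.heckeActHom hp hμ hG)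
  have ht : ∀ φ v, t φ v = (coinvKer U V).mkQ (V.heckeAct μ φ v) := fun _ _ => rfl
  have hsurj : Function.Surjective (fibreIntegralHom hUc hp hν hU hG) :=
    exists_fibreIntegral_eq hUc hp hν hU hG
  let s := (fibreIntegralHom hUc hp hν hU hG).liftOfSurjective hsurj ⟨t, fun φ hφ => by
    refine AddMonoidHom.ext fun v => ?_
    refine map_eq_zero_of_fibreIntegral_eq_zero hUc hp hν hU hG hex (t.flip v) (fun x φ => ?_) hφ
    change t _ v = t φ v
    rw [ht, ht, ← V.ρ_heckeAct hp hμ hG, ← sub_eq_zero, ← map_sub]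
    exact (Submodule.Quotient.mk_eq_zero _).2 (Submodule.subset_span ⟨x, x.2, _, rfl⟩)⟩
  refine ⟨s, fun φ v => ?_⟩
  rw [← ht]
  exact DFunLike.congr_fun ((fibreIntegralHom hUc hp hν hU hG).liftOfRightInverse_comp_apply _
    (Function.rightInverse_surjInv hsurj) _ φ) v

/-- The elementary tensor `π(φ) ⊗ v`, where `π(φ)` is the integral of `φ` over the cosets
of `U`. -/
noncomputable def fibreTensor (μ : @Measure G (borel G)) (V : SmoothRep R G) (φ : CcInf G R)
    (v : V) : BalTensor ((restrictionBimodule hMU χ).heckeRight μ) (V.heckeAct μ) :=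
  BalTensor.tmul (Y := (restrictionBimodule hMU χ).carrier) _ _ (fibreIntegral hν hG φ) v

section

variable (V : SmoothRep R G)

theorem fibreTensor_add (φ : CcInf G R) (v w : V) :
    fibreTensor hν hG hMU χ μ V φ (v + w) =
      fibreTensor hν hG hMU χ μ V φ v + fibreTensor hν hG hMU χ μ V φ w :=
  BalTensor.tmul_add (Y := (restrictionBimodule hMU χ).carrier) _ _ _

theorem fibreTensor_sub (φ : CcInf G R) (v w : V) :
    fibreTensor hν hG hMU χ μ V φ (v - w) =
      fibreTensor hν hG hMU χ μ V φ v - fibreTensor hν hG hMU χ μ V φ w :=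
  BalTensor.tmul_sub (Y := (restrictionBimodule hMU χ).carrier) _ _ _

theorem fibreTensor_zero (φ : CcInf G R) : fibreTensor hν hG hMU χ μ V φ 0 = 0 :=
  BalTensor.tmul_zero (Y := (restrictionBimodule hMU χ).carrier) _

include hUc hp hμ hU

theorem fibreTensor_heckeMul (φ ψ : CcInf G R) (v : V) :
    fibreTensor hν hG hMU χ μ V (heckeMul μ φ ψ) v =
      fibreTensor hν hG hMU χ μ V φ (V.heckeAct μ ψ v) := by
  rw [fibreTensor, fibreIntegral_heckeMul hUc hp hν hU hG hμ hMU χ]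
  exact BalTensor.balanced (Y := (restrictionBimodule hMU χ).carrier) _ _ _

/-- For `ψ` left invariant under `L`, move `ψ` across the tensor product and use that `e_L` times
`ψ` is `ψ`. -/
theorem exists_fibreTensor_heckeAct_eq (ψ : CcInf G R) :
    ∃ K : Subgroup G, IsCompactOpenProP p K ∧ ∀ (L : Subgroup G) (hL : IsCompactOpenProP p L),
      L ≤ K → ∀ v : V, fibreTensor hν hG hMU χ μ V (cosetFn μ hL 1 1) (V.heckeAct μ ψ v) =
        fibreTensor hν hG hMU χ μ V ψ v := by
  obtain ⟨K, hK, h⟩ := (CcInf.isLcc ψ).exists_left_invariant hG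
  refine ⟨K, hK, fun L hL hLK v => ?_⟩
  rw [← fibreTensor_heckeMul hUc hp hν hμ hU hG,
    SmoothRep.cosetFn_heckeMul hp hμ hG hL 1 1 fun k hk => h k (hLK hk)]
  congr 1
  refine CcInf.ext fun x => ?_
  simp

/-- Fibre integration is onto, and elementary tensors `π(φ) ⊗ v` equal `π(e_L) ⊗ φ v` for small `L`;
with a common `L` these can be added. -/
theorem exists_eq_fibreTensor
    (z : BalTensor ((restrictionBimodule hMU χ).heckeRight μ) (V.heckeAct μ)) :
    ∃ (v : V) (K : Subgroup G), IsCompactOpenProP p K ∧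
      ∀ (L : Subgroup G) (hL : IsCompactOpenProP p L), L ≤ K →
      z = fibreTensor hν hG hMU χ μ V (cosetFn μ hL 1 1) v := by
  induction z using BalTensor.induction_on with
  | h0 =>
    obtain ⟨K, hK, -⟩ := hG _ univ_mem
    exact ⟨0, K, hK, fun L hL _ => (fibreTensor_zero hν hG hMU χ V _).symm⟩
  | ht y v =>
    obtain ⟨φ, rfl⟩ := exists_fibreIntegral_eq hUc hp hν hU hG y
    obtain ⟨K, hK, h⟩ := exists_fibreTensor_heckeAct_eq hUc hp hν hμ hU hG hMU χ V φ
    exact ⟨_, K, hK, fun L hL hLK => (h L hL hLK v).symm⟩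
  | ha z w hz hw =>
    obtain ⟨v, K, hK, h⟩ := hz
    obtain ⟨v', K', hK', h'⟩ := hw
    refine ⟨v + v', K ⊓ K', hK.inf hK', fun L hL hLK => ?_⟩
    rw [h L hL (hLK.trans inf_le_left), h' L hL (hLK.trans inf_le_right), fibreTensor_add]

-- Write `w = ψ w` with `ψ` a local unit. Then `π(e_L) ⊗ (x w - w)` is `π` of the difference between
-- the left translate of `ψ` by `x` and `ψ`, tensored with `w`. This is zero because `π` is
-- invariant under left translation by `U`.
include hex in
theorem exists_fibreTensor_eq_zero [LocallyCompactSpace U] {v : V} (hv : v ∈ coinvKer U V) :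
    ∃ K : Subgroup G, IsCompactOpenProP p K ∧
      ∀ (L : Subgroup G) (hL : IsCompactOpenProP p L), L ≤ K →
      fibreTensor hν hG hMU χ μ V (cosetFn μ hL 1 1) v = 0 := by
  -- The balanced tensor product has no scalar action on the second factor, so the induction over
  -- the `R`-span needs the claim for all multiples of `v`.
  suffices ∀ r : R, ∃ K : Subgroup G, IsCompactOpenProP p K ∧
      ∀ (L : Subgroup G) (hL : IsCompactOpenProP p L), L ≤ K →
      fibreTensor hν hG hMU χ μ V (cosetFn μ hL 1 1) (r • v) = 0 by
    simpa using this 1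
  induction hv using Submodule.span_induction with
  | mem v hv =>
    obtain ⟨x, hx, w, rfl⟩ := hv
    intro r
    obtain ⟨K₀, hK₀, h₀⟩ := V.exists_cosetFn_heckeAct hp hμ hG (r • w)
    set ψ := cosetFn μ hK₀ (1 : G) (1 : R)
    obtain ⟨K, hK, h⟩ := exists_fibreTensor_heckeAct_eq hUc hp hν hμ hU hG hMU χ V ψ
    obtain ⟨K', hK', h'⟩ := exists_fibreTensor_heckeAct_eq hUc hp hν hμ hU hG hMU χ V
      (CcInf.comp (Homeomorph.mulLeft x⁻¹) ψ)
    refine ⟨K ⊓ K', hK.inf hK', fun L hL hLK => ?_⟩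
    have e1 := h L hL (hLK.trans inf_le_left) (r • w)
    have e2 := h' L hL (hLK.trans inf_le_right) (r • w)
    rw [h₀] at e1
    rw [← V.ρ_heckeAct hp hμ hG, h₀] at e2
    rw [smul_sub, fibreTensor_sub, e1, ← map_smul, e2, fibreTensor, fibreTensor,
      fibreIntegral_comp_mulLeft hUc hp hν hU hG (fun x => by
        obtain ⟨K, hK, h⟩ := hex {x} isCompact_singleton
        exact ⟨K, hK, by simpa using h⟩) ψ ⟨x, hx⟩, sub_self]
  | zero =>
    intro r
    obtain ⟨K, hK, -⟩ := hG _ univ_mem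
    exact ⟨K, hK, fun L hL _ => by rw [smul_zero, fibreTensor_zero]⟩
  | add v w _ _ hv hw =>
    intro r
    obtain ⟨K, hK, h⟩ := hv r
    obtain ⟨K', hK', h'⟩ := hw r
    refine ⟨K ⊓ K', hK.inf hK', fun L hL hLK => ?_⟩
    rw [smul_add, fibreTensor_add, h L hL (hLK.trans inf_le_left),
      h' L hL (hLK.trans inf_le_right), add_zero]
  | smul s v _ hv =>
    intro r
    rw [smul_smul]
    exact hv _

end

include hUc hp hν hμ hU hG hM hex in
/-- Jacquet restriction is the tensor product with the functions on `U \ G`. -/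
theorem isTensorFunctor_restriction [LocallyCompactSpace U] {μM : @Measure M (borel M)}
    (hμM : IsNormalizedHaar p μM)
    (hνr : @Measure.Regular U (borel U) _ ν) (hχ : IsModulusSqrt hMU χ) :
    (restrictionBimodule hMU χ).IsTensorFunctor μM μ (restriction hMU χ) := by
  have hsm := isSmooth_restrictionBimodule hG hM hMU χ
  choose s hs using fun V : SmoothRep R G => exists_restrictionPairing hUc hp hν hμ hU hG hex V
  have hsurj := exists_fibreIntegral_eq (R := R) hUc hp hν hU hG
  have ht : ∀ (V : SmoothRep R G) y φ v, s V ((restrictionBimodule hMU χ).heckeRight μ y φ) v =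
      s V y (V.heckeAct μ φ v) := fun V y φ v => by
    obtain ⟨ψ, rfl⟩ := hsurj y
    rw [hs, ← V.heckeMul_heckeAct hp hμ hG, ← hs, fibreIntegral_heckeMul hUc hp hν hU hG hμ hMU χ]
  let T (V : SmoothRep R G) : BalTensor ((restrictionBimodule hMU χ).heckeRight μ)
      (V.heckeAct μ) →+ V ⧸ coinvKer U V :=
    BalTensor.lift (Y := (restrictionBimodule hMU χ).carrier) (s V) (ht V)
  have hT : ∀ (V : SmoothRep R G) (y : (restrictionBimodule hMU χ).carrier) v,
      T V (BalTensor.tmul _ _ y v) = s V y v :=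
    fun V y v => BalTensor.lift_tmul _ _ _ _
  have hT' : ∀ (V : SmoothRep R G) φ v,
      T V (fibreTensor hν hG hMU χ μ V φ v) = (coinvKer U V).mkQ (V.heckeAct μ φ v) :=
    fun V φ v => (hT V _ v).trans (hs V φ v)
  have hbij : ∀ V, Function.Bijective (T V) := fun V => by
    refine ⟨(injective_iff_map_eq_zero _).2 fun z hz => ?_, fun w => ?_⟩
    -- For `L` fixing `v`, the image of `z = π(e_L) ⊗ v` is the class of `v`. If this class is zero,
    -- the tensor vanishes for a smaller `L`, which represents the same `z`.
    · obtain ⟨v, K, hK, h⟩ := exists_eq_fibreTensor hUc hp hν hμ hU hG hMU χ V z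
      obtain ⟨K', hK', h'⟩ := V.exists_fixed hG v
      rw [h _ (hK.inf hK') inf_le_left, hT', V.heckeAct_cosetFn hp hμ (hK.inf hK') 1 1
        fun k hk => h' k hk.2, one_smul, map_one, Module.End.one_apply] at hz
      obtain ⟨K₂, hK₂, h₂⟩ := exists_fibreTensor_eq_zero hUc hp hν hμ hU hG hex hMU χ V
        ((Submodule.Quotient.mk_eq_zero _).1 hz)
      rw [h _ (hK.inf hK₂) inf_le_left, h₂ _ _ inf_le_right]
    · obtain ⟨v, rfl⟩ := Submodule.Quotient.mk_surjective _ w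
      obtain ⟨K, hK, h⟩ := V.exists_cosetFn_heckeAct hp hμ hG v
      refine ⟨fibreTensor hν hG hMU χ μ V (cosetFn μ hK 1 1) v, ?_⟩
      rw [hT', h]
      rfl
  refine ⟨fun V => AddEquiv.ofBijective (T V) (hbij V), fun V φ y v => ?_, fun V W f y v => ?_⟩
  · change T V _ = ((restriction hMU χ).obj V).heckeAct μM φ (T V _)
    rw [hT, hT]
    refine hsm.leftRep.map_heckeAct_of_comm (X := V ⧸ coinvKer U V) hp hμM hM hp id
      (fun m => coinvAct hMU χ V m) ((s V).flip v) (fun r m y => ?_) φ y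
    obtain ⟨ψ, rfl⟩ := hsurj y
    change s V (r • (restrictionBimodule hMU χ).left m _) v = r • coinvAct hMU χ V m (s V _ v)
    rw [left_fibreIntegral hUc hp hν hU hG hMU hνr χ hχ]
    refine (congrArg (fun y => s V y v) (fibreIntegral_smul hUc hp hν hU hG r _).symm).trans ?_
    rw [hs, hs, coinvAct_mk, V.smul_heckeAct hp hμ hG,
      V.smul_heckeAct hp hμ hG, ← V.ρ_heckeAct hp hμ hG, map_smul]
  · change T W _ = SmoothRep.lin ((restriction hMU χ).map f) (T V _)
    rw [hT, hT]
    obtain ⟨ψ, rfl⟩ := hsurj y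
    rw [hs, hs, ← (integrationIsEquivalence hp hμ hG).map V W f]
    rfl

end Jacquet

/-! ### The pairing of functions on `G / U` with representations of `M`. -/

namespace Jacquet

variable {p : ℕ} {R : Type u} [Ring R] {G : Type u} [Group G]
  [TopologicalSpace G] [IsTopologicalGroup G] {M U : Subgroup G}
  (hMU : ∀ (m : M), ∀ x ∈ U, (m : G) * x * (m : G)⁻¹ ∈ U) (χ : SmoothChar R M)

theorem isLocallyConstant_val {M : Type u} [Group M] [TopologicalSpace M] [IsTopologicalGroup M]
    (χ : SmoothChar R M) : IsLocallyConstant (val χ) :=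
  isLocallyConstant_of_right_invariant χ.isOpen_ker fun k hk g => by
    rw [val_mul, val_eq_one χ hk, mul_one]

theorem isSmooth_inductionBimodule (hG : LocallyProP p G) (hM : LocallyProP p M) :
    (inductionBimodule hMU χ).IsSmooth where
  left_smul _ _ _ := rfl
  right_smul m r f := CcInf.ext fun x => mul_assoc _ _ _
  left_op_smul _ _ _ := rfl
  right_op_smul := fun m r (f : CcInf (G ⧸ U) R) => CcInf.ext fun x => by
    change f _ * r.unop * val χ m.unop⁻¹ = f _ * val χ m.unop⁻¹ * r.unop
    rw [mul_assoc, val_comm, mul_assoc]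
  smul_comm r s f := CcInf.ext fun x => (mul_assoc _ _ _).symm
  left_right := fun g m (f : CcInf (G ⧸ U) R) => CcInf.ext fun x => by
    obtain ⟨x, rfl⟩ := QuotientGroup.mk_surjective x
    change f (QuotientGroup.mk (g⁻¹ * x * (m.unop : G)⁻¹)) * val χ m.unop⁻¹ =
      f (QuotientGroup.mk (g⁻¹ * (x * (m.unop : G)⁻¹))) * val χ m.unop⁻¹
    rw [mul_assoc]
  left_smooth := fun (f : CcInf (G ⧸ U) R) => by
    obtain ⟨K, hK, h⟩ := hG.exists_forall_eq_quotient
      (QuotientGroup.isOpenQuotientMap_mk (N := U))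
      (fun g => leftMove' U g⁻¹) (fun g x => g * x)
      (fun g x => congrArg QuotientGroup.mk (show g⁻¹⁻¹ * x = g * x by simp))
      (by fun_prop) (by simp) (by simp) (CcInf.isLcc f)
    refine ⟨K, hK.isOpen, fun k hk => CcInf.ext fun x => ?_⟩
    have := h _ (K.inv_mem hk) x
    rwa [inv_inv] at this
  right_smooth := fun (f : CcInf (G ⧸ U) R) => by
    obtain ⟨K, hK, h⟩ := hM.exists_forall_eq_quotient
      (QuotientGroup.isOpenQuotientMap_mk (N := U))
      (fun m => rightMove' hMU m⁻¹) (fun m x => x * (m : G))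
      (fun m x => congrArg QuotientGroup.mk (show x * ((m⁻¹ : M) : G)⁻¹ = x * m by simp))
      (by fun_prop) (by simp) (by simp) (CcInf.isLcc f)
    refine ⟨K ⊓ χ.toHom.ker, hK.isOpen.inter χ.isOpen_ker, fun k hk => CcInf.ext fun x => ?_⟩
    have := h _ (K.inv_mem hk.1) x
    rw [inv_inv] at this
    change f (rightMove' hMU k x) * val χ k⁻¹ = f x
    rw [this, val_eq_one χ (inv_mem hk.2), mul_one]

variable (hq : IsClosedEmbedding fun m : M => ((m : G) : G ⧸ U))

/-- The function `m ↦ f(g⁻¹ m U) χ(m)` on `M`. -/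
def leviFn (g : G) : CcInf (G ⧸ U) R →+ CcInf M R where
  toFun f := ⟨fun m => f ((g⁻¹ * m : G) : G ⧸ U) * val χ m, by
    have h1 : IsLcc fun m : M => f ((g⁻¹ * m : G) : G ⧸ U) :=
      ((CcInf.isLcc f).comp_homeomorph (leftMove' U g)).comp_isClosedEmbedding hq
    exact h1.smul (isLocallyConstant_val χ)⟩
  map_zero' := CcInf.ext fun m => zero_mul _
  map_add' f f' := CcInf.ext fun m => add_mul _ _ _

@[simp] theorem leviFn_apply (g : G) (f : CcInf (G ⧸ U) R) (m : M) :
    leviFn χ hq g f m = f ((g⁻¹ * m : G) : G ⧸ U) * val χ m := rfl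

theorem leviFn_levi_mul (m : M) (g : G) (f : CcInf (G ⧸ U) R) :
    leviFn χ hq (m * g) f = val χ m • CcInf.comp (Homeomorph.mulLeft m⁻¹) (leviFn χ hq g f) := by
  refine CcInf.ext fun x => ?_
  change f _ * _ = val χ m * (f ((g⁻¹ * ((m⁻¹ * x : M) : G) : G) : G ⧸ U) * val χ (m⁻¹ * x))
  rw [← mul_assoc, ← val_comm χ m, mul_assoc, ← val_mul, mul_inv_cancel_left]
  simp [mul_assoc]

include hMU in
theorem leviFn_unip_mul {x : G} (hx : x ∈ U) (g : G) (f : CcInf (G ⧸ U) R) :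
    leviFn χ hq (x * g) f = leviFn χ hq g f := by
  refine CcInf.ext fun m => ?_
  have h : (((x * g)⁻¹ * m : G) : G ⧸ U) = ((g⁻¹ * m : G) : G ⧸ U) := QuotientGroup.eq.2 (by
    have := hMU m⁻¹ x hx
    simpa [mul_assoc] using this)
  rw [leviFn_apply, leviFn_apply, h]

theorem leviFn_left (g x : G) (f : CcInf (G ⧸ U) R) :
    leviFn χ hq g (CcInf.comp (leftMove' U x) f) = leviFn χ hq (g * x) f := by
  refine CcInf.ext fun m => ?_
  change f ((x⁻¹ * (g⁻¹ * m) : G) : G ⧸ U) * _ = f (((g * x)⁻¹ * m : G) : G ⧸ U) * _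
  rw [mul_inv_rev, mul_assoc]

theorem leviFn_smul (r : R) (g : G) (f : CcInf (G ⧸ U) R) :
    leviFn χ hq g (r • f) = r • leviFn χ hq g f :=
  CcInf.ext fun _ => mul_assoc _ _ _

/-- The factor `χ(x)` in `leviFn` combines with the twist `χ(m)` of the right action to `χ(x m)`, so
that `leviFn` is equivariant for untwisted right translation. -/
theorem leviFn_right (g : G) (m : M) (r : Rᵐᵒᵖ) (f : CcInf (G ⧸ U) R) :
    leviFn χ hq g (r • (inductionBimodule hMU χ).right (MulOpposite.op m⁻¹) f) =
      r • CcInf.comp (Homeomorph.mulRight m) (leviFn χ hq g f) := by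
  refine CcInf.ext fun x => ?_
  change f ((g⁻¹ * x * ((m⁻¹ : M) : G)⁻¹ : G) : G ⧸ U) * val χ m⁻¹⁻¹ * r.unop * val χ x =
    f ((g⁻¹ * (x * m : M) : G) : G ⧸ U) * val χ (x * m) * r.unop
  have h : g⁻¹ * x * ((m⁻¹ : M) : G)⁻¹ = g⁻¹ * (x * m : M) := by simp [mul_assoc]
  rw [h, inv_inv, val_mul, mul_assoc _ r.unop, val_comm χ x, ← mul_assoc,
    mul_assoc (f _) (val χ m), val_comm χ x (val χ m)]

variable [hprime : Fact p.Prime] (hp : IsUnit (p : R)) (hG : LocallyProP p G)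
  (hM : LocallyProP p M) {μ : @Measure M (borel M)} (hμ : IsNormalizedHaar p μ)

include hp hμ hM hG

theorem leviFn_heckeRight (g : G) (f : CcInf (G ⧸ U) R) (φ : CcInf M R) :
    leviFn χ hq g ((inductionBimodule hMU χ).heckeRight μ f φ) =
      heckeMul μ (leviFn χ hq g f) φ := by
  rw [heckeMul_eq_rightRegular hp hμ hM]
  have hp' := isUnit_natCast_mulOpposite hp
  exact (isSmooth_inductionBimodule hMU χ hG hM).rightRep.map_heckeAct_of_comm hp' hμ hM hp'
    (X := CcInf M R) id (fun m => CcInf.comp (Homeomorph.mulRight m))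
    (leviFn χ hq g : CcInf (G ⧸ U) R →+ CcInf M R)
    (fun r m f => leviFn_right hMU χ hq g m r f) (heckeFlip φ) f

/-- The map from the tensor product to the induced representation: `(f ⊗ w)(g)` is the action
of `leviFn g f` on `w`. -/
theorem exists_inductionHom (W : SmoothRep R M) :
    ∃ T : BalTensor ((inductionBimodule hMU χ).heckeRight μ) (W.heckeAct μ) →+ indSpace U χ W,
      ∀ (f : CcInf (G ⧸ U) R) (w : W) (g : G),
        (T (BalTensor.tmul (Y := (inductionBimodule hMU χ).carrier) _ _ f w)).1 g =
          W.heckeAct μ (leviFn χ hq g f) w := by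
  let t₀ : CcInf (G ⧸ U) R → W → indSpace U χ W := fun f w =>
    ⟨fun g => W.heckeAct μ (leviFn χ hq g f) w, fun x hx g => by
        change W.heckeAct _ _ _ = W.heckeAct _ _ _
        rw [leviFn_unip_mul hMU χ hq hx], fun m g => by
        change W.heckeAct _ _ _ = _ • W.ρ m (W.heckeAct _ _ _)
        rw [leviFn_levi_mul, W.smul_heckeAct hp hμ hM, W.ρ_heckeAct hp hμ hM], by
        obtain ⟨K, hK, h⟩ := (isSmooth_inductionBimodule hMU χ hG hM).left_smooth f
        refine ⟨K, hK, fun k hk g => ?_⟩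
        change W.heckeAct _ _ _ = W.heckeAct _ _ _
        rw [← leviFn_left]
        exact congrArg (fun f => W.heckeAct μ (leviFn χ hq g f) w) (h k hk)⟩
  let t : CcInf (G ⧸ U) R →+ W →+ indSpace U χ W :=
    AddMonoidHom.mk' (fun f => AddMonoidHom.mk' (t₀ f) fun w w' =>
      Subtype.ext (funext fun g => W.heckeAct_add hp hμ hM _ w w')) fun f f' => by
        refine AddMonoidHom.ext fun w => Subtype.ext (funext fun g => ?_)
        change W.heckeAct μ (leviFn χ hq g (f + f')) w =
          W.heckeAct μ (leviFn χ hq g f) w + W.heckeAct μ (leviFn χ hq g f') w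
        rw [map_add, W.add_heckeAct hp hμ hM]
  refine ⟨BalTensor.lift (Y := (inductionBimodule hMU χ).carrier) t fun f φ w =>
    Subtype.ext (funext fun g => ?_), fun f w g => ?_⟩
  · change W.heckeAct μ (leviFn χ hq g ((inductionBimodule hMU χ).heckeRight μ f φ)) w =
      W.heckeAct μ (leviFn χ hq g f) (W.heckeAct μ φ w)
    refine (congrArg (fun ψ => W.heckeAct μ ψ w)
      (leviFn_heckeRight hMU χ hq hp hG hM hμ g f φ)).trans ?_
    rw [W.heckeMul_heckeAct hp hμ hM]
  · exact congrArg (fun F : indSpace U χ W => F.1 g)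
      (BalTensor.lift_tmul (Y := (inductionBimodule hMU χ).carrier) _ _ _ _)

end Jacquet

/-! ### Orbits of a compact open subgroup on `G / U`. -/

namespace Jacquet

section orbits

variable {p : ℕ} {R : Type u} [Ring R] {G : Type u} [Group G]
  [TopologicalSpace G] [IsTopologicalGroup G] {M U : Subgroup G}

theorem doubleCoset_mul_right {K : Subgroup G} {x : G} (hx : x ∈ U) (g : G) :
    DoubleCoset.doubleCoset (g * x) (K : Set G) U = DoubleCoset.doubleCoset g K U :=
  DoubleCoset.doubleCoset_eq_of_mem
    (DoubleCoset.mem_doubleCoset.2 ⟨1, K.one_mem, x, hx, by simp⟩)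

theorem doubleCoset_mul_left {K : Subgroup G} {k : G} (hk : k ∈ K) (g : G) :
    DoubleCoset.doubleCoset (k * g) (K : Set G) U = DoubleCoset.doubleCoset g K U :=
  DoubleCoset.doubleCoset_eq_of_mem
    (DoubleCoset.mem_doubleCoset.2 ⟨k, hk, 1, U.one_mem, by simp⟩)

/-- The orbit under `K` of a point of `G / U`, as a double coset. -/
def orbitSet (K U : Subgroup G) : G ⧸ U → Set G :=
  Quotient.lift (fun x => DoubleCoset.doubleCoset x (K : Set G) U) fun a b hab => by
    have := doubleCoset_mul_right (K := K) (QuotientGroup.leftRel_apply.1 hab) a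
    rw [mul_inv_cancel_left] at this
    exact this.symm

@[simp] theorem orbitSet_mk (K U : Subgroup G) (g : G) :
    orbitSet K U (g : G ⧸ U) = DoubleCoset.doubleCoset g K U := rfl

theorem isLocallyConstant_orbitSet {K : Subgroup G} (hK : IsOpen (K : Set G)) :
    IsLocallyConstant (orbitSet K U) := by
  refine (QuotientGroup.isOpenQuotientMap_mk (N := U)).isQuotientMap.isLocallyConstant ?_
  -- Inversion turns the left invariance under `K` into the right invariance that the criterion
  -- requires.
  have h : IsLocallyConstant fun g : G => orbitSet K U ((g⁻¹ : G) : G ⧸ U) :=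
    isLocallyConstant_of_right_invariant hK fun k hk g => by
      rw [orbitSet_mk, orbitSet_mk, mul_inv_rev, doubleCoset_mul_left (K.inv_mem hk)]
  have := h.comp_continuous (continuous_inv (G := G))
  refine (funext fun g => ?_ : (fun g : G => orbitSet K U (g : G ⧸ U)) = _) ▸ this
  simp

variable {K : Subgroup G} (hK : IsCompactOpenProP p K)

include hK in
theorem isCompact_orbit (g : G) :
    IsCompact (orbitSet K U ⁻¹' {DoubleCoset.doubleCoset g (K : Set G) U}) := by
  refine (hK.isCompact.image (f := fun k : G => ((k * g : G) : G ⧸ U))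
    (QuotientGroup.continuous_mk.comp (continuous_mul_const g))).of_isClosed_subset
    ((isLocallyConstant_orbitSet hK.isOpen).isClopen_fiber _).isClosed ?_
  intro x hx
  obtain ⟨x, rfl⟩ := QuotientGroup.mk_surjective x
  have hx' := DoubleCoset.mem_doubleCoset_self K U x
  rw [← orbitSet_mk, hx] at hx'
  obtain ⟨k, hk, u, hu, rfl⟩ := DoubleCoset.mem_doubleCoset.1 hx'
  exact ⟨k, hk, QuotientGroup.eq.2 (by simpa [mul_assoc] using hu)⟩

/-- The characteristic function of the orbit `K g U / U`. -/
noncomputable def orbitFn (R : Type u) [Ring R] (U : Subgroup G) (hK : IsCompactOpenProP p K)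
    (g : G) : CcInf (G ⧸ U) R :=
  CcInf.single _ ((isLocallyConstant_orbitSet hK.isOpen).isClopen_fiber _) (isCompact_orbit hK g) 1

theorem orbitFn_of_mem {g h : G} (hh : h ∈ DoubleCoset.doubleCoset g (K : Set G) U) :
    orbitFn R U hK g (h : G ⧸ U) = 1 :=
  CcInf.single_of_mem _ _ _ (DoubleCoset.doubleCoset_eq_of_mem hh)

theorem orbitFn_of_notMem {g h : G} (hh : h ∉ DoubleCoset.doubleCoset g (K : Set G) U) :
    orbitFn R U hK g (h : G ⧸ U) = 0 :=
  CcInf.single_of_notMem _ _ _ fun h' => hh (by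
    have h' : DoubleCoset.doubleCoset h (K : Set G) U = _ := h'
    rw [← h']
    exact DoubleCoset.mem_doubleCoset_self K U h)

theorem orbitFn_eq_of_iff {g h h' : G} (hh : h ∈ DoubleCoset.doubleCoset g (K : Set G) U ↔
    h' ∈ DoubleCoset.doubleCoset g (K : Set G) U) :
    orbitFn R U hK g (h : G ⧸ U) = orbitFn R U hK g (h' : G ⧸ U) := by
  by_cases h1 : h ∈ DoubleCoset.doubleCoset g (K : Set G) U
  · rw [orbitFn_of_mem hK h1, orbitFn_of_mem hK (hh.1 h1)]
  · rw [orbitFn_of_notMem hK h1, orbitFn_of_notMem hK fun h2 => h1 (hh.2 h2)]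

variable (hMU : ∀ (m : M), ∀ x ∈ U, (m : G) * x * (m : G)⁻¹ ∈ U)

/-- The stabilizer in `M` of the orbit `K g U / U`. -/
def leviStab (K : Subgroup G) (g : G) : Subgroup M where
  carrier := {m | ∃ x ∈ U, g * m * x * g⁻¹ ∈ K}
  one_mem' := ⟨1, U.one_mem, by simp⟩
  mul_mem' := by
    rintro m m' ⟨x, hx, h⟩ ⟨x', hx', h'⟩
    refine ⟨(m' : G)⁻¹ * x * m' * x', U.mul_mem (by simpa using hMU m'⁻¹ x hx) hx', ?_⟩
    simpa [mul_assoc] using K.mul_mem h h'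
  inv_mem' := by
    rintro m ⟨x, hx, h⟩
    refine ⟨m * x⁻¹ * (m : G)⁻¹, hMU m _ (U.inv_mem hx), ?_⟩
    simpa [mul_assoc] using K.inv_mem h

theorem mem_leviStab {g : G} {m : M} :
    m ∈ leviStab hMU K g ↔ g * m ∈ DoubleCoset.doubleCoset g (K : Set G) U := by
  rw [DoubleCoset.mem_doubleCoset]
  constructor
  · rintro ⟨x, hx, h⟩
    exact ⟨_, h, x⁻¹, U.inv_mem hx, by simp [mul_assoc]⟩
  · rintro ⟨k, hk, x, hx, h⟩
    exact ⟨x⁻¹, U.inv_mem hx, by rw [h]; simpa [mul_assoc] using hk⟩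

/-- Since `m` normalises `U`, right multiplication by `m` maps `K g U` onto `K g m U`, which is `K g
U` again. -/
theorem mul_mem_doubleCoset_iff {g h : G} {m : M} (hm : m ∈ leviStab hMU K g) :
    h * m ∈ DoubleCoset.doubleCoset g (K : Set G) U ↔
      h ∈ DoubleCoset.doubleCoset g (K : Set G) U := by
  have key : ∀ (h : G) (m : M), m ∈ leviStab hMU K g →
      h ∈ DoubleCoset.doubleCoset g (K : Set G) U →
      h * m ∈ DoubleCoset.doubleCoset g (K : Set G) U := by
    intro h m hm hh
    obtain ⟨k, hk, x, hx, rfl⟩ := DoubleCoset.mem_doubleCoset.1 hh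
    obtain ⟨k', hk', x', hx', h'⟩ := DoubleCoset.mem_doubleCoset.1 ((mem_leviStab hMU).1 hm)
    refine DoubleCoset.mem_doubleCoset.2 ⟨k * k', K.mul_mem hk hk',
      x' * ((m : G)⁻¹ * x * m), U.mul_mem hx' (by simpa using hMU m⁻¹ x hx), ?_⟩
    have : k * k' * g * (x' * ((m : G)⁻¹ * x * m)) =
      k * (k' * g * x') * ((m : G)⁻¹ * x * m) := by simp [mul_assoc]
    rw [this, ← h']
    simp [mul_assoc]
  refine ⟨fun h' => ?_, key h m hm⟩
  simpa using key _ _ (inv_mem hm) h'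

variable (hq : IsClosedEmbedding fun m : M => ((m : G) : G ⧸ U))

-- With `L = g⁻¹ K g`, the stabiliser is the preimage of the compact open image of `L` under the
-- closed embedding of `M` in `G / U`. If `m x ∈ L` with `x ∈ U`, then `(m x) ^ k ∈ m ^ k U`, so the
-- `p`-power iterates of `m` converge in `G / U`.
include hq hK in
theorem isCompactOpenProP_leviStab (g : G) : IsCompactOpenProP p (leviStab hMU K g) := by
  set L := K.map (MulAut.conj g⁻¹).toMonoidHom
  have hL : IsCompactOpenProP p L := hK.map_conj g⁻¹
  have hmemL : ∀ y, g * y * g⁻¹ ∈ K → y ∈ L := fun y hy =>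
    Subgroup.mem_map.2 ⟨_, hy, by simp [mul_assoc]⟩
  have hset : (leviStab hMU K g : Set M) =
      (fun m : M => ((m : G) : G ⧸ U)) ⁻¹' (QuotientGroup.mk '' (L : Set G)) := by
    ext m
    constructor
    · rintro ⟨x, hx, h⟩
      exact ⟨m * x, hmemL _ (by simpa [mul_assoc] using h),
        QuotientGroup.eq.2 (by simpa using U.inv_mem hx)⟩
    · rintro ⟨_, ⟨k, hk, rfl⟩, h⟩
      refine ⟨_, U.inv_mem (QuotientGroup.eq.1 h), ?_⟩
      simpa [mul_assoc] using hk
  refine ⟨?_, ?_, fun m hm => ?_⟩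
  · rw [hset]
    exact ((QuotientGroup.isOpenQuotientMap_mk (N := U)).isOpenMap _ hL.isOpen).preimage
      hq.continuous
  · rw [hset]
    exact hq.isCompact_preimage (hL.isCompact.image QuotientGroup.continuous_mk)
  · obtain ⟨x, hx, h⟩ := hm
    rw [hq.isInducing.tendsto_nhds_iff]
    have h1 := hL.tendsto _ (hmemL (m * x) (by simpa [mul_assoc] using h))
    have h2 : ∀ k : ℕ, ((m : G) ^ k : G)⁻¹ * ((m : G) * x) ^ k ∈ U := by
      intro k
      induction k with
      | zero => simp
      | succ k ih =>
        have h3 := U.mul_mem (hMU m⁻¹ _ ih) hx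
        rw [pow_succ, pow_succ]
        simpa [mul_assoc] using h3
    have h3 := ((QuotientGroup.continuous_mk (N := U)).tendsto 1).comp h1
    refine h3.congr fun j => ?_
    exact (QuotientGroup.eq.2 (by simpa using h2 (p ^ j))).symm

variable (χ : SmoothChar R M)

theorem leviFn_orbitFn_of_mem {g : G} {m : M} (hm : m ∈ leviStab hMU K g) :
    leviFn χ hq g⁻¹ (orbitFn R U hK g) m = val χ m := by
  rw [leviFn_apply, inv_inv, orbitFn_of_mem hK ((mem_leviStab hMU).1 hm), one_mul]

theorem leviFn_orbitFn_of_notMem {g : G} {m : M} (hm : m ∉ leviStab hMU K g) :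
    leviFn χ hq g⁻¹ (orbitFn R U hK g) m = 0 := by
  rw [leviFn_apply, inv_inv, orbitFn_of_notMem hK fun h => hm ((mem_leviStab hMU).2 h), zero_mul]

theorem leviFn_orbitFn_eq_zero {g h : G} (hm : ∀ m : M,
    h * m ∉ DoubleCoset.doubleCoset g (K : Set G) U) :
    leviFn χ hq h⁻¹ (orbitFn R U hK g) = 0 :=
  CcInf.ext fun m => by
    rw [leviFn_apply, inv_inv, orbitFn_of_notMem hK (hm m), zero_mul]
    rfl

variable [hprime : Fact p.Prime] (hp : IsUnit (p : R)) {μ : @Measure M (borel M)}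
  (hμ : IsNormalizedHaar p μ) (hM : LocallyProP p M) (hG : LocallyProP p G)

include hp hμ

/-- Only the stabiliser contributes to the integral. It fixes the orbit function up to the twist,
which is inverse to the value of `χ` in `leviFn`, and the volume cancels. So this element of `H(M)`
is a local unit for the orbit function. -/
theorem heckeRight_orbitFn (g : G) :
    (inductionBimodule hMU χ).heckeRight μ (orbitFn R U hK g)
      (Ring.inverse (ringVol R μ (leviStab hMU K g)) • leviFn χ hq g⁻¹ (orbitFn R U hK g)) =
        orbitFn R U hK g := by
  have hL := isCompactOpenProP_leviStab hK hMU hq g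
  have hp' := isUnit_natCast_mulOpposite hp
  set c := Ring.inverse (ringVol R μ (leviStab hMU K g))
  have h1 := haarIntegral_coset (R := Rᵐᵒᵖ) (V := CcInf (G ⧸ U) R) hp' hμ hL 1
    (F := fun m => MulOpposite.op ((c • leviFn χ hq g⁻¹ (orbitFn R U hK g)) m⁻¹) •
      (MulOpposite.op (val χ m⁻¹⁻¹) • CcInf.comp (rightMove' hMU m⁻¹) (orbitFn R U hK g)))
    (v := MulOpposite.op c • orbitFn R U hK g) (fun m hm => ?_) (fun m hm => ?_)
  · refine h1.trans ?_
    -- The integral over `Rᵐᵒᵖ` carries the volume as an element of `Rᵐᵒᵖ`; the identity, as an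
    -- additive map, converts it to an element of `R`.
    have h2 := map_ringVol_smul hp hp' hμ hL (AddMonoidHom.id (CcInf (G ⧸ U) R))
      (MulOpposite.op c • orbitFn R U hK g)
    refine h2.symm.trans (CcInf.ext fun x => ?_)
    change ringVol R μ (leviStab hMU K g) * (orbitFn R U hK g x * c) = _
    rw [← mul_assoc, (ringVol_commute hp hμ hL _).eq, mul_assoc,
      Ring.mul_inverse_cancel _ (isUnit_ringVol hp hμ hL), mul_one]
  · rw [one_mul]
    refine CcInf.ext fun x => ?_
    obtain ⟨x, rfl⟩ := QuotientGroup.mk_surjective x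
    change orbitFn R U hK g ((x * ((m⁻¹ : M) : G)⁻¹ : G) : G ⧸ U) * val χ m⁻¹⁻¹ *
      (c * leviFn χ hq g⁻¹ (orbitFn R U hK g) m⁻¹) = orbitFn R U hK g (x : G ⧸ U) * c
    rw [leviFn_orbitFn_of_mem hK hMU hq χ (inv_mem hm), inv_inv, mul_assoc, val_comm χ m⁻¹ c,
      ← mul_assoc (val χ m), val_mul_inv, one_mul, Subgroup.coe_inv, inv_inv,
      orbitFn_eq_of_iff hK (mul_mem_doubleCoset_iff hMU hm)]
  · rw [inv_one, one_mul] at hm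
    have : (c • leviFn χ hq g⁻¹ (orbitFn R U hK g)) m⁻¹ = 0 := by
      rw [CcInf.smul_apply, leviFn_orbitFn_of_notMem hK hMU hq χ fun h => hm (by
        simpa using inv_mem h), mul_zero]
    rw [this, MulOpposite.op_zero, zero_smul]

include hM hG

/-- The double coset of `k g m x` is `K g U m`, so `f` is a multiple of the translate of the orbit
function by `m`. A function supported on one small coset in `M` realises this translation; the
factor `χ(m)` undoes the twist. -/
theorem exists_heckeRight_orbitFn_eq (g k x : G) (m : M) (hk : k ∈ K) (hx : x ∈ U) (r : R)
    (f : CcInf (G ⧸ U) R) (h1 : ∀ h ∈ DoubleCoset.doubleCoset (k * g * m * x) (K : Set G) U,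
      f (h : G ⧸ U) = r)
    (h0 : ∀ h ∉ DoubleCoset.doubleCoset (k * g * m * x) (K : Set G) U, f (h : G ⧸ U) = 0) :
    ∃ φ, (inductionBimodule hMU χ).heckeRight μ (orbitFn R U hK g) φ = f := by
  have hY := isSmooth_inductionBimodule hMU χ hG hM
  have hp' := isUnit_natCast_mulOpposite hp
  obtain ⟨L, hL, h⟩ := hY.rightRep.exists_fixed hM (orbitFn R U hK g : CcInf (G ⧸ U) R)
  refine ⟨heckeFlip.symm (cosetFn μ hL m⁻¹ (MulOpposite.op (val χ m * r))), ?_⟩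
  refine (congrArg (fun ψ => hY.rightRep.heckeAct μ ψ (orbitFn R U hK g : CcInf (G ⧸ U) R))
    (heckeFlip.apply_symm_apply _)).trans ?_
  refine (hY.rightRep.heckeAct_cosetFn hp' hμ hL m⁻¹ _ h).trans (CcInf.ext fun y => ?_)
  obtain ⟨y, rfl⟩ := QuotientGroup.mk_surjective y
  change orbitFn R U hK g ((y * ((m⁻¹⁻¹ : M) : G)⁻¹ : G) : G ⧸ U) * val χ m⁻¹⁻¹⁻¹ *
    (val χ m * r) = f (y : G ⧸ U)
  rw [mul_assoc, ← mul_assoc (val χ _), inv_inv, val_inv_mul, one_mul]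
  rw [doubleCoset_mul_right hx, mul_assoc, doubleCoset_mul_left hk] at h1 h0
  have hiff : y * (m : G)⁻¹ ∈ DoubleCoset.doubleCoset g (K : Set G) U ↔
      y ∈ DoubleCoset.doubleCoset (g * m) (K : Set G) U := by
    rw [DoubleCoset.mem_doubleCoset, DoubleCoset.mem_doubleCoset]
    constructor
    · rintro ⟨k, hk, x, hx, h⟩
      refine ⟨k, hk, (m : G)⁻¹ * x * m, by simpa using hMU m⁻¹ x hx, ?_⟩
      rw [mul_inv_eq_iff_eq_mul] at h
      rw [h]
      simp [mul_assoc]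
    · rintro ⟨k, hk, x, hx, rfl⟩
      exact ⟨k, hk, _, hMU m x hx, by simp [mul_assoc]⟩
  by_cases hy : y ∈ DoubleCoset.doubleCoset (g * m) (K : Set G) U
  · rw [h1 y hy, orbitFn_of_mem hK (hiff.2 hy), one_mul]
  · rw [h0 y hy, orbitFn_of_notMem hK (fun h => hy (hiff.1 h)), zero_mul]

/-- `f` is a finite sum of multiples of indicator functions of `K`-orbits, and each orbit is a
translate by `M` of the orbit of a representative. -/
theorem exists_eq_sum_heckeRight (γ : G → G)
    (hγ : ∀ h, ∃ k ∈ K, ∃ m : M, ∃ x ∈ U, h = k * γ h * m * x) (f : CcInf (G ⧸ U) R)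
    (hf : ∀ k ∈ K, ∀ h : G, f ((k * h : G) : G ⧸ U) = f (h : G ⧸ U)) :
    ∃ (ι : Type u) (T : Finset ι) (h : ι → G) (φ : ι → CcInf M R), f = ∑ i ∈ T,
      (show CcInf (G ⧸ U) R from
        (inductionBimodule hMU χ).heckeRight μ (orbitFn R U hK (γ (h i))) (φ i)) := by
  classical
  obtain ⟨T, F, rfl, hF⟩ := CcInf.exists_eq_sum (isLocallyConstant_orbitSet (U := U) hK.isOpen) f
    (fun x y hxy => by
      obtain ⟨x, rfl⟩ := QuotientGroup.mk_surjective x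
      obtain ⟨y, rfl⟩ := QuotientGroup.mk_surjective y
      have hx := DoubleCoset.mem_doubleCoset_self K U x
      rw [← orbitSet_mk, hxy] at hx
      obtain ⟨k, hk, v, hv, rfl⟩ := DoubleCoset.mem_doubleCoset.1 hx
      have : ((k * y * v : G) : G ⧸ U) = ((k * y : G) : G ⧸ U) :=
        QuotientGroup.eq.2 (by simpa [mul_assoc] using U.inv_mem hv)
      rw [this, hf k hk])
  have key : ∀ i : T, ∃ (h : G) (φ : CcInf M R),
      (inductionBimodule hMU χ).heckeRight μ (orbitFn R U hK (γ h)) φ = F i := by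
    rintro ⟨i, hi⟩
    obtain ⟨h, rfl, h1, h0⟩ := hF i hi
    obtain ⟨h, rfl⟩ := QuotientGroup.mk_surjective h
    obtain ⟨k, hk, m, x, hx, e⟩ := hγ h
    refine ⟨h, exists_heckeRight_orbitFn_eq hK hMU χ hp hμ hM hG (γ h) k x m hk hx _
      (F (orbitSet K U h)) (fun h' hh' => h1 h' ?_) (fun h' hh' => h0 h' fun e' => hh' ?_)⟩
    · rw [← e] at hh'
      exact DoubleCoset.doubleCoset_eq_of_mem hh'
    · rw [← e, ← orbitSet_mk, ← e']
      exact DoubleCoset.mem_doubleCoset_self K U h'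
  choose h φ hφ using key
  refine ⟨T, Finset.univ, h, φ, ?_⟩
  rw [← Finset.sum_coe_sort]
  exact Finset.sum_congr rfl fun i _ => (hφ i).symm

end orbits

end Jacquet

/-! ### Parabolic induction as a tensor product. -/

namespace Jacquet

variable {p : ℕ} {R : Type u} [Ring R] {G : Type u} [Group G]
  [TopologicalSpace G] [IsTopologicalGroup G] {M U : Subgroup G} {K : Subgroup G}
  (hK : IsCompactOpenProP p K)
  (hMU : ∀ (m : M), ∀ x ∈ U, (m : G) * x * (m : G)⁻¹ ∈ U) (χ : SmoothChar R M)
  (μ : @Measure M (borel M))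

/-- The elementary tensor of the characteristic function of `K g U / U` and `w`. -/
noncomputable def orbitTensor (hK : IsCompactOpenProP p K) (W : SmoothRep R M) (g : G) (w : W) :
    BalTensor ((inductionBimodule hMU χ).heckeRight μ) (W.heckeAct μ) :=
  BalTensor.tmul (Y := (inductionBimodule hMU χ).carrier) _ _ (orbitFn R U hK g) w

theorem orbitTensor_add (W : SmoothRep R M) (g : G) (w w' : W) :
    orbitTensor hMU χ μ hK W g (w + w') =
      orbitTensor hMU χ μ hK W g w + orbitTensor hMU χ μ hK W g w' :=
  BalTensor.tmul_add (Y := (inductionBimodule hMU χ).carrier) _ _ _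

theorem orbitTensor_zero (W : SmoothRep R M) (g : G) : orbitTensor hMU χ μ hK W g 0 = 0 :=
  BalTensor.tmul_zero (Y := (inductionBimodule hMU χ).carrier) _

/-- The double cosets of a compact open subgroup and a cocompact subgroup have a finite system of
representatives. -/
theorem exists_doubleCoset_representatives {P C : Set G} (hK : IsOpen (K : Set G))
    (hC : IsCompact C) (hCP : ∀ g, ∃ c ∈ C, c⁻¹ * g ∈ P) (r : G → Set G)
    (hr : ∀ k ∈ K, ∀ g, r (k * g) = r g) (hrP : ∀ g, ∀ y ∈ P, r (g * y) = r g) :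
    ∃ (S : Finset (Set G)) (γ : Set G → G), (∀ g, r g ∈ S) ∧ ∀ g, r (γ (r g)) = r g := by
  classical
  obtain ⟨T, hT⟩ := hC.elim_finite_subcover (fun c : G => (fun g => g * c⁻¹) ⁻¹' (K : Set G))
    (fun c => hK.preimage (by fun_prop)) (fun c _ => Set.mem_iUnion.2 ⟨c, by simp⟩)
  refine ⟨T.image r, fun s => if h : ∃ g, r g = s then h.choose else 1, fun g => ?_, fun g => ?_⟩
  · obtain ⟨c, hc, hcP⟩ := hCP g
    obtain ⟨t, ht, hct⟩ := Set.mem_iUnion₂.1 (hT hc)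
    refine Finset.mem_image.2 ⟨t, ht, ?_⟩
    have h1 := hr _ hct t
    have h2 := hrP c _ hcP
    rw [mul_inv_cancel_left] at h2
    rw [inv_mul_cancel_right] at h1
    rw [h2, h1]
  · have h : ∃ g', r g' = r g := ⟨g, rfl⟩
    simp only [dif_pos h]
    exact h.choose_spec

variable {χ μ} [hprime : Fact p.Prime] (hp : IsUnit (p : R)) (hμ : IsNormalizedHaar p μ)
  (hM : LocallyProP p M) (hG : LocallyProP p G)
  (hq : IsClosedEmbedding fun m : M => ((m : G) : G ⧸ U)) (W : SmoothRep R M)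

include hp hμ hM hG

-- The local unit of `heckeRight_orbitFn` is moved to the second factor. Consequently the tensor
-- depends on `w` only through the action of `leviFn` on it, which is what the map to the induced
-- representation detects.
include hq in
theorem orbitTensor_heckeAct (g : G) (w : W) :
    orbitTensor hMU χ μ hK W g (W.heckeAct μ (Ring.inverse (ringVol R μ (leviStab hMU K g)) •
      leviFn χ hq g⁻¹ (orbitFn R U hK g)) w) = orbitTensor hMU χ μ hK W g w := by
  refine (BalTensor.balanced (Y := (inductionBimodule hMU χ).carrier) _ _ _).symm.trans ?_
  rw [heckeRight_orbitFn hK hMU hq χ hp hμ]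
  rfl

/-- Each summand of `f` is an orbit function times an element of `H(M)`; these elements move to the
second factor, and terms with the same representative are collected. -/
theorem exists_eq_sum_orbitTensor (S : Finset (Set G)) (r : G → Set G) (hS : ∀ g, r g ∈ S)
    (γ : Set G → G) (hγ : ∀ h, ∃ k ∈ K, ∃ m : M, ∃ x ∈ U, h = k * γ (r h) * m * x)
    (f : CcInf (G ⧸ U) R) (hf : ∀ k ∈ K, ∀ h : G, f ((k * h : G) : G ⧸ U) = f (h : G ⧸ U)) (w : W) :
    ∃ w' : Set G → W,
      BalTensor.tmul (Y := (inductionBimodule hMU χ).carrier) _ (W.heckeAct μ) f w =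
        ∑ s ∈ S, orbitTensor hMU χ μ hK W (γ s) (w' s) := by
  classical
  obtain ⟨ι, T, h, φ, rfl⟩ := exists_eq_sum_heckeRight hK hMU χ hp hμ hM hG (fun g => γ (r g)) hγ f hf
  have e1 : BalTensor.tmul (Y := (inductionBimodule hMU χ).carrier) _ (W.heckeAct μ)
      (∑ i ∈ T, (inductionBimodule hMU χ).heckeRight μ (orbitFn R U hK (γ (r (h i)))) (φ i)) w =
      ∑ i ∈ T, orbitTensor hMU χ μ hK W (γ (r (h i))) (W.heckeAct μ (φ i) w) := by
    rw [BalTensor.sum_tmul]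
    exact Finset.sum_congr rfl fun i _ =>
      BalTensor.balanced (Y := (inductionBimodule hMU χ).carrier) _ _ _
  refine ⟨fun s => ∑ i ∈ T.filter fun i => r (h i) = s, W.heckeAct μ (φ i) w, e1.trans ?_⟩
  have e2 : ∀ s, orbitTensor hMU χ μ hK W (γ s)
      (∑ i ∈ T.filter fun i => r (h i) = s, W.heckeAct μ (φ i) w) =
      ∑ i ∈ T.filter fun i => r (h i) = s,
        orbitTensor hMU χ μ hK W (γ s) (W.heckeAct μ (φ i) w) := fun s =>
    map_sum (AddMonoidHom.mk' (orbitTensor hMU χ μ hK W (γ s)) (orbitTensor_add hK hMU χ μ W _)) _ _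
  simp only [e2]
  rw [← Finset.sum_fiberwise_of_maps_to (g := fun i => r (h i)) (t := S) fun i _ => hS _]
  refine Finset.sum_congr rfl fun s _ => Finset.sum_congr rfl fun i hi => ?_
  rw [(Finset.mem_filter.1 hi).2]

variable {C : Set G} {P : Subgroup G} (hMP : M ≤ P) (hUP : U ≤ P)
  (hP : ∀ y ∈ P, ∃ m : M, ∃ x ∈ U, y = m * x) (hC : IsCompact C)
  (hCP : ∀ g, ∃ c ∈ C, c⁻¹ * g ∈ P)

-- The index `r g` is the double coset `K g P`; finitely many occur because `G / P` is compact and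
-- `K` open. As `M` and `U` lie in `P`, a relation between `γ s` and `γ s'` through `K`, `M` and `U`
-- forces equal double cosets.
omit hp hμ hM hG in
include hMP hUP hP hC hCP hK in
theorem exists_representatives : ∃ (S : Finset (Set G)) (r : G → Set G) (γ : Set G → G),
    (∀ g, r g ∈ S) ∧ (∀ h, ∃ k ∈ K, ∃ m : M, ∃ x ∈ U, h = k * γ (r h) * m * x) ∧
    (∀ s ∈ S, ∀ s' ∈ S, ∀ m : M,
      γ s * m ∈ DoubleCoset.doubleCoset (γ s') (K : Set G) U → s = s') := by
  have hr : ∀ k ∈ K, ∀ g, DoubleCoset.doubleCoset (k * g) (K : Set G) P =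
    DoubleCoset.doubleCoset g K P := fun k hk g => doubleCoset_mul_left hk g
  have hrP : ∀ g, ∀ y ∈ P, DoubleCoset.doubleCoset (g * y) (K : Set G) P =
    DoubleCoset.doubleCoset g K P := fun g y hy => doubleCoset_mul_right hy g
  obtain ⟨S, γ, hS, hγ⟩ := exists_doubleCoset_representatives (P := P) hK.isOpen hC hCP
    (fun g => DoubleCoset.doubleCoset g (K : Set G) P) hr hrP
  classical
  -- The function `γ` is controlled only on sets that are double cosets, so other members of `S` are
  -- discarded.
  let S' := S.filter fun s => ∃ g, DoubleCoset.doubleCoset g (K : Set G) P = s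
  refine ⟨S', _, γ, fun g => Finset.mem_filter.2 ⟨hS g, g, rfl⟩, fun h => ?_, ?_⟩
  · have h1 := DoubleCoset.mem_doubleCoset_self K P h
    rw [← hγ h] at h1
    obtain ⟨k, hk, y, hy, e⟩ := DoubleCoset.mem_doubleCoset.1 h1
    obtain ⟨m, x, hx, rfl⟩ := hP y hy
    exact ⟨k, hk, m, x, hx, by rw [mul_assoc _ (m : G) x]; exact e⟩
  · intro s hs s' hs' m hm
    obtain ⟨-, g, rfl⟩ := Finset.mem_filter.1 hs
    obtain ⟨-, g', rfl⟩ := Finset.mem_filter.1 hs'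
    obtain ⟨k, hk, x, hx, e⟩ := DoubleCoset.mem_doubleCoset.1 hm
    have h1 := hγ g
    have h2 := hγ g'
    rw [← h1, ← h2, ← hrP _ _ (hMP m.2), e, mul_assoc, hr k hk, hrP _ _ (hUP hx), h2]

include hq hMP hUP hP hC hCP in
/-- Parabolic induction is the tensor product with the functions on `G / U`. -/
theorem isTensorFunctor_induction {μG : @Measure G (borel G)} (hμG : IsNormalizedHaar p μG) :
    (inductionBimodule hMU χ).IsTensorFunctor μG μ (induction U χ) := by
  have hsm := isSmooth_inductionBimodule hMU χ hG hM
  choose T hT using exists_inductionHom hMU χ hq hp hG hM hμ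
  have hTo : ∀ {K : Subgroup G} (hK : IsCompactOpenProP p K) (W : SmoothRep R M) (h : G) (w : W)
      (g : G), (T W (orbitTensor hMU χ μ hK W h w)).1 g =
        W.heckeAct μ (leviFn χ hq g (orbitFn R U hK h)) w := fun hK W h w g => hT W _ w g
  -- At `(γ s)⁻¹` only the term for `s` survives, since `γ s M` does not meet `K γ s' U` for `s' ≠
  -- s`.
  have hsum : ∀ {K : Subgroup G} (hK : IsCompactOpenProP p K) (W : SmoothRep R M)
      (S : Finset (Set G)) (γ : Set G → G), (∀ s ∈ S, ∀ s' ∈ S, ∀ m : M,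
        γ s * m ∈ DoubleCoset.doubleCoset (γ s') (K : Set G) U → s = s') →
      ∀ (w : Set G → W), ∀ s ∈ S,
        (T W (∑ s ∈ S, orbitTensor hMU χ μ hK W (γ s) (w s))).1 (γ s)⁻¹ =
          W.heckeAct μ (leviFn χ hq (γ s)⁻¹ (orbitFn R U hK (γ s))) (w s) := by
    intro K hK W S γ hγ w s hs
    rw [map_sum, AddSubmonoidClass.coe_finsetSum, Finset.sum_apply, Finset.sum_eq_single s]
    · exact hTo hK W _ _ _
    · intro s' hs' hne
      rw [hTo, leviFn_orbitFn_eq_zero hK hq χ fun m hm => hne (hγ s hs s' hs' m hm).symm]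
      exact map_zero ((W.heckeActHom hp hμ hM).flip (w s'))
    · exact fun h => (h hs).elim
  have hbij : ∀ W, Function.Bijective (T W) := fun W => by
    refine ⟨(injective_iff_map_eq_zero _).2 fun z hz => ?_, fun F => ?_⟩
    -- The claim ranges over all smaller subgroups and all systems of representatives, so that two
    -- tensors can be written with the same ones and added.
    · have hz' : ∃ K : Subgroup G, ∃ hK : IsCompactOpenProP p K, ∀ (K' : Subgroup G)
          (hK' : IsCompactOpenProP p K'), K' ≤ K → ∀ (S : Finset (Set G)) (r : G → Set G)
          (γ : Set G → G), (∀ g, r g ∈ S) →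
          (∀ h, ∃ k ∈ K', ∃ m : M, ∃ x ∈ U, h = k * γ (r h) * m * x) →
          ∃ w : Set G → W, z = ∑ s ∈ S, orbitTensor hMU χ μ hK' W (γ s) (w s) := by
        clear hz
        induction z using BalTensor.induction_on with
        | h0 =>
          obtain ⟨K, hK, -⟩ := hG _ univ_mem
          exact ⟨K, hK, fun K' hK' _ S r γ _ _ => ⟨0, (Finset.sum_eq_zero fun s _ =>
            orbitTensor_zero hK' hMU χ μ W _).symm⟩⟩
        | ht y w =>
          obtain ⟨K, hKo, h⟩ := hsm.left_smooth y
          obtain ⟨L, hLK, hL⟩ := hG.exists_le hKo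
          refine ⟨L, hL, fun K' hK' hK'L S r γ hS hγ => exists_eq_sum_orbitTensor hK' hMU hp hμ hM hG
            W S r hS γ hγ y (fun k hk g => ?_) w⟩
          have e := congrArg (fun f : CcInf (G ⧸ U) R => f (g : G ⧸ U))
            (h _ (K.inv_mem (hLK (hK'L hk))))
          refine Eq.trans ?_ e
          change y.1 ((k * g : G) : G ⧸ U) = y.1 ((k⁻¹⁻¹ * g : G) : G ⧸ U)
          rw [inv_inv]
        | ha z z' hz hz' =>
          obtain ⟨K, hK, h⟩ := hz
          obtain ⟨K', hK', h'⟩ := hz'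
          refine ⟨K ⊓ K', hK.inf hK', fun L hL hLK S r γ hS hγ => ?_⟩
          obtain ⟨w, rfl⟩ := h L hL (hLK.trans inf_le_left) S r γ hS hγ
          obtain ⟨w', rfl⟩ := h' L hL (hLK.trans inf_le_right) S r γ hS hγ
          refine ⟨w + w', ?_⟩
          rw [← Finset.sum_add_distrib]
          exact Finset.sum_congr rfl fun s _ => (orbitTensor_add hL hMU χ μ W _ _ _).symm
      obtain ⟨K, hK, h⟩ := hz'
      obtain ⟨S, r, γ, hS, hγ, hγS⟩ := exists_representatives hK hMP hUP hP hC hCP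
      obtain ⟨w, rfl⟩ := h K hK le_rfl S r γ hS hγ
      refine Finset.sum_eq_zero fun s hs => ?_
      -- The value of `T W z` at `(γ s)⁻¹` is zero, so `leviFn` of the orbit function kills `w s`,
      -- and the tensor for `s` vanishes by `orbitTensor_heckeAct`.
      have h1 := hsum hK W S γ hγS w s hs
      rw [hz] at h1
      rw [← orbitTensor_heckeAct hK hMU hp hμ hM hG hq, W.smul_heckeAct hp hμ hM, ← h1]
      exact (congrArg _ (smul_zero _)).trans (orbitTensor_zero hK hMU χ μ W _)
    · obtain ⟨F, hFU, hFM, K₀, hK₀, hFK₀⟩ := F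
      obtain ⟨K, hKK₀, hK⟩ := hG.exists_le hK₀
      obtain ⟨S, r, γ, hS, hγ, hγS⟩ := exists_representatives hK hMP hUP hP hC hCP
      -- The action of `leviFn` of the orbit function multiplies `F (γ s)⁻¹` by the volume of the
      -- stabiliser, which is divided out in advance.
      set w : Set G → W := fun s =>
        Ring.inverse (ringVol R μ (leviStab hMU K (γ s))) • F (γ s)⁻¹
      set z := ∑ s ∈ S, orbitTensor hMU χ μ hK W (γ s) (w s)
      have hval : ∀ s ∈ S, (T W z).1 (γ s)⁻¹ = F (γ s)⁻¹ := by
        intro s hs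
        have hL := isCompactOpenProP_leviStab hK hMU hq (γ s)
        rw [hsum hK W S γ hγS w s hs, SmoothRep.heckeAct, haarIntegral_coset hp hμ hL 1 (v := w s),
          smul_smul, Ring.mul_inverse_cancel _ (isUnit_ringVol hp hμ hL), one_smul]
        · intro m hm
          rw [one_mul, leviFn_orbitFn_of_mem hK hMU hq χ hm]
          obtain ⟨x, hx, h⟩ := hm
          -- With `γ = γ s`, right invariance under `γ m x γ⁻¹ ∈ K` together with the transformation
          -- rules for `U` and `M` shows that `F γ⁻¹` is fixed by `χ(m) m`.
          have h1 := hFK₀ _ (hKK₀ h) (γ s)⁻¹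
          have h2 : (γ s)⁻¹ * (γ s * m * x * (γ s)⁻¹) =
            (m * x * (m : G)⁻¹) * (m * (γ s)⁻¹) := by simp [mul_assoc]
          rw [h2, hFU _ (hMU m x hx), hFM] at h1
          simp only [w]
          rw [map_smul, smul_smul, ← val_comm, ← smul_smul, h1]
        · intro m hm
          rw [inv_one, one_mul] at hm
          rw [leviFn_orbitFn_of_notMem hK hMU hq χ hm, zero_smul]
      refine ⟨z, Subtype.ext (funext fun g => ?_)⟩
      change (T W z).1 g = F g
      have hTK : ∀ k ∈ K, ∀ g, (T W z).1 (g * k) = (T W z).1 g := by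
        intro k hk g
        rw [map_sum, AddSubmonoidClass.coe_finsetSum, Finset.sum_apply, Finset.sum_apply]
        refine Finset.sum_congr rfl fun s _ => ?_
        rw [hTo, hTo, ← leviFn_left]
        congr 2
        refine CcInf.ext fun x => ?_
        obtain ⟨x, rfl⟩ := QuotientGroup.mk_surjective x
        refine orbitFn_eq_of_iff hK (h := k⁻¹ * x) (h' := x) ?_
        have e := doubleCoset_mul_left (U := U) (K.inv_mem hk) x
        constructor <;> intro h
        · rw [← DoubleCoset.doubleCoset_eq_of_mem h, e]
          exact DoubleCoset.mem_doubleCoset_self K U x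
        · rw [← DoubleCoset.doubleCoset_eq_of_mem h, ← e]
          exact DoubleCoset.mem_doubleCoset_self K U _
      -- Inverting `g⁻¹ = k γ m x` places `g` in `U M γ⁻¹ K`, where both functions obey the same
      -- rules and agree at `γ⁻¹`.
      obtain ⟨k, hk, m, x, hx, e⟩ := hγ g⁻¹
      have e' : g = x⁻¹ * (((m⁻¹ : M) : G) * (γ (r g⁻¹))⁻¹) * k⁻¹ := by
        refine inv_injective (e.trans ?_)
        simp [mul_assoc]
      obtain ⟨hTU, hTM, -⟩ := (T W z).2
      rw [e', hTK _ (K.inv_mem hk), hFK₀ _ (K₀.inv_mem (hKK₀ hk)), hTU _ (U.inv_mem hx),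
        hFU _ (U.inv_mem hx), hTM, hFM, hval _ (hS _)]
  refine ⟨fun W => AddEquiv.ofBijective (T W) (hbij W), fun W φ y w => ?_, fun V W f y v => ?_⟩
  · change T W _ = ((induction U χ).obj W).heckeAct μG φ (T W _)
    let s : CcInf (G ⧸ U) R →+ indSpace U χ W :=
      (T W).comp ((BalTensor.tmulHom (Y := (inductionBimodule hMU χ).carrier) _ _).flip w)
    refine hsm.leftRep.map_heckeAct_of_comm (X := indSpace U χ W) hp hμG hG hp id
      (fun g => indAct U χ W g) (s : CcInf (G ⧸ U) R →+ indSpace U χ W) (fun r g (y : CcInf (G ⧸ U) R) => ?_) φ y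
    refine Subtype.ext (funext fun h => ?_)
    refine (hT W _ w h).trans ?_
    refine (congrArg (fun ψ => W.heckeAct μ ψ w) (leviFn_smul χ hq r h
      (CcInf.comp (leftMove' U g) y))).trans ?_
    rw [leviFn_left, W.smul_heckeAct hp hμ hM]
    exact congrArg (fun v => r • v) (hT W y w (h * g)).symm
  · refine Subtype.ext (funext fun h => (hT W y _ h).trans ?_)
    rw [← (integrationIsEquivalence hp hμ hM).map V W f]
    exact congrArg (SmoothRep.lin f) (hT V y v h).symm

end Jacquet

/-! ### Local fields -/

namespace IsNonarchimedeanLocalField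

open ValuativeRel

variable {F : Type u} [Field F] [ValuativeRel F] [TopologicalSpace F]
  [IsNonarchimedeanLocalField F]

instance mulArchimedean : MulArchimedean (ValueGroupWithZero F) :=
  .comap (valueGroupWithZeroIsoInt F).toMonoidHom (valueGroupWithZeroIsoInt F).strictMono

variable (F) in
theorem t2Space : T2Space F := by
  have : T1Space F := AlgGrp.t1Space_localField
  infer_instance

theorem eventually_valuation_sub_le (x : F) {γ : ValueGroupWithZero F} (hγ : γ ≠ 0) :
    ∀ᶠ y in 𝓝 x, valuation F (y - x) ≤ γ :=
  mem_of_superset ((IsValuativeTopology.hasBasis_nhds' x).mem_of_mem hγ) fun y hy =>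
    le_of_lt (show valuation F (y - x) < γ from hy)

theorem tendsto_of_valuation_sub_le {c γ : ValueGroupWithZero F} (hc : c < 1) {x : ℕ → F} {y : F}
    (h : ∀ j, valuation F (x j - y) ≤ c ^ j * γ) : Tendsto x atTop (𝓝 y) := by
  rw [(IsValuativeTopology.hasBasis_nhds' y).tendsto_right_iff]
  intro β hβ
  by_cases hγ : γ = 0
  · refine Eventually.of_forall fun j => lt_of_le_of_lt (h j) ?_
    rw [hγ, mul_zero]
    exact zero_lt_iff.2 hβ
  obtain ⟨k, hk⟩ := exists_pow_lt₀ hc (Units.mk0 (β / γ) (div_ne_zero hβ hγ))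
  filter_upwards [eventually_ge_atTop k] with j hj
  refine lt_of_le_of_lt (h j) ?_
  rw [Units.val_mk0, lt_div_iff₀ (zero_lt_iff.2 hγ)] at hk
  exact lt_of_le_of_lt (mul_le_mul_left (pow_le_pow_right_of_le_one' hc.le hj) _) hk

theorem isClosed_setOf_valuation_le (γ : ValueGroupWithZero F) : IsClosed {x | valuation F x ≤ γ} :=
  have := t2Space F
  (isCompact_closedBall F γ).isClosed

theorem isOpen_setOf_valuation_le {γ : ValueGroupWithZero F} (hγ : γ ≠ 0) :
    IsOpen {x | valuation F x ≤ γ} := by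
  rw [isOpen_iff_mem_nhds]
  intro x hx
  filter_upwards [eventually_valuation_sub_le x hγ] with y hy
  have := (valuation F).map_add_le hy hx
  rwa [sub_add_cancel] at this

variable (F) in
theorem prime_of_charP (p : ℕ) [CharP 𝓀[F] p] : p.Prime := by
  refine (CharP.char_is_prime_or_zero 𝓀[F] p).resolve_right fun h => ?_
  subst h
  have := CharP.charP_to_charZero 𝓀[F]
  exact not_finite 𝓀[F] |>.elim

variable (F) in
theorem valuation_natCast_lt_one (p : ℕ) [CharP 𝓀[F] p] : valuation F (p : F) < 1 := by
  have h1 : (IsLocalRing.residue 𝒪[F]) (p : 𝒪[F]) = 0 := by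
    rw [map_natCast, CharP.cast_eq_zero]
  rw [IsLocalRing.residue_eq_zero_iff, IsLocalRing.mem_maximalIdeal, mem_nonunits_iff,
    (Valuation.integer.integers (valuation F)).isUnit_iff_valuation_eq_one] at h1
  refine lt_of_le_of_ne ?_ (by simpa using h1)
  exact (p : 𝒪[F]).2

variable (F) in
theorem exists_pos_lt_one : ∃ γ : ValueGroupWithZero F, γ ≠ 0 ∧ γ < 1 := by
  obtain ⟨r, hr, hr1⟩ := Valuation.IsNontrivial.exists_lt_one (v := valuation F)
  exact ⟨_, (valuation F).ne_zero_iff.2 hr, hr1⟩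

end IsNonarchimedeanLocalField

/-! ### Bounded matrices -/

section bounded

open ValuativeRel IsNonarchimedeanLocalField

variable {F : Type u} [Field F] [ValuativeRel F] {m n : Type*} [Fintype n] 

/-- All entries of the matrix `A` are bounded by `γ`. -/
def Matrix.EntriesLE (γ : ValueGroupWithZero F) (A : Matrix m n F) : Prop :=
  ∀ i j, valuation F (A i j) ≤ γ

namespace Matrix.EntriesLE

variable {γ γ' : ValueGroupWithZero F} {A B : Matrix m n F}

theorem mono (hA : A.EntriesLE γ) (h : γ ≤ γ') : A.EntriesLE γ' := fun i j => (hA i j).trans h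

theorem add (hA : A.EntriesLE γ) (hB : B.EntriesLE γ) : (A + B).EntriesLE γ := fun i j =>
  (valuation F).map_add_le (hA i j) (hB i j)

theorem neg (hA : A.EntriesLE γ) : (-A).EntriesLE γ := fun i j => by
  rw [Matrix.neg_apply, Valuation.map_neg]
  exact hA i j

theorem sum {ι : Type*} {s : Finset ι} {f : ι → Matrix m n F} (h : ∀ i ∈ s, (f i).EntriesLE γ) :
    (∑ i ∈ s, f i).EntriesLE γ := fun i j => by
  rw [Matrix.sum_apply]
  exact (valuation F).map_sum_le fun k hk => h k hk i j

theorem zero : (0 : Matrix m n F).EntriesLE γ := fun i j => by simp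

theorem mul {l : Type*} {B : Matrix n l F} (hA : A.EntriesLE γ) (hB : B.EntriesLE γ') :
    (A * B).EntriesLE (γ * γ') := fun i j =>
  (valuation F).map_sum_le fun k _ => by
    rw [map_mul]
    exact mul_le_mul' (hA i k) (hB k j)

theorem one [DecidableEq n] (h : 1 ≤ γ) : (1 : Matrix n n F).EntriesLE γ := fun i j => by
  rw [Matrix.one_apply]
  split_ifs
  · simpa using h
  · simp

theorem smul {A : Matrix m n F} (hA : A.EntriesLE γ) {c : F} (hc : valuation F c ≤ γ') :
    (c • A).EntriesLE (γ' * γ) := fun i j => by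
  rw [Matrix.smul_apply, smul_eq_mul, map_mul]
  exact mul_le_mul' hc (hA i j)

end Matrix.EntriesLE

variable [DecidableEq n]

theorem Matrix.EntriesLE.list_prod {γ : ValueGroupWithZero F} (hγ : 1 ≤ γ) :
    ∀ {l : List (Matrix n n F)}, (∀ A ∈ l, A.EntriesLE γ) → l.prod.EntriesLE (γ ^ l.length)
  | [], _ => Matrix.EntriesLE.one (by simp)
  | A :: l, h => by
    rw [List.prod_cons, List.length_cons, pow_succ']
    exact (h A (by simp)).mul (Matrix.EntriesLE.list_prod hγ fun B hB => h B (by simp [hB]))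

theorem Matrix.EntriesLE.pow_sub_one {γ : ValueGroupWithZero F} (hγ : γ ≤ 1) {x : Matrix n n F}
    (hx : (x - 1).EntriesLE γ) (k : ℕ) : (x ^ k - 1).EntriesLE γ := by
  induction k with
  | zero => rw [pow_zero, sub_self]; exact .zero
  | succ k ih =>
    have : x ^ (k + 1) - 1 = (x ^ k - 1) * (x - 1) + (x ^ k - 1) + (x - 1) := by
      rw [pow_succ]; noncomm_ring
    rw [this]
    exact (((ih.mul hx).mono (mul_le_of_le_one_left' hγ)).add ih).add hx

/-- Factor `y ^ p - 1` as the sum of the `y ^ i`, `i < p`, times `y - 1`. The sum is `p` plus the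
terms `y ^ i - 1`, all bounded by `γ`; so each `p`-th power gains a factor `γ`, in any
characteristic. -/
theorem Matrix.EntriesLE.pow_prime_pow_sub_one {γ : ValueGroupWithZero F} (hγ : γ ≤ 1) {p : ℕ}
    (hp : valuation F (p : F) ≤ γ) {x : Matrix n n F}
    (hx : (x - 1).EntriesLE γ) (j : ℕ) : (x ^ p ^ j - 1).EntriesLE (γ ^ j * γ) := by
  induction j with
  | zero => simpa using hx
  | succ j ih =>
    set y := x ^ p ^ j
    have hy : (y - 1).EntriesLE γ := Matrix.EntriesLE.pow_sub_one hγ hx _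
    have h1 : x ^ p ^ (j + 1) - 1 = (∑ i ∈ Finset.range p, (y ^ i - 1) + (p : F) • 1) * (y - 1) := by
      rw [pow_succ, pow_mul, ← geom_sum_mul, Finset.sum_sub_distrib, Finset.sum_const,
        Finset.card_range, ← Nat.cast_smul_eq_nsmul F, sub_add_cancel]
    rw [h1, pow_succ', mul_assoc]
    refine .mul (.add (.sum fun i _ => .pow_sub_one hγ hy i) ?_) ih
    have := (Matrix.EntriesLE.one (F := F) (n := n) le_rfl).smul hp
    rwa [mul_one] at this

end bounded

/-! ### `GL_n` over a local field is locally pro-`p`. -/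

section GeneralLinear

open ValuativeRel IsNonarchimedeanLocalField

variable {F : Type u} [Field F] [ValuativeRel F] [TopologicalSpace F]
  [IsNonarchimedeanLocalField F] {n : ℕ}

theorem isCompact_setOf_entriesLE {m n : Type*} (γ : ValueGroupWithZero F) :
    IsCompact {A : Matrix m n F | A.EntriesLE γ} := by
  have := isCompact_univ_pi fun _ : m => isCompact_univ_pi fun _ : n => isCompact_closedBall F γ
  have e : {A : Matrix m n F | A.EntriesLE γ} = Set.univ.pi fun _ => Set.univ.pi fun _ =>
      {x | valuation F x ≤ γ} := by
    ext A
    exact ⟨fun h i _ j _ => h i j, fun h i j => h i trivial j trivial⟩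
  rw [e]
  exact this

theorem isOpen_setOf_entriesLE {m n : Type*} [Finite m] [Finite n] {γ : ValueGroupWithZero F}
    (hγ : γ ≠ 0) : IsOpen {A : Matrix m n F | A.EntriesLE γ} := by
  have := isOpen_set_pi Set.finite_univ fun (_ : m) _ => isOpen_set_pi Set.finite_univ
    fun (_ : n) _ => isOpen_setOf_valuation_le hγ
  have e : {A : Matrix m n F | A.EntriesLE γ} = Set.univ.pi fun _ => Set.univ.pi fun _ =>
      {x | valuation F x ≤ γ} := by
    ext A
    exact ⟨fun h i _ j _ => h i j, fun h i j => h i trivial j trivial⟩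
  rw [e]
  exact this

instance : T2Space (Matrix (Fin n) (Fin n) F) :=
  have := t2Space F
  inferInstanceAs (T2Space (Fin n → Fin n → F))

/-- The topology of `GL_n` is that of pairs of a matrix and its inverse, so both must be bounded. -/
theorem isCompact_setOf_entriesLE_GL (γ : ValueGroupWithZero F) :
    IsCompact {g : GL (Fin n) F | (g : Matrix (Fin n) (Fin n) F).EntriesLE γ ∧
      ((g⁻¹ : GL (Fin n) F) : Matrix (Fin n) (Fin n) F).EntriesLE γ} := by
  have h := (isCompact_setOf_entriesLE (F := F) (m := Fin n) (n := Fin n) γ).prod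
    ((isCompact_setOf_entriesLE (F := F) (m := Fin n) (n := Fin n) γ).image
      MulOpposite.continuous_op)
  refine (Units.isClosedEmbedding_embedProduct.isCompact_preimage h).of_isClosed_subset ?_ ?_
  · have hc := (isCompact_setOf_entriesLE (F := F) (m := Fin n) (n := Fin n) γ).isClosed
    exact (hc.preimage Units.continuous_val).inter
      (hc.preimage (Units.continuous_val.comp continuous_inv))
  · rintro g ⟨h1, h2⟩
    exact ⟨h1, _, h2, rfl⟩

/-- The congruence subgroup of `GL_n(F)` of level `γ`. -/
def congruenceSubgroup (n : ℕ) {γ : ValueGroupWithZero F} (hγ : γ ≤ 1) :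
    Subgroup (GL (Fin n) F) where
  carrier := {g | ((g : Matrix (Fin n) (Fin n) F) - 1).EntriesLE γ ∧
    (((g⁻¹ : GL (Fin n) F) : Matrix (Fin n) (Fin n) F) - 1).EntriesLE γ}
  one_mem' := by
    simp only [inv_one, Units.val_one, sub_self, Set.mem_ofPred_eq, and_self]
    exact .zero
  mul_mem' := by
    have key : ∀ A B : Matrix (Fin n) (Fin n) F, (A - 1).EntriesLE γ → (B - 1).EntriesLE γ →
        (A * B - 1).EntriesLE γ := fun A B hA hB => by
      have : A * B - 1 = (A - 1) * (B - 1) + (A - 1) + (B - 1) := by noncomm_ring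
      rw [this]
      exact (((hA.mul hB).mono (mul_le_of_le_one_left' hγ)).add hA).add hB
    rintro g h ⟨hg, hg'⟩ ⟨hh, hh'⟩
    refine ⟨by rw [Units.val_mul]; exact key _ _ hg hh, ?_⟩
    rw [mul_inv_rev, Units.val_mul]
    exact key _ _ hh' hg'
  inv_mem' := by
    rintro g ⟨hg, hg'⟩
    exact ⟨hg', by rwa [inv_inv]⟩

theorem tendsto_units_of_entriesLE {c : ValueGroupWithZero F} (hc : c < 1) {γ : ValueGroupWithZero F}
    {x : ℕ → GL (Fin n) F} (h : ∀ j, ((x j : Matrix (Fin n) (Fin n) F) - 1).EntriesLE (c ^ j * γ))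
    (h' : ∀ j, (((x j)⁻¹ : GL (Fin n) F) - 1 : Matrix (Fin n) (Fin n) F).EntriesLE (c ^ j * γ)) :
    Tendsto x atTop (𝓝 1) := by
  rw [Units.isClosedEmbedding_embedProduct.isInducing.tendsto_nhds_iff]
  refine Tendsto.prodMk_nhds ?_ ((MulOpposite.continuous_op.tendsto _).comp ?_)
  · exact tendsto_pi_nhds.2 fun i => tendsto_pi_nhds.2 fun k =>
      tendsto_of_valuation_sub_le hc fun j => h j i k
  · exact tendsto_pi_nhds.2 fun i => tendsto_pi_nhds.2 fun k =>
      tendsto_of_valuation_sub_le hc fun j => h' j i k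

theorem isCompactOpenProP_congruenceSubgroup (p : ℕ) [CharP 𝓀[F] p] {γ : ValueGroupWithZero F}
    (h0 : γ ≠ 0) (hγ : γ < 1) :
    IsCompactOpenProP p (congruenceSubgroup n hγ.le) := by
  have hopen : IsOpen (congruenceSubgroup n hγ.le : Set (GL (Fin n) F)) := by
    have ho := isOpen_setOf_entriesLE (F := F) (m := Fin n) (n := Fin n) h0
    have hc : Continuous fun g : GL (Fin n) F => (g : Matrix (Fin n) (Fin n) F) - 1 :=
      Units.continuous_val.sub continuous_const
    exact (ho.preimage hc).inter (ho.preimage (hc.comp continuous_inv))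
  refine ⟨hopen, ?_, fun x hx => ?_⟩
  · refine (isCompact_setOf_entriesLE_GL (F := F) (n := n) 1).of_isClosed_subset
      (Subgroup.isClosed_of_isOpen _ hopen) ?_
    rintro g ⟨h1, h2⟩
    have key : ∀ A : Matrix (Fin n) (Fin n) F, (A - 1).EntriesLE γ → A.EntriesLE 1 := fun A hA => by
      have := (hA.mono hγ.le).add (Matrix.EntriesLE.one le_rfl)
      rwa [sub_add_cancel] at this
    exact ⟨key _ h1, key _ h2⟩
  -- This bounds `p` as well as the entries of `x - 1` and `x⁻¹ - 1`, and is still less than one.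
  · set c := max γ (valuation F (p : F))
    have hc : c < 1 := max_lt hγ (valuation_natCast_lt_one F p)
    refine tendsto_units_of_entriesLE hc (γ := c) (fun j => ?_) fun j => ?_
    · rw [Units.val_pow_eq_pow_val]
      exact .pow_prime_pow_sub_one hc.le (le_max_right _ _) (hx.1.mono (le_max_left _ _)) j
    · rw [← inv_pow, Units.val_pow_eq_pow_val]
      exact .pow_prime_pow_sub_one hc.le (le_max_right _ _) (hx.2.mono (le_max_left _ _)) j

theorem locallyProP_GL (p : ℕ) [CharP 𝓀[F] p] (n : ℕ) : LocallyProP p (GL (Fin n) F) := by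
  intro V hV
  rw [Units.isClosedEmbedding_embedProduct.isInducing.nhds_eq_comap] at hV
  obtain ⟨W, hW, hWV⟩ := mem_comap.1 hV
  rw [map_one, Prod.one_eq_mk, nhds_prod_eq] at hW
  obtain ⟨W₁, hW₁, W₂, hW₂, hW⟩ := mem_prod_iff.1 hW
  have hW₂' : MulOpposite.op ⁻¹' W₂ ∈ 𝓝 (1 : Matrix (Fin n) (Fin n) F) :=
    MulOpposite.continuous_op.continuousAt.preimage_mem_nhds hW₂
  have key : ∀ W ∈ 𝓝 (1 : Matrix (Fin n) (Fin n) F), ∃ γ : ValueGroupWithZero F, γ ≠ 0 ∧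
      ∀ A : Matrix (Fin n) (Fin n) F, (A - 1).EntriesLE γ → A ∈ W := by
    intro W hW
    obtain ⟨c, hc, hc1⟩ := exists_pos_lt_one F
    have hW' := hW
    erw [nhds_pi, mem_pi'] at hW'
    obtain ⟨I, t, ht, htW⟩ := hW'
    have h2 : ∀ i, ∃ γ : (ValueGroupWithZero F)ˣ, ∀ y : Fin n → F,
        (∀ j, valuation F (y j - (1 : Matrix (Fin n) (Fin n) F) i j) ≤ γ) → y ∈ t i := by
      intro i
      have hti := ht i
      rw [nhds_pi, mem_pi'] at hti
      obtain ⟨J, s, hs, hst⟩ := hti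
      have h3 : ∀ j, ∃ γ : (ValueGroupWithZero F)ˣ, ∀ y : F,
          valuation F (y - (1 : Matrix (Fin n) (Fin n) F) i j) ≤ γ → y ∈ s j := by
        intro j
        obtain ⟨γ, hγ, h⟩ := (IsValuativeTopology.hasBasis_nhds' _).mem_iff.1 (hs j)
        -- The basic neighbourhoods are given by strict inequalities; the factor `c < 1` makes
        -- non-strict ones sufficient.
        refine ⟨Units.mk0 (c * γ) (mul_ne_zero hc hγ), fun y hy => h ?_⟩
        refine lt_of_le_of_lt hy ?_
        rw [Units.val_mk0]
        exact mul_lt_of_lt_one_left (zero_lt_iff.2 hγ) hc1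
      choose γ hγ using h3
      obtain ⟨M, hM⟩ := Finite.exists_ge γ
      exact ⟨M, fun y hy => hst fun j _ => hγ j _ ((hy j).trans (Units.val_le_val.2 (hM j)))⟩
    choose γ hγ using h2
    obtain ⟨M, hM⟩ := Finite.exists_ge γ
    exact ⟨M, M.ne_zero, fun A hA => htW fun i _ =>
      hγ i _ fun j => (hA i j).trans (Units.val_le_val.2 (hM i))⟩
  obtain ⟨γ₁, h₁, h₁'⟩ := key _ hW₁
  obtain ⟨γ₂, h₂, h₂'⟩ := key _ hW₂'
  obtain ⟨γ, h, h'⟩ := exists_pos_lt_one F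
  have hmin : min γ (min γ₁ γ₂) ≠ 0 := by
    rcases min_choice γ (min γ₁ γ₂) with e | e <;> rw [e]
    · exact h
    · rcases min_choice γ₁ γ₂ with e | e <;> rw [e] <;> assumption
  refine ⟨_, isCompactOpenProP_congruenceSubgroup p hmin ((min_le_left _ _).trans_lt h'), ?_⟩
  rintro g ⟨hg, hg'⟩
  refine hWV (hW ⟨h₁' _ (hg.mono ?_), h₂' _ (hg'.mono ?_)⟩)
  · exact (min_le_right _ _).trans (min_le_left _ _)
  · exact (min_le_right _ _).trans (min_le_right _ _)

end GeneralLinear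

/-! ### Unipotent groups -/

section Kolchin

theorem Ideal.list_prod_mem_pow {A : Type*} [Ring A] (I : Ideal A) [I.IsTwoSided] {l : List A}
    (h : ∀ x ∈ l, x ∈ I) : l.prod ∈ I ^ l.length := by
  induction l with
  | nil => rw [List.length_nil, Submodule.pow_zero, Ideal.one_eq_top]; trivial
  | cons x l ih =>
    rw [List.prod_cons, List.length_cons, Ideal.IsTwoSided.pow_succ]
    exact Ideal.mul_mem_mul (h x (by simp)) (ih fun y hy => h y (by simp [hy]))

/-- **Kolchin's theorem**: a multiplicative set of unipotent elements that spans a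
finite-dimensional algebra generates a nilpotent augmentation ideal. -/
theorem exists_list_prod_eq_zero_of_span {L A : Type*} [Field L] [IsAlgClosed L] [Ring A]
    [Algebra L A] [FiniteDimensional L A] (H : Submonoid A)
    (hspan : Submodule.span L (H : Set A) = ⊤) (hH : ∀ x ∈ H, IsNilpotent (x - 1)) :
    ∃ N, ∀ l : List A, (∀ x ∈ l, ∃ h ∈ H, x = h - 1) → N ≤ l.length → l.prod = 0 := by
  have := IsArtinianRing.of_finite L A
  obtain ⟨k, d, hd, ⟨e⟩⟩ :=
    IsSemisimpleRing.exists_algEquiv_pi_matrix_of_isAlgClosed L (A ⧸ Ring.jacobson A)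
  -- Modulo the radical, `A` is a product of matrix algebras over `L`. In each factor `(x - 1) y =
  -- (x y - 1) - (y - 1)` has trace zero for `y ∈ H`, hence for all `y`, and the trace form is
  -- non-degenerate.
  have key : ∀ x ∈ H, x - 1 ∈ Ring.jacobson A := by
    intro x hx
    rw [← Ideal.Quotient.eq_zero_iff_mem, ← e.map_eq_zero_iff]
    funext i
    let φ : A →ₐ[L] Matrix (Fin (d i)) (Fin (d i)) L :=
      (Pi.evalAlgHom L _ i).comp (e.toAlgHom.comp (Ideal.Quotient.mkₐ L _))
    have hφ : Function.Surjective φ := (Function.surjective_eval i).comp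
      (e.surjective.comp Ideal.Quotient.mk_surjective)
    have htr : ∀ h ∈ H, (φ (h - 1)).trace = 0 := fun h hh =>
      (Matrix.isNilpotent_trace_of_isNilpotent ((hH h hh).map φ)).eq_zero
    change φ (x - 1) = 0
    rw [Matrix.ext_iff_trace_mul_right]
    intro B
    obtain ⟨y, rfl⟩ := hφ B
    rw [zero_mul, Matrix.trace_zero, ← map_mul]
    have hy : y ∈ Submodule.span L (H : Set A) := hspan ▸ Submodule.mem_top
    induction hy using Submodule.span_induction with
    | mem y hy =>
      have : (x - 1) * y = (x * y - 1) - (y - 1) := by noncomm_ring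
      rw [this, map_sub, Matrix.trace_sub, htr _ (H.mul_mem hx hy), htr _ hy, sub_zero]
    | zero => simp
    | add a b _ _ ha hb => rw [mul_add, map_add, Matrix.trace_add, ha, hb, add_zero]
    | smul c a _ ha => rw [mul_smul_comm, map_smul, Matrix.trace_smul, ha, smul_zero]
  obtain ⟨N, hN⟩ := IsSemiprimaryRing.isNilpotent (R := A)
  refine ⟨N, fun l hl hlN => ?_⟩
  have h1 := Ideal.list_prod_mem_pow (Ring.jacobson A) (l := l) fun x hx => by
    obtain ⟨h, hh, rfl⟩ := hl x hx
    exact key h hh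
  have h2 := Ideal.pow_le_pow_right hlN h1
  rwa [hN, Ideal.zero_eq_bot, Ideal.mem_bot] at h2

/-- Replace `A` by the subalgebra generated by `H`; it is spanned by `H` because `H` is closed under
products. -/
theorem exists_list_prod_eq_zero {L A : Type*} [Field L] [IsAlgClosed L] [Ring A]
    [Algebra L A] [FiniteDimensional L A] (H : Submonoid A)
    (hH : ∀ x ∈ H, IsNilpotent (x - 1)) :
    ∃ N, ∀ l : List A, (∀ x ∈ l, ∃ h ∈ H, x = h - 1) → N ≤ l.length → l.prod = 0 := by
  set B := Algebra.adjoin L (H : Set A)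
  have hHB : ∀ x ∈ H, x ∈ B := fun x hx => Algebra.subset_adjoin hx
  have hspan : Submodule.span L ((H.comap B.val : Submonoid B) : Set B) = ⊤ := by
    rw [eq_top_iff]
    rintro ⟨x, hx⟩ -
    have h1 : x ∈ Submodule.span L (H : Set A) := by
      have h2 := Algebra.adjoin_eq_span L (H : Set A)
      rw [Submonoid.closure_eq] at h2
      rw [← h2]
      exact hx
    induction h1 using Submodule.span_induction with
    | mem y hy => exact Submodule.subset_span hy
    | zero => exact Submodule.zero_mem _
    | add a b ha hb iha ihb =>
      have hB : ∀ c ∈ Submodule.span L (H : Set A), c ∈ B := fun c hc =>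
        (Submodule.span_le (p := Subalgebra.toSubmodule B)).2 hHB hc
      exact Submodule.add_mem _ (iha (hB a ha)) (ihb (hB b hb))
    | smul c a ha iha =>
      have hB : ∀ c ∈ Submodule.span L (H : Set A), c ∈ B := fun c hc =>
        (Submodule.span_le (p := Subalgebra.toSubmodule B)).2 hHB hc
      exact Submodule.smul_mem _ c (iha (hB a ha))
  obtain ⟨N, hN⟩ := exists_list_prod_eq_zero_of_span (H.comap B.val) hspan fun x hx => by
    obtain ⟨k, hk⟩ := hH _ hx
    exact ⟨k, Subtype.ext hk⟩
  refine ⟨N, fun l hl hlN => ?_⟩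
  have hlB : ∀ x ∈ l, x ∈ B := fun x hx => by
    obtain ⟨h, hh, rfl⟩ := hl x hx
    exact B.sub_mem (hHB h hh) B.one_mem
  lift l to List B using hlB
  have := hN l (fun x hx => by
    obtain ⟨h, hh, hx'⟩ := hl x (List.mem_map_of_mem hx)
    exact ⟨⟨h, hHB h hh⟩, hh, Subtype.ext hx'⟩) (by simpa using hlN)
  have h2 := congrArg B.val this
  rw [map_list_prod, map_zero] at h2
  exact h2

end Kolchin

/-! ### Powers of unipotent matrices and bounds on compact sets. -/

section bounded

open ValuativeRel IsNonarchimedeanLocalField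

variable {F : Type u} [Field F] [ValuativeRel F]

theorem Matrix.exists_entriesLE {m n : Type*} [Finite m] [Finite n] (A : Matrix m n F) :
    ∃ γ : ValueGroupWithZero F, 1 ≤ γ ∧ A.EntriesLE γ := by
  obtain ⟨γ, hγ⟩ := Finite.exists_le fun ij : m × n => valuation F (A ij.1 ij.2)
  exact ⟨max 1 γ, le_max_left _ _, fun i j => (hγ (i, j)).trans (le_max_right _ _)⟩

theorem Matrix.EntriesLE.pow {n : Type*} [Fintype n] [DecidableEq n] {γ : ValueGroupWithZero F}
    {A : Matrix n n F} (hA : A.EntriesLE γ) (k : ℕ) : (A ^ k).EntriesLE (γ ^ k) := by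
  induction k with
  | zero => exact .one (by simp)
  | succ k ih => rw [pow_succ, pow_succ]; exact ih.mul hA

/-- The exponent `e` of `p` in `a` satisfies `e ≤ p ^ e ≤ a`, so cancelling `a` costs at most `a`
factors `p`. This crude bound suffices. -/
theorem Nat.pow_sub_dvd_of_dvd_mul {p : ℕ} (hp : p.Prime) {a b j : ℕ} (ha : a ≠ 0)
    (h : p ^ j ∣ a * b) : p ^ (j - a) ∣ b := by
  obtain ⟨e, a', ha', rfl⟩ := Nat.exists_eq_pow_mul_and_not_dvd ha p hp.ne_one
  have he : e ≤ p ^ e * a' :=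
    (Nat.lt_pow_self hp.one_lt).le.trans (Nat.le_mul_of_pos_right _ (Nat.pos_of_ne_zero fun h0 =>
      ha' (h0 ▸ dvd_zero p)))
  refine (pow_dvd_pow p (Nat.sub_le_sub_left he j)).trans ?_
  rcases le_or_gt e j with hej | hej
  · obtain ⟨i, rfl⟩ := Nat.exists_eq_add_of_le hej
    rw [pow_add, mul_assoc] at h
    have h2 := Nat.dvd_of_mul_dvd_mul_left (pow_pos hp.pos e) h
    rw [Nat.add_sub_cancel_left]
    exact Nat.Coprime.dvd_of_dvd_mul_left
      (Nat.Coprime.pow_left i ((Nat.Prime.coprime_iff_not_dvd hp).2 ha')) h2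
  · rw [Nat.sub_eq_zero_of_le hej.le, pow_zero]
    exact one_dvd b

/-- It comes from the identity `(i + 1) * (p ^ j).choose (i + 1) = p ^ j * (p ^ j - 1).choose i`. -/
theorem Nat.pow_sub_dvd_choose {p : ℕ} (hp : p.Prime) (j i : ℕ) :
    p ^ (j - (i + 1)) ∣ (p ^ j).choose (i + 1) := by
  refine Nat.pow_sub_dvd_of_dvd_mul hp i.succ_ne_zero ?_
  have h : p ^ j - 1 + 1 = p ^ j := Nat.sub_add_cancel (pow_pos hp.pos j)
  rw [← h, mul_comm, ← Nat.add_one_mul_choose_eq]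
  exact dvd_mul_right _ _

variable [TopologicalSpace F] [IsNonarchimedeanLocalField F]

/-- The `p`-power iterates of a unipotent matrix converge to `1`. -/
theorem Matrix.exists_entriesLE_pow_prime_pow_sub_one {n : ℕ} (p : ℕ) [CharP 𝓀[F] p]
    {c : ValueGroupWithZero F} (hc : c ≠ 0) (hpc : valuation F (p : F) ≤ c) (hc1 : c ≤ 1)
    {x : Matrix (Fin n) (Fin n) F} (hx : IsNilpotent (x - 1)) :
    ∃ γ : ValueGroupWithZero F, ∀ j, (x ^ p ^ j - 1).EntriesLE (c ^ j * γ) := by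
  obtain ⟨k, hk⟩ := hx
  obtain ⟨γ, hγ, hA⟩ := Matrix.exists_entriesLE (x - 1)
  set y := x - 1
  -- In the binomial expansion only powers `y ^ (i + 1)` with `i + 1 < k` occur. They are bounded by
  -- `γ ^ k`, and their coefficients are divisible by `p ^ (j - (i + 1))`; the factor `(c ^ k)⁻¹`
  -- pays for the lost exponent. As `p` may vanish in `F`, an invertible bound `c` is used in place
  -- of its valuation.
  refine ⟨(c ^ k)⁻¹ * γ ^ k, fun j => ?_⟩
  have hxy : x ^ p ^ j - 1 = ∑ i ∈ Finset.range (p ^ j),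
      (((p ^ j).choose (i + 1) : ℕ) : F) • y ^ (i + 1) := by
    have h1 : x = y + 1 := (sub_add_cancel _ _).symm
    rw [h1, (Commute.one_right y).add_pow, Finset.sum_range_succ']
    simp only [one_pow, mul_one, pow_zero, Nat.choose_zero_right, Nat.cast_one, add_sub_cancel_right]
    refine Finset.sum_congr rfl fun i _ => ?_
    rw [Nat.cast_smul_eq_nsmul, nsmul_eq_mul, (Nat.cast_commute _ _).eq]
  rw [hxy]
  refine .sum fun i _ => ?_
  rcases le_or_gt k (i + 1) with hik | hik
  · rw [pow_eq_zero_of_le hik hk, smul_zero]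
    exact .zero
  · have hv : valuation F (((p ^ j).choose (i + 1) : ℕ) : F) ≤ c ^ j * (c ^ k)⁻¹ := by
      obtain ⟨d, hd⟩ := Nat.pow_sub_dvd_choose (prime_of_charP F p) j i
      rw [hd, Nat.cast_mul, map_mul, Nat.cast_pow, map_pow, ← div_eq_mul_inv,
        le_div_iff₀ (zero_lt_iff.2 (pow_ne_zero k hc))]
      have hd1 : valuation F (d : F) ≤ 1 := by
        have : ((d : 𝒪[F]) : F) = d := by simp
        rw [← this]
        exact (d : 𝒪[F]).2
      calc _ ≤ c ^ (j - (i + 1)) * 1 * c ^ k := by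
            gcongr
        _ = c ^ (j - (i + 1) + k) := by rw [mul_one, pow_add]
        _ ≤ c ^ j := pow_le_pow_right_of_le_one' hc1 (by omega)
    have := ((hA.pow (i + 1)).mono (pow_le_pow_right' hγ hik.le)).smul hv
    rwa [mul_assoc] at this

theorem IsCompact.exists_entriesLE {X m n : Type*} [TopologicalSpace X] [Finite m] [Fintype n]
    {C : Set X} (hC : IsCompact C) {f : X → Matrix m n F} (hf : Continuous f) :
    ∃ γ : ValueGroupWithZero F, 1 ≤ γ ∧ ∀ x ∈ C, (f x).EntriesLE γ := by
  refine hC.induction_on (p := fun s => ∃ γ : ValueGroupWithZero F, 1 ≤ γ ∧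
    ∀ x ∈ s, (f x).EntriesLE γ) ⟨1, le_rfl, by simp⟩ ?_ ?_ ?_
  · rintro s t hst ⟨γ, h1, h⟩
    exact ⟨γ, h1, fun x hx => h x (hst hx)⟩
  · rintro s t ⟨γ, h1, h⟩ ⟨γ', h1', h'⟩
    refine ⟨max γ γ', h1.trans (le_max_left _ _), ?_⟩
    rintro x (hx | hx)
    · exact (h x hx).mono (le_max_left _ _)
    · exact (h' x hx).mono (le_max_right _ _)
  · intro x _
    obtain ⟨γ, h1, h⟩ := (f x).exists_entriesLE
    have ho := (isOpen_setOf_entriesLE (F := F) (m := m) (n := n)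
      (zero_lt_one.trans_le h1).ne').preimage hf
    exact ⟨_, mem_nhdsWithin_of_mem_nhds (ho.mem_nhds h), γ, h1, fun y hy => hy⟩

end bounded

/-! ### Unipotent groups are unions of compact open pro-`p`-subgroups. -/

namespace AlgGrp

theorem map_mem_pts {K : Type u} [Field K] {n : ℕ} (G : AlgGrp K n) {S T : Type u} [CommRing S]
    [Algebra K S] [CommRing T] [Algebra K T] (f : S →ₐ[K] T) {g : GL (Fin n) S}
    (hg : g ∈ G.pts S) : Matrix.GeneralLinearGroup.map (f : S →+* T) g ∈ G.pts T := by
  intro q hq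
  have h1 := congrArg f (hg q hq)
  rw [map_zero] at h1
  refine Eq.trans ?_ h1
  exact (MvPolynomial.comp_aeval_apply _ f q).symm

/-- Long products of elements `g - 1` with `g` in a unipotent group vanish. -/
theorem IsUnipotent.exists_list_prod_eq_zero {F : Type u} [Field F] {n : ℕ} {U : AlgGrp F n}
    (hU : U.IsUnipotent) : ∃ N, ∀ l : List (Matrix (Fin n) (Fin n) F),
      (∀ x ∈ l, ∃ g ∈ U.pts F, x = (g : Matrix (Fin n) (Fin n) F) - 1) →
        N ≤ l.length → l.prod = 0 := by
  let i : F →ₐ[F] AlgebraicClosure F := Algebra.ofId F _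
  let φ : Matrix (Fin n) (Fin n) F →+* Matrix (Fin n) (Fin n) (AlgebraicClosure F) :=
    (i : F →+* AlgebraicClosure F).mapMatrix
  obtain ⟨N, hN⟩ := _root_.exists_list_prod_eq_zero (L := AlgebraicClosure F)
    ((U.pts (AlgebraicClosure F)).toSubmonoid.map (Units.coeHom _)) (by
      rintro _ ⟨g, hg, rfl⟩
      exact hU g hg)
  refine ⟨N, fun l hl hlN => ?_⟩
  have hφ : Function.Injective φ := Matrix.map_injective i.injective
  apply hφ
  rw [map_zero, map_list_prod]
  refine hN _ (fun x hx => ?_) (by simpa using hlN)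
  obtain ⟨y, hy, rfl⟩ := List.mem_map.1 hx
  obtain ⟨g, hg, rfl⟩ := hl y hy
  exact ⟨_, ⟨_, U.map_mem_pts i hg, rfl⟩, by rw [map_sub, map_one]; rfl⟩

open ValuativeRel IsNonarchimedeanLocalField

variable {F : Type u} [Field F] [ValuativeRel F] [TopologicalSpace F]
  [IsNonarchimedeanLocalField F] {n : ℕ}

instance locallyCompactSpace_pts (G : AlgGrp F n) : LocallyCompactSpace (G.pts F) := by
  have : T1Space F := t1Space_localField
  have : LocallyCompactSpace (Matrix (Fin n) (Fin n) F) :=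
    inferInstanceAs (LocallyCompactSpace (Fin n → Fin n → F))
  have : LocallyCompactSpace (GL (Fin n) F) :=
    inferInstanceAs (LocallyCompactSpace (Matrix (Fin n) (Fin n) F)ˣ)
  exact G.isClosed_pts.locallyCompactSpace

theorem isCompact_setOf_entriesLE (G : AlgGrp F n) (γ : ValueGroupWithZero F) :
    IsCompact {g : G.pts F | ((g : GL (Fin n) F) : Matrix (Fin n) (Fin n) F).EntriesLE γ ∧
      (((g : GL (Fin n) F)⁻¹ : GL (Fin n) F) : Matrix (Fin n) (Fin n) F).EntriesLE γ} := by
  have : T1Space F := t1Space_localField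
  exact G.isClosed_pts.isClosedEmbedding_subtypeVal.isCompact_preimage
    (isCompact_setOf_entriesLE_GL γ)

/-- Add to `C` a compact neighbourhood of `1` and all inverses. The ring generated by the matrices
`g - 1` is bounded, since products of length at least `N` vanish and shorter ones are bounded by `γ
^ N`. The elements that lie in this ring with their inverses form a bounded subgroup, open because
it contains a neighbourhood of `1`. -/
theorem IsUnipotent.exists_isCompactOpenProP (p : ℕ) [CharP 𝓀[F] p]
    {U : AlgGrp F n} (hU : U.IsUnipotent) (C : Set (U.pts F)) (hC : IsCompact C) :
    ∃ K : Subgroup (U.pts F), IsCompactOpenProP p K ∧ C ⊆ K := by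
  obtain ⟨N, hN⟩ := hU.exists_list_prod_eq_zero
  obtain ⟨K₀, hK₀, h1⟩ := exists_compact_mem_nhds (1 : U.pts F)
  let val : U.pts F → Matrix (Fin n) (Fin n) F := fun g => ((g : GL (Fin n) F) : Matrix _ _ F)
  have hval : Continuous val := Units.continuous_val.comp continuous_subtype_val
  set C' := (C ∪ K₀) ∪ (C ∪ K₀)⁻¹
  have hC' : IsCompact C' := (hC.union hK₀).union (hC.union hK₀).inv
  obtain ⟨γ, hγ, hγC⟩ := hC'.exists_entriesLE (hval.sub (continuous_const (y := (1 : Matrix (Fin n) (Fin n) F))))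
  set T := Subring.closure ((fun g => val g - 1) '' C')
  have hT : ∀ x ∈ T, x.EntriesLE (γ ^ N) := by
    intro x hx
    rw [Subring.mem_closure_iff] at hx
    induction hx using AddSubgroup.closure_induction with
    | mem x hx =>
      obtain ⟨l, hl, rfl⟩ := Submonoid.exists_list_of_mem_closure hx
      rcases le_or_gt N l.length with h | h
      · rw [hN l (fun x hx => ?_) h]
        · exact .zero
        obtain ⟨g, _, rfl⟩ := hl x hx
        exact ⟨g, g.2, rfl⟩
      · refine (Matrix.EntriesLE.list_prod hγ fun x hx => ?_).mono (pow_le_pow_right' hγ h.le)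
        obtain ⟨g, hg, rfl⟩ := hl x hx
        exact hγC g hg
    | zero => exact .zero
    | add a b _ _ ha hb => exact ha.add hb
    | neg a _ ha => exact ha.neg
  have hCT : ∀ g ∈ C', val g ∈ T := fun g hg => by
    have := T.add_mem (Subring.subset_closure ⟨g, hg, rfl⟩) T.one_mem
    rwa [sub_add_cancel] at this
  let K : Subgroup (U.pts F) :=
    { carrier := {g | val g ∈ T ∧ val g⁻¹ ∈ T}
      one_mem' := ⟨T.one_mem, by rw [inv_one]; exact T.one_mem⟩
      mul_mem' := fun {a b} ha hb => ⟨T.mul_mem ha.1 hb.1, by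
        rw [mul_inv_rev]; exact T.mul_mem hb.2 ha.2⟩
      inv_mem' := fun {a} ha => ⟨ha.2, by rw [inv_inv]; exact ha.1⟩ }
  have hK : ∀ g ∈ C ∪ K₀, g ∈ K := fun g hg =>
    ⟨hCT g (Or.inl hg), hCT _ (Or.inr (Set.inv_mem_inv.2 hg))⟩
  have hopen : IsOpen (K : Set (U.pts F)) :=
    K.isOpen_of_mem_nhds (mem_of_superset h1 fun g hg => hK g (Or.inr hg))
  refine ⟨K, ⟨hopen, ?_, fun x _ => ?_⟩, fun g hg => hK g (Or.inl hg)⟩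
  · exact (U.isCompact_setOf_entriesLE (γ ^ N)).of_isClosed_subset (K.isClosed_of_isOpen hopen)
      fun g hg => ⟨hT _ hg.1, hT _ hg.2⟩
  · have hnil : ∀ g : U.pts F, IsNilpotent (val g - 1) := fun g => ⟨N, by
      have := hN (List.replicate N (val g - 1)) (fun x hx => by
        rw [List.eq_of_mem_replicate hx]
        exact ⟨g, g.2, rfl⟩) (by simp)
      rwa [List.prod_replicate] at this⟩
    obtain ⟨c, hc, hc1⟩ := exists_pos_lt_one F
    have hm : max c (valuation F (p : F)) ≠ 0 := ((zero_lt_iff.2 hc).trans_le (le_max_left _ _)).ne'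
    have hm1 := max_lt hc1 (valuation_natCast_lt_one F p)
    obtain ⟨γ₁, h₁⟩ := Matrix.exists_entriesLE_pow_prime_pow_sub_one p hm (le_max_right _ _) hm1.le
      (hnil x)
    obtain ⟨γ₂, h₂⟩ := Matrix.exists_entriesLE_pow_prime_pow_sub_one p hm (le_max_right _ _) hm1.le
      (hnil x⁻¹)
    rw [tendsto_subtype_rng]
    refine tendsto_units_of_entriesLE hm1 (γ := max γ₁ γ₂) (fun j => ?_) fun j => ?_
    · exact (h₁ j).mono (by gcongr; exact le_max_left _ _)
    · have : ((((x ^ p ^ j : U.pts F) : GL (Fin n) F)⁻¹ : GL (Fin n) F) : Matrix _ _ F) =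
          val x⁻¹ ^ p ^ j := by
        simp [val, ← inv_pow]
      rw [this]
      exact (h₂ j).mono (by gcongr; exact le_max_right _ _)

end AlgGrp

/-! ### The universal point of an algebraic group -/

namespace AlgGrp

section universal

variable {K : Type u} [Field K] {n : ℕ}

/-- Indices for the entries of a matrix and of its inverse. -/
abbrev PtIdx (n : ℕ) : Type := (Fin n × Fin n) ⊕ (Fin n × Fin n)

/-- The entries of an invertible matrix and of its inverse. -/
def ptCoord {S : Type*} [CommRing S] (g : GL (Fin n) S) : PtIdx n → S :=
  Sum.elim (fun ij => (g : Matrix (Fin n) (Fin n) S) ij.1 ij.2)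
    fun ij => ((g⁻¹ : GL (Fin n) S) : Matrix (Fin n) (Fin n) S) ij.1 ij.2

variable (K n) in
/-- The matrix of the first half of the variables. -/
noncomputable def genMat : Matrix (Fin n) (Fin n) (MvPolynomial (PtIdx n) K) :=
  Matrix.of fun i j => MvPolynomial.X (Sum.inl (i, j))

variable (K n) in
/-- The matrix of the second half of the variables. -/
noncomputable def genMatInv : Matrix (Fin n) (Fin n) (MvPolynomial (PtIdx n) K) :=
  Matrix.of fun i j => MvPolynomial.X (Sum.inr (i, j))

theorem genMat_map {S : Type*} [CommRing S] [Algebra K S] (t : PtIdx n → S) :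
    (genMat K n).map (MvPolynomial.aeval t) = Matrix.of fun i j => t (Sum.inl (i, j)) := by
  ext i j
  simp [genMat]

theorem genMatInv_map {S : Type*} [CommRing S] [Algebra K S] (t : PtIdx n → S) :
    (genMatInv K n).map (MvPolynomial.aeval t) = Matrix.of fun i j => t (Sum.inr (i, j)) := by
  ext i j
  simp [genMatInv]

/-- The equations satisfied by the entries of a point of `G` and of its inverse. -/
def ptEqs (G : AlgGrp K n) : Set (MvPolynomial (PtIdx n) K) :=
  (MvPolynomial.rename Sum.inl '' (G.eqs : Set (MvPolynomial (Fin n × Fin n) K))) ∪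
    (Set.range (fun ij : Fin n × Fin n => (genMat K n * genMatInv K n - 1) ij.1 ij.2) ∪
      Set.range fun ij : Fin n × Fin n => (genMatInv K n * genMat K n - 1) ij.1 ij.2)

theorem aeval_ptCoord_eq_zero (G : AlgGrp K n) {S : Type u} [CommRing S] [Algebra K S]
    {g : GL (Fin n) S} (hg : g ∈ G.pts S) {q : MvPolynomial (PtIdx n) K} (hq : q ∈ G.ptEqs) :
    MvPolynomial.aeval (ptCoord g) q = 0 := by
  have e1 : (genMat K n).map (MvPolynomial.aeval (ptCoord g)) = g := genMat_map _
  have e2 : (genMatInv K n).map (MvPolynomial.aeval (ptCoord g)) = (g⁻¹ : GL (Fin n) S) :=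
    genMatInv_map _
  have key : ∀ A B : Matrix (Fin n) (Fin n) (MvPolynomial (PtIdx n) K),
      A.map (MvPolynomial.aeval (ptCoord g)) * B.map (MvPolynomial.aeval (ptCoord g)) = 1 →
      ∀ i j, MvPolynomial.aeval (ptCoord g) ((A * B - 1) i j) = 0 := by
    intro A B h i j
    have h2 : (A * B - 1).map (MvPolynomial.aeval (ptCoord g)) = 0 := by
      rw [Matrix.map_sub _ (map_sub _), Matrix.map_mul, h, Matrix.map_one _ (map_zero _) (map_one _),
        sub_self]
    exact congrFun (congrFun h2 i) j
  rcases hq with ⟨f, hf, rfl⟩ | ⟨ij, rfl⟩ | ⟨ij, rfl⟩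
  · rw [MvPolynomial.aeval_rename]
    exact hg f hf
  · exact key _ _ (by rw [e1, e2, ← Units.val_mul, mul_inv_cancel, Units.val_one]) _ _
  · exact key _ _ (by rw [e1, e2, ← Units.val_mul, inv_mul_cancel, Units.val_one]) _ _

/-- A solution of the equations gives a point of `G`. -/
theorem exists_ptCoord_eq (G : AlgGrp K n) {S : Type u} [CommRing S] [Algebra K S]
    {t : PtIdx n → S} (ht : ∀ q ∈ G.ptEqs, MvPolynomial.aeval t q = 0) :
    ∃ g ∈ G.pts S, ptCoord g = t := by
  have key : ∀ A B : Matrix (Fin n) (Fin n) (MvPolynomial (PtIdx n) K),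
      (∀ i j, MvPolynomial.aeval t ((A * B - 1) i j) = 0) →
      A.map (MvPolynomial.aeval t) * B.map (MvPolynomial.aeval t) = 1 := by
    intro A B h
    have h2 : (A * B - 1).map (MvPolynomial.aeval t) = 0 := by
      ext i j
      exact h i j
    rwa [Matrix.map_sub _ (map_sub _), Matrix.map_mul, Matrix.map_one _ (map_zero _) (map_one _),
      sub_eq_zero] at h2
  refine ⟨⟨(genMat K n).map (MvPolynomial.aeval t), (genMatInv K n).map (MvPolynomial.aeval t),
    key _ _ fun i j => ht _ (Or.inr (Or.inl ⟨(i, j), rfl⟩)),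
    key _ _ fun i j => ht _ (Or.inr (Or.inr ⟨(i, j), rfl⟩))⟩, fun f hf => ?_, ?_⟩
  · have := ht _ (Or.inl ⟨f, hf, rfl⟩)
    rw [MvPolynomial.aeval_rename] at this
    refine Eq.trans ?_ this
    congr 2
    ext ij
    simp [genMat]
  · ext (ij | ij)
    · change MvPolynomial.aeval t (genMat K n ij.1 ij.2) = _
      simp [genMat]
    · change MvPolynomial.aeval t (genMatInv K n ij.1 ij.2) = _
      simp [genMatInv]

theorem ptCoord_injective {S : Type*} [CommRing S] :
    Function.Injective (ptCoord : GL (Fin n) S → PtIdx n → S) := by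
  intro g h e
  ext i j
  exact congrFun e (Sum.inl (i, j))

theorem ptCoord_map {S T : Type*} [CommRing S] [CommRing T] (f : S →+* T) (g : GL (Fin n) S) :
    ptCoord (Matrix.GeneralLinearGroup.map f g) = f ∘ ptCoord g := by
  ext (ij | ij)
  · rfl
  · change ((Matrix.GeneralLinearGroup.map f g)⁻¹ : GL (Fin n) T).1 ij.1 ij.2 = _
    rw [← map_inv]
    rfl

/-- The coordinate ring of `G`, presented by the entries of a matrix and of its inverse. -/
abbrev UnivRing (G : AlgGrp K n) : Type u := MvPolynomial (PtIdx n) K ⧸ Ideal.span G.ptEqs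

theorem exists_univ (G : AlgGrp K n) :
    ∃ g : G.pts G.UnivRing, ptCoord (g : GL (Fin n) G.UnivRing) =
      fun k => Ideal.Quotient.mk _ (MvPolynomial.X k) := by
  obtain ⟨g, hg, h⟩ := G.exists_ptCoord_eq (S := G.UnivRing)
    (t := fun k => Ideal.Quotient.mk _ (MvPolynomial.X k)) fun q hq => by
      have h1 : MvPolynomial.aeval (fun k => Ideal.Quotient.mk (Ideal.span G.ptEqs)
          (MvPolynomial.X k)) = Ideal.Quotient.mkₐ K (Ideal.span G.ptEqs) := by
        ext k
        simp
      rw [h1]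
      exact Ideal.Quotient.eq_zero_iff_mem.2 (Ideal.subset_span hq)
  exact ⟨⟨g, hg⟩, h⟩

/-- The universal point of `G`. -/
noncomputable def univ (G : AlgGrp K n) : G.pts G.UnivRing := G.exists_univ.choose

/-- The specialisation of the universal point at a given point. -/
noncomputable def spec (G : AlgGrp K n) {S : Type u} [CommRing S] [Algebra K S] (g : G.pts S) :
    G.UnivRing →ₐ[K] S :=
  Ideal.Quotient.liftₐ _ (MvPolynomial.aeval (ptCoord (g : GL (Fin n) S))) fun q hq => by
    have : Ideal.span G.ptEqs ≤ RingHom.ker (MvPolynomial.aeval (R := K)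
        (ptCoord (g : GL (Fin n) S))) :=
      Ideal.span_le.2 fun q hq => G.aeval_ptCoord_eq_zero g.2 hq
    exact this hq

theorem spec_mk (G : AlgGrp K n) {S : Type u} [CommRing S] [Algebra K S] (g : G.pts S)
    (q : MvPolynomial (PtIdx n) K) : G.spec g (Ideal.Quotient.mk _ q) =
      MvPolynomial.aeval (ptCoord (g : GL (Fin n) S)) q := rfl

theorem map_spec_univ (G : AlgGrp K n) {S : Type u} [CommRing S] [Algebra K S] (g : G.pts S) :
    (g : GL (Fin n) S) = Matrix.GeneralLinearGroup.map (G.spec g : G.UnivRing →+* S)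
      (G.univ : GL (Fin n) G.UnivRing) := by
  apply ptCoord_injective
  rw [ptCoord_map, univ, G.exists_univ.choose_spec]
  ext k
  change _ = G.spec g (Ideal.Quotient.mk _ (MvPolynomial.X k))
  rw [spec_mk, MvPolynomial.aeval_X]

/-- Matrices over the universal ring are given by polynomials. -/
theorem exists_polynomial_matrix (G : AlgGrp K n) {d : ℕ} (A : Matrix (Fin d) (Fin d) G.UnivRing) :
    ∃ r : Matrix (Fin d) (Fin d) (MvPolynomial (PtIdx n) K),
      ∀ (S : Type u) [CommRing S] [Algebra K S] (g : G.pts S),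
        A.map (G.spec g) = r.map (MvPolynomial.aeval (ptCoord (g : GL (Fin n) S))) := by
  choose r hr using fun i j => Ideal.Quotient.mk_surjective (A i j)
  refine ⟨Matrix.of r, fun S _ _ g => ?_⟩
  ext i j
  change G.spec g (A i j) = _
  rw [← hr]
  rfl

/-- The matrix entries of a representation are polynomials. -/
theorem ProjectiveQuotient.exists_polynomial_rep {G P : AlgGrp K n} (X : ProjectiveQuotient G P) :
    ∃ r : Matrix (Fin X.dim) (Fin X.dim) (MvPolynomial (PtIdx n) K),
      ∀ (S : Type u) [CommRing S] [Algebra K S] (g : G.pts S),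
        (X.rep S g : Matrix (Fin X.dim) (Fin X.dim) S) =
          r.map (MvPolynomial.aeval (ptCoord (g : GL (Fin n) S))) := by
  obtain ⟨r, hr⟩ := G.exists_polynomial_matrix
    (X.rep G.UnivRing G.univ : Matrix (Fin X.dim) (Fin X.dim) G.UnivRing)
  refine ⟨r, fun S _ _ g => ?_⟩
  -- By naturality, the representation at `g` is the specialisation of its matrix at the universal
  -- point.
  rw [← hr, X.rep_natural _ _ (G.spec g) G.univ g (G.map_spec_univ g)]
  rfl

/-- The projection of `P = M ⋉ U` onto `M` is given by polynomials. -/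
theorem IsLeviDecomposition.exists_polynomial_proj {P M U : AlgGrp K n}
    (h : P.IsLeviDecomposition M U) :
    ∃ q q' : Matrix (Fin n) (Fin n) (MvPolynomial (PtIdx n) K), ∀ g : P.pts K,
      ∃ m ∈ M.pts K, m⁻¹ * (g : GL (Fin n) K) ∈ U.pts K ∧
        (m : Matrix (Fin n) (Fin n) K) =
          q.map (MvPolynomial.aeval (ptCoord (g : GL (Fin n) K))) ∧
        ((m⁻¹ : GL (Fin n) K) : Matrix (Fin n) (Fin n) K) =
          q'.map (MvPolynomial.aeval (ptCoord (g : GL (Fin n) K))) := by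
  -- Decomposing the universal point of `P` once gives the projection to `M` for all points by
  -- specialisation.
  obtain ⟨m, hm, x, hx, hmx⟩ := h.exists_mul P.UnivRing _ P.univ.2
  obtain ⟨q, hq⟩ := P.exists_polynomial_matrix (m : Matrix (Fin n) (Fin n) P.UnivRing)
  obtain ⟨q', hq'⟩ := P.exists_polynomial_matrix
    ((m⁻¹ : GL (Fin n) P.UnivRing) : Matrix (Fin n) (Fin n) P.UnivRing)
  refine ⟨q, q', fun g => ⟨_, M.map_mem_pts (P.spec g) hm, ?_, hq K g, ?_⟩⟩
  · rw [P.map_spec_univ g, hmx, map_mul, inv_mul_cancel_left]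
    exact U.map_mem_pts (P.spec g) hx
  · rw [← hq' K g, ← map_inv]
    rfl

end universal

section topology

variable {K : Type u} [Field K] [TopologicalSpace K] [IsTopologicalRing K] {n : ℕ}

theorem continuous_ptCoord : Continuous (ptCoord : GL (Fin n) K → PtIdx n → K) := by
  refine continuous_pi ?_
  rintro (ij | ij)
  · exact Units.continuous_val.matrix_elem ij.1 ij.2
  · exact (Units.continuous_val.comp continuous_inv).matrix_elem ij.1 ij.2

theorem continuous_map_aeval_ptCoord {m : Type*}
    (q : Matrix m m (MvPolynomial (PtIdx n) K)) :
    Continuous fun g : GL (Fin n) K => q.map (MvPolynomial.aeval (ptCoord g)) := by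
  refine continuous_matrix fun i j => ?_
  simp only [Matrix.map_apply, MvPolynomial.aeval_eq_eval]
  exact (MvPolynomial.continuous_eval _).comp continuous_ptCoord

/-- The Levi subgroup is closed in `G / U`. -/
theorem IsLeviDecomposition.isClosedEmbedding [T1Space K] {G P M U : AlgGrp K n}
    (hPG : P.IsSubgroup G) (h : P.IsLeviDecomposition M U) :
    IsClosedEmbedding fun m : G.sub M => ((m : G.pts K) : G.pts K ⧸ G.sub U) := by
  obtain ⟨q, q', hq⟩ := h.exists_polynomial_proj
  choose pr hprM hprU hpr hpr' using hq
  have hcont : Continuous pr := Units.continuous_iff.2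
    ⟨by
      have := (continuous_map_aeval_ptCoord q).comp
        (continuous_subtype_val (p := fun g => g ∈ P.pts K))
      exact this.congr fun g => (hpr g).symm, by
      have := (continuous_map_aeval_ptCoord q').comp
        (continuous_subtype_val (p := fun g => g ∈ P.pts K))
      exact this.congr fun g => (hpr' g).symm⟩
  have hMG : ∀ x ∈ M.pts K, x ∈ G.pts K := fun x hx => hPG K (h.levi_subgroup K hx)
  let f : G.sub P → G.sub M := fun g => ⟨⟨pr ⟨_, g.2⟩, hMG _ (hprM _)⟩, hprM _⟩
  have hf : Continuous f := by
    refine Continuous.subtype_mk (Continuous.subtype_mk (hcont.comp ?_) _) _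
    exact Continuous.subtype_mk (continuous_subtype_val.comp continuous_subtype_val) _
  -- The component in `M` is unique because `M` and `U` intersect trivially.
  have huniq : ∀ (g : G.sub P) (m : G.sub M), (m : G.pts K)⁻¹ * g ∈ G.sub U → f g = m := by
    intro g m hm
    have h1 : ((m : G.pts K) : GL (Fin n) K)⁻¹ * pr ⟨_, g.2⟩ ∈ M.pts K ⊓ U.pts K := by
      refine ⟨(M.pts K).mul_mem ((M.pts K).inv_mem m.2) (hprM _), ?_⟩
      have := (U.pts K).mul_mem hm ((U.pts K).inv_mem (hprU ⟨_, g.2⟩))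
      simpa [mul_assoc] using this
    rw [h.inf_eq_bot, Subgroup.mem_bot, inv_mul_eq_one] at h1
    exact Subtype.ext (Subtype.ext h1.symm)
  refine IsClosedEmbedding.of_continuous_injective_isClosedMap
    (continuous_quotient_mk'.comp continuous_subtype_val) (fun m m' hm => ?_) fun A hA => ?_
  · have hP : ∀ m : G.sub M, (m : G.pts K) ∈ G.sub P := fun m => h.levi_subgroup K m.2
    have h1 := huniq ⟨m', hP m'⟩ m (QuotientGroup.eq.1 hm)
    have h2 := huniq ⟨m', hP m'⟩ m' (by simp [(G.sub U).one_mem])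
    exact h1.symm.trans h2
  -- The preimage in `G` of the image of `A` is the preimage of `A` under the continuous projection
  -- from `P` to `M`, and `P` is closed in `G`.
  · have hPc : IsClosed (G.sub P : Set (G.pts K)) := P.isClosed_pts.preimage continuous_subtype_val
    have hB := hPc.isClosedEmbedding_subtypeVal.isClosedMap _ (hA.preimage hf)
    rw [← (QuotientGroup.isQuotientMap_mk (N := G.sub U)).isClosed_preimage]
    convert hB using 1
    ext g
    constructor
    · rintro ⟨m, hm, hmg⟩
      have h1 := QuotientGroup.eq.1 hmg
      have hgP : g ∈ G.sub P := by
        have := (G.sub P).mul_mem (h.levi_subgroup K m.2 : (m : G.pts K) ∈ G.sub P)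
          (h.unip_subgroup K h1 : (m : G.pts K)⁻¹ * g ∈ G.sub P)
        rwa [mul_inv_cancel_left] at this
      exact ⟨⟨g, hgP⟩, by rwa [Set.mem_preimage, huniq ⟨g, hgP⟩ m h1], rfl⟩
    · rintro ⟨g, hg, rfl⟩
      exact ⟨f g, hg, QuotientGroup.eq.2 (hprU _)⟩

end topology

end AlgGrp

/-! ### Transporters in a projective homogeneous space -/

namespace AlgGrp.ProjectiveQuotient

variable {K : Type u} [Field K] {n : ℕ} {G P : AlgGrp K n} (X : ProjectiveQuotient G P)

/-- The representation in terms of polynomials in the entries of a point and of its inverse. -/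
noncomputable def repMat : Matrix (Fin X.dim) (Fin X.dim) (MvPolynomial (PtIdx n) K) :=
  X.exists_polynomial_rep.choose

theorem rep_eq (S : Type u) [CommRing S] [Algebra K S] (g : G.pts S) :
    (X.rep S g : Matrix (Fin X.dim) (Fin X.dim) S) =
      X.repMat.map (MvPolynomial.aeval (ptCoord (g : GL (Fin n) S))) :=
  X.exists_polynomial_rep.choose_spec S g

/-- Coordinates for a group element and a unit. -/
abbrev TransIdx (n : ℕ) : Type := PtIdx n ⊕ Bool

/-- The coordinates of a group element and a unit. -/
def transCoord {S : Type*} [CommRing S] (g : GL (Fin n) S) (c : Sˣ) : TransIdx n → S :=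
  Sum.elim (ptCoord g) fun b => cond b (c : S) ((c⁻¹ : Sˣ) : S)

/-- The equation `y = c • g w` for a fixed vector `w`. -/
noncomputable def transEq (w : Fin X.dim → K) (i : Fin X.dim) :
    MvPolynomial (Fin X.dim ⊕ TransIdx n) K :=
  MvPolynomial.X (Sum.inl i) - MvPolynomial.X (Sum.inr (Sum.inr true)) *
    ∑ j, MvPolynomial.rename (fun k => Sum.inr (Sum.inl k)) (X.repMat i j) * MvPolynomial.C (w j)

/-- The ideal that describes the triples `(y, g, c)` with `y = c • g w`. -/
noncomputable def transIdeal (w : Fin X.dim → K) :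
    Ideal (MvPolynomial (Fin X.dim ⊕ TransIdx n) K) :=
  Ideal.span (MvPolynomial.rename (fun k => Sum.inr (Sum.inl k)) '' G.ptEqs ∪
    ({MvPolynomial.X (Sum.inr (Sum.inr true)) * MvPolynomial.X (Sum.inr (Sum.inr false)) - 1} ∪
      Set.range (X.transEq w)))

/-- The equations of the projective variety, in the first group of variables. -/
noncomputable def coneIdeal : Ideal (MvPolynomial (Fin X.dim ⊕ TransIdx n) K) :=
  Ideal.span (MvPolynomial.rename Sum.inl '' X.eqs)

variable {X}

section points

variable {S : Type u} [CommRing S] [Algebra K S]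

theorem aeval_transEq (w : Fin X.dim → K) (t : Fin X.dim ⊕ TransIdx n → S) (i : Fin X.dim) :
    MvPolynomial.aeval t (X.transEq w i) = t (Sum.inl i) - t (Sum.inr (Sum.inr true)) *
      ((X.repMat.map (MvPolynomial.aeval fun k => t (Sum.inr (Sum.inl k)))) *ᵥ
        fun j => algebraMap K S (w j)) i := by
  simp only [transEq, map_sub, map_mul, map_sum, MvPolynomial.aeval_X, MvPolynomial.aeval_rename,
    MvPolynomial.aeval_C, Matrix.mulVec, dotProduct, Matrix.map_apply]
  rfl

theorem aeval_transIdeal_eq_zero {w : Fin X.dim → K} {y : Fin X.dim → S} (g : G.pts S) (c : Sˣ)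
    (h : y = c • ((X.rep S g : Matrix (Fin X.dim) (Fin X.dim) S) *ᵥ
      fun j => algebraMap K S (w j)))
    {q : MvPolynomial (Fin X.dim ⊕ TransIdx n) K} (hq : q ∈ X.transIdeal w) :
    MvPolynomial.aeval (Sum.elim y (transCoord (g : GL (Fin n) S) c)) q = 0 := by
  refine (Ideal.span_le (I := RingHom.ker (MvPolynomial.aeval (R := K)
    (Sum.elim y (transCoord (g : GL (Fin n) S) c))))).2 ?_ hq
  rintro _ (⟨f, hf, rfl⟩ | rfl | ⟨i, rfl⟩)
  · rw [SetLike.mem_coe, RingHom.mem_ker, MvPolynomial.aeval_rename]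
    exact G.aeval_ptCoord_eq_zero g.2 hf
  · simp [RingHom.mem_ker, transCoord]
  · rw [SetLike.mem_coe, RingHom.mem_ker, aeval_transEq, sub_eq_zero]
    have := congrFun h i
    rw [X.rep_eq] at this
    exact this

theorem exists_of_aeval_transIdeal {w : Fin X.dim → K} {t : Fin X.dim ⊕ TransIdx n → S}
    (ht : ∀ q ∈ X.transIdeal w, MvPolynomial.aeval t q = 0) :
    ∃ (g : G.pts S) (c : Sˣ), (fun k => t (Sum.inr k)) = transCoord (g : GL (Fin n) S) c ∧
      (fun i => t (Sum.inl i)) = c • ((X.rep S g : Matrix (Fin X.dim) (Fin X.dim) S) *ᵥ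
        fun j => algebraMap K S (w j)) := by
  obtain ⟨g, hg, hgt⟩ := G.exists_ptCoord_eq (t := fun k => t (Sum.inr (Sum.inl k))) fun q hq => by
    have := ht _ (Ideal.subset_span (Or.inl ⟨q, hq, rfl⟩))
    rw [MvPolynomial.aeval_rename] at this
    exact this
  have hc := ht _ (Ideal.subset_span (Or.inr (Or.inl rfl)))
  rw [map_sub, map_mul, map_one, MvPolynomial.aeval_X, MvPolynomial.aeval_X, sub_eq_zero] at hc
  refine ⟨⟨g, hg⟩, Units.mkOfMulEqOne _ _ hc, ?_, ?_⟩
  · ext (k | b)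
    · exact (congrFun hgt k).symm
    · cases b
      · rfl
      · rfl
  · ext i
    have := ht _ (Ideal.subset_span (Or.inr (Or.inr ⟨i, rfl⟩)))
    rw [aeval_transEq, sub_eq_zero] at this
    rw [this, X.rep_eq]
    simp only [hgt]
    rfl

end points

theorem _root_.AlgGrp.SolvesEqs.algebraMap_comp {m : ℕ} {E : Set (MvPolynomial (Fin m) K)}
    {w : Fin m → K} (h : SolvesEqs E w) (S : Type u) [CommRing S] [Algebra K S] :
    SolvesEqs E fun i => algebraMap K S (w i) := fun f hf => by
  have := congrArg (algebraMap K S) (h f hf)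
  rw [map_zero, ← MvPolynomial.aeval_algebraMap_apply] at this
  exact this

/-- Smoothness gives polynomial formulas for improving approximate solutions of `y = c • g w`. -/
theorem exists_transIdeal_lift {w : Fin X.dim → K} (hw : SolvesEqs X.eqs w) {i₀ : Fin X.dim}
    (hi₀ : w i₀ = 1) :
    ∃ τ : TransIdx n → MvPolynomial (Fin X.dim ⊕ TransIdx n) K,
      (∀ k, τ k - MvPolynomial.X (Sum.inr k) ∈ X.transIdeal w ⊔ X.coneIdeal) ∧
      ∀ q ∈ X.transIdeal w, MvPolynomial.aeval (Sum.elim (fun i => MvPolynomial.X (Sum.inl i)) τ) q ∈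
        X.transIdeal w ^ 2 ⊔ X.coneIdeal := by
  set I := X.transIdeal w
  -- Over the quotient by `Q` the ideal `J` generated by `I` has square zero. The tautological point
  -- solves `y = c • g w` modulo `J`, while `y` satisfies the equations of the variety modulo `Q`.
  set Q := I ^ 2 ⊔ X.coneIdeal
  let A := MvPolynomial (Fin X.dim ⊕ TransIdx n) K ⧸ Q
  let J : Ideal A := I.map (Ideal.Quotient.mk Q)
  have hJ : J ^ 2 = ⊥ := by
    rw [← Ideal.map_pow, Ideal.map_eq_bot_iff_le_ker, Ideal.mk_ker]
    exact le_sup_left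
  have hmk : ∀ q, MvPolynomial.aeval (fun k => Ideal.Quotient.mk Q (MvPolynomial.X k)) q =
      Ideal.Quotient.mk Q q := fun q => by
    have : MvPolynomial.aeval (fun k => Ideal.Quotient.mk Q (MvPolynomial.X k)) =
        Ideal.Quotient.mkₐ K Q := by
      ext k
      simp
    rw [this]
    rfl
  have hmk' : ∀ q, MvPolynomial.aeval
      (fun k => Ideal.Quotient.mk J (Ideal.Quotient.mk Q (MvPolynomial.X k))) q =
      Ideal.Quotient.mk J (Ideal.Quotient.mk Q q) := fun q => by
    have : MvPolynomial.aeval (fun k => Ideal.Quotient.mk J (Ideal.Quotient.mk Q (MvPolynomial.X k)))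
        = (Ideal.Quotient.mkₐ K J).comp (Ideal.Quotient.mkₐ K Q) := by
      ext k
      rw [MvPolynomial.aeval_X]
      rfl
    rw [this]
    rfl
  obtain ⟨g₀, c₀, htr, hy⟩ := exists_of_aeval_transIdeal (X := X) (w := w)
    (t := fun k => Ideal.Quotient.mk J (Ideal.Quotient.mk Q (MvPolynomial.X k))) fun q hq => by
      rw [hmk', Ideal.Quotient.eq_zero_iff_mem]
      exact Ideal.mem_map_of_mem _ hq
  -- Infinitesimal lifting turns the solution modulo `J` into an exact one over `A`; polynomial
  -- representatives of its coordinates are the required `τ`.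
  obtain ⟨g, c, hg, hc, hgc⟩ := X.smooth A J hJ (fun i => algebraMap K A (w i))
    (fun i => Ideal.Quotient.mk Q (MvPolynomial.X (Sum.inl i)))
    (by
      rw [Ideal.eq_top_iff_one]
      exact Ideal.subset_span ⟨i₀, (congrArg (algebraMap K A) hi₀).trans (map_one _)⟩)
    (hw.algebraMap_comp A)
    (fun f hf => by
      have := hmk (MvPolynomial.rename Sum.inl f)
      rw [MvPolynomial.aeval_rename] at this
      refine this.trans (Ideal.Quotient.eq_zero_iff_mem.2 (Ideal.mem_sup_right ?_))
      exact Ideal.subset_span ⟨f, hf, rfl⟩) g₀ c₀ hy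
  choose τ hτ using fun k => Ideal.Quotient.mk_surjective (I := Q)
    (transCoord (g : GL (Fin n) A) c k)
  refine ⟨τ, fun k => ?_, fun q hq => ?_⟩
  · have h1 : Ideal.Quotient.mk J (transCoord (g : GL (Fin n) A) c k) =
        transCoord (g₀ : GL (Fin n) (A ⧸ J)) c₀ k := by
      rcases k with k | b
      · have := congrFun (ptCoord_map (S := A) (T := A ⧸ J) (Ideal.Quotient.mk J) (g : GL (Fin n) A)) k
        rw [hg] at this
        exact this.symm
      · rw [← hc]
        cases b <;> rfl
    rw [← congrFun htr k, ← hτ k, ← sub_eq_zero, ← map_sub, ← map_sub,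
      Ideal.Quotient.eq_zero_iff_mem,
      Ideal.mem_map_iff_of_surjective _ Ideal.Quotient.mk_surjective] at h1
    obtain ⟨a, ha, hae⟩ := h1
    have h2 := Ideal.Quotient.eq.1 hae.symm
    have h3 := Ideal.add_mem _ ((sup_le_sup_right (Ideal.pow_le_self two_ne_zero) _ : Q ≤ _) h2)
      (Ideal.mem_sup_left ha)
    rwa [sub_add_cancel] at h3
  · have h1 := aeval_transIdeal_eq_zero g c hgc hq
    rw [← Ideal.Quotient.eq_zero_iff_mem]
    refine Eq.trans ?_ h1
    have h2 := MvPolynomial.comp_aeval_apply (R := K)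
      (Sum.elim (fun i => MvPolynomial.X (Sum.inl i)) τ) (Ideal.Quotient.mkₐ K Q) q
    refine h2.trans ?_
    congr 2
    ext (k | k)
    · rfl
    · exact hτ k

end AlgGrp.ProjectiveQuotient

/-! ### Approximate zeros of polynomials over a local field -/

namespace MvPolynomial

open ValuativeRel IsNonarchimedeanLocalField

section bound

variable {F : Type u} [Field F] [ValuativeRel F] {σ : Type*}

theorem exists_valuation_aeval_le (q : MvPolynomial σ F) :
    ∃ A : ValueGroupWithZero F, ∀ t : σ → F, (∀ i, valuation F (t i) ≤ 1) →
      valuation F (aeval t q) ≤ A := by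
  induction q using MvPolynomial.induction_on with
  | C a => exact ⟨valuation F a, fun t _ => by rw [aeval_C]; exact le_rfl⟩
  | add p q hp hq =>
    obtain ⟨A, hA⟩ := hp
    obtain ⟨B, hB⟩ := hq
    refine ⟨max A B, fun t ht => ?_⟩
    rw [map_add]
    exact (valuation F).map_add_le ((hA t ht).trans (le_max_left _ _))
      ((hB t ht).trans (le_max_right _ _))
  | mul_X p i hp =>
    obtain ⟨A, hA⟩ := hp
    refine ⟨A * 1, fun t ht => ?_⟩
    rw [map_mul, map_mul, aeval_X]
    exact mul_le_mul' (hA t ht) (ht i)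

variable {s : Set (MvPolynomial σ F)}

theorem exists_valuation_aeval_le_of_mem_span {q : MvPolynomial σ F} (hq : q ∈ Ideal.span s) :
    ∃ A : ValueGroupWithZero F, ∀ (t : σ → F) (e : ValueGroupWithZero F),
      (∀ i, valuation F (t i) ≤ 1) → (∀ h ∈ s, valuation F (aeval t h) ≤ e) →
      valuation F (aeval t q) ≤ A * e := by
  induction hq using Submodule.span_induction with
  | mem q hq => exact ⟨1, fun t e _ h => by rw [one_mul]; exact h q hq⟩
  | zero => exact ⟨0, fun t e _ h => by simp⟩
  | add p q _ _ hp hq =>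
    obtain ⟨A, hA⟩ := hp
    obtain ⟨B, hB⟩ := hq
    refine ⟨max A B, fun t e ht he => ?_⟩
    rw [map_add]
    exact (valuation F).map_add_le
      ((hA t e ht he).trans (mul_le_mul_left (le_max_left _ _) _))
      ((hB t e ht he).trans (mul_le_mul_left (le_max_right _ _) _))
  | smul a q _ hq =>
    obtain ⟨A, hA⟩ := a.exists_valuation_aeval_le
    obtain ⟨B, hB⟩ := hq
    refine ⟨A * B, fun t e ht he => ?_⟩
    rw [smul_eq_mul, map_mul, map_mul, mul_assoc]
    exact mul_le_mul' (hA t ht) (hB t e ht he)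

/-- The bound is quadratic in the error `e`, with a constant independent of the point; this is what
makes the iteration below contract. -/
theorem exists_valuation_aeval_le_of_mem_span_sq {q : MvPolynomial σ F}
    (hq : q ∈ Ideal.span s ^ 2) :
    ∃ A : ValueGroupWithZero F, ∀ (t : σ → F) (e : ValueGroupWithZero F),
      (∀ i, valuation F (t i) ≤ 1) → (∀ h ∈ s, valuation F (aeval t h) ≤ e) →
      valuation F (aeval t q) ≤ A * (e * e) := by
  rw [pow_two] at hq
  induction hq using Submodule.mul_induction_on' with
  | mem_mul_mem p hp q hq =>
    obtain ⟨A, hA⟩ := exists_valuation_aeval_le_of_mem_span hp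
    obtain ⟨B, hB⟩ := exists_valuation_aeval_le_of_mem_span hq
    refine ⟨A * B, fun t e ht he => ?_⟩
    rw [map_mul, map_mul, mul_mul_mul_comm]
    exact mul_le_mul' (hA t e ht he) (hB t e ht he)
  | add p _ q _ hp hq =>
    obtain ⟨A, hA⟩ := hp
    obtain ⟨B, hB⟩ := hq
    refine ⟨max A B, fun t e ht he => ?_⟩
    rw [map_add]
    exact (valuation F).map_add_le
      ((hA t e ht he).trans (mul_le_mul_left (le_max_left _ _) _))
      ((hB t e ht he).trans (mul_le_mul_left (le_max_right _ _) _))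

end bound

variable {F : Type u} [Field F] [ValuativeRel F] [TopologicalSpace F]
  [IsNonarchimedeanLocalField F]

theorem continuous_aeval {σ : Type*} (q : MvPolynomial σ F) :
    Continuous fun t : σ → F => aeval t q := by
  simp only [aeval_eq_eval]
  exact continuous_eval q

/-- A system of polynomial equations in `t` depending on a parameter `y` that has a polynomial
recipe for improving approximate solutions is solvable with `t` integral for all `y` close to a
given one for which it has an integral solution. -/
theorem eventually_exists_aeval_eq_zero {ι κ : Type*} [Finite ι] [Finite κ]
    {I E : Ideal (MvPolynomial (ι ⊕ κ) F)}
    {τ : κ → MvPolynomial (ι ⊕ κ) F} (h1 : ∀ k, τ k - X (Sum.inr k) ∈ I ⊔ E)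
    (h2 : ∀ q ∈ I, aeval (Sum.elim (fun i => X (Sum.inl i)) τ) q ∈ I ^ 2 ⊔ E)
    {y₀ : ι → F} {t₀ : κ → F} (ht₀ : ∀ k, valuation F (t₀ k) ≤ 1)
    (h0 : ∀ q ∈ I, aeval (Sum.elim y₀ t₀) q = 0) :
    ∀ᶠ y in 𝓝 y₀, (∀ i, valuation F (y i) ≤ 1) →
      (∀ t, ∀ q ∈ E, aeval (Sum.elim y t) q = 0) →
      ∃ t : κ → F, (∀ k, valuation F (t k) ≤ 1) ∧ ∀ q ∈ I, aeval (Sum.elim y t) q = 0 := by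
  have := t2Space F
  obtain ⟨s, hs⟩ := (isNoetherianRing_iff_ideal_fg _).1
    (inferInstance : IsNoetherianRing (MvPolynomial (ι ⊕ κ) F)) I
  have hsI : ∀ h ∈ s, h ∈ I := fun h hh => hs ▸ Ideal.subset_span hh
  -- One improvement step moves an approximate solution with error `e` by at most a constant times
  -- `e`.
  have b1 : ∀ k, ∃ A : ValueGroupWithZero F, ∀ (y : ι → F) (t : κ → F) (e : ValueGroupWithZero F),
      (∀ q ∈ E, aeval (Sum.elim y t) q = 0) → (∀ i, valuation F (Sum.elim y t i) ≤ 1) →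
      (∀ h ∈ s, valuation F (aeval (Sum.elim y t) h) ≤ e) →
      valuation F (aeval (Sum.elim y t) (τ k) - t k) ≤ A * e := by
    intro k
    obtain ⟨a, ha, b, hb, hab⟩ := Submodule.mem_sup.1 (h1 k)
    obtain ⟨A, hA⟩ := exists_valuation_aeval_le_of_mem_span (hs ▸ ha)
    refine ⟨A, fun y t e hE ht he => ?_⟩
    have h3 := congrArg (aeval (Sum.elim y t)) hab
    rw [map_add, map_sub, hE b hb, add_zero, aeval_X] at h3
    exact (congrArg (valuation F) h3).symm.trans_le (hA _ e ht he)
  -- The same step reduces the error to a constant times `e * e`.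
  have b2 : ∀ h : s, ∃ A : ValueGroupWithZero F,
      ∀ (y : ι → F) (t : κ → F) (e : ValueGroupWithZero F),
      (∀ q ∈ E, aeval (Sum.elim y t) q = 0) → (∀ i, valuation F (Sum.elim y t i) ≤ 1) →
      (∀ h ∈ s, valuation F (aeval (Sum.elim y t) h) ≤ e) →
      valuation F (aeval (Sum.elim y fun k => aeval (Sum.elim y t) (τ k)) h.1) ≤ A * (e * e) := by
    intro h
    obtain ⟨a, ha, b, hb, hab⟩ := Submodule.mem_sup.1 (h2 h (hsI h h.2))
    obtain ⟨A, hA⟩ := exists_valuation_aeval_le_of_mem_span_sq (hs ▸ ha)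
    refine ⟨A, fun y t e hE ht he => ?_⟩
    have h3 := congrArg (aeval (Sum.elim y t)) hab
    rw [map_add, hE b hb, add_zero, comp_aeval_apply] at h3
    have h4 : (fun i => aeval (Sum.elim y t) (Sum.elim (fun i => X (Sum.inl i)) τ i)) =
        Sum.elim y fun k => aeval (Sum.elim y t) (τ k) := by
      ext (i | k)
      · simp
      · rfl
    rw [h4] at h3
    exact (congrArg (valuation F) h3).symm.trans_le (hA _ e ht he)
  choose A₁ hA₁ using b1
  choose A₂ hA₂ using b2
  obtain ⟨B₁, hB₁⟩ := Finite.exists_le A₁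
  obtain ⟨B₂, hB₂⟩ := Finite.exists_le A₂
  set A := max 1 (max B₁ B₂)
  have hA₁A : ∀ k, A₁ k ≤ A := fun k => (hB₁ k).trans ((le_max_left _ _).trans (le_max_right _ _))
  have hA₂A : ∀ h, A₂ h ≤ A := fun h => (hB₂ h).trans ((le_max_right _ _).trans (le_max_right _ _))
  have hA : A ≠ 0 := (zero_lt_one.trans_le (le_max_left _ _)).ne'
  obtain ⟨c, hc, hc1⟩ := exists_pos_lt_one F
  -- With initial error at most `e₀ = c / A`, each step gains at least a factor `c` and never leaves
  -- the integral points.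
  set e₀ := A⁻¹ * c
  have he₀ : A * e₀ = c := mul_inv_cancel_left₀ hA c
  have he₀' : e₀ ≠ 0 := mul_ne_zero (inv_ne_zero hA) hc
  have hev : ∀ᶠ y in 𝓝 y₀, ∀ h ∈ s, valuation F (aeval (Sum.elim y t₀) h) ≤ e₀ := by
    rw [Filter.eventually_all_finset]
    intro h hh
    have hcont : Continuous fun y : ι → F => aeval (Sum.elim y t₀) h := by
      refine (continuous_aeval h).comp (continuous_pi ?_)
      rintro (i | k)
      · exact continuous_apply i
      · exact continuous_const
    have := (hcont.tendsto y₀).eventually (eventually_valuation_sub_le _ he₀')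
    filter_upwards [this] with y hy
    rwa [h0 h (hsI h hh), sub_zero] at hy
  filter_upwards [hev] with y hy hy1 hE
  have hunit : ∀ t : κ → F, (∀ k, valuation F (t k) ≤ 1) → ∀ i, valuation F (Sum.elim y t i) ≤ 1 := by
    rintro t ht (i | k)
    · exact hy1 i
    · exact ht k
  -- No convergence of the iterates is needed: these sets are nested, compact and, by the iteration,
  -- non-empty, and a common point is an exact solution.
  let T : ℕ → Set (κ → F) := fun j => {t | (∀ k, valuation F (t k) ≤ 1) ∧
    ∀ h ∈ s, valuation F (aeval (Sum.elim y t) h) ≤ c ^ j * e₀}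
  have hball : IsCompact {t : κ → F | ∀ k, valuation F (t k) ≤ 1} := by
    have := isCompact_univ_pi fun _ : κ => isCompact_closedBall F 1
    convert this using 1
    ext t
    exact ⟨fun h i _ => h i, fun h i => h i trivial⟩
  have hTclosed : ∀ j, IsClosed (T j) := by
    intro j
    suffices h : IsClosed {t : κ → F | ∀ h ∈ s, valuation F (aeval (Sum.elim y t) h) ≤ c ^ j * e₀} from
      hball.isClosed.inter h
    have : {t : κ → F | ∀ h ∈ s, valuation F (aeval (Sum.elim y t) h) ≤ c ^ j * e₀} =
        ⋂ h ∈ s, (fun t : κ → F => aeval (Sum.elim y t) h) ⁻¹'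
          {x | valuation F x ≤ c ^ j * e₀} := by
      ext t
      simp only [Set.mem_iInter]
      exact Iff.rfl
    rw [this]
    refine isClosed_biInter fun h _ => (isClosed_setOf_valuation_le _).preimage ?_
    refine (continuous_aeval h).comp (continuous_pi ?_)
    rintro (i | k)
    · exact continuous_const
    · exact continuous_apply k
  have hTne : ∀ j, (T j).Nonempty := by
    intro j
    induction j with
    | zero => exact ⟨t₀, ht₀, fun h hh => by rw [pow_zero, one_mul]; exact hy h hh⟩
    | succ j ih =>
      obtain ⟨t, ht, hte⟩ := ih
      have hce : A * (c ^ j * e₀) ≤ c ^ (j + 1) := by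
        rw [mul_left_comm, he₀, pow_succ]
      refine ⟨fun k => aeval (Sum.elim y t) (τ k), fun k => ?_, fun h hh => ?_⟩
      · have h3 := hA₁ k y t _ (hE t) (hunit t ht) hte
        have h4 : valuation F (aeval (Sum.elim y t) (τ k) - t k) ≤ 1 :=
          h3.trans ((mul_le_mul_left (hA₁A k) _).trans
            (hce.trans (pow_le_one' hc1.le _)))
        have := (valuation F).map_add_le h4 (ht k)
        rwa [sub_add_cancel] at this
      · have h3 := hA₂ ⟨h, hh⟩ y t _ (hE t) (hunit t ht) hte
        refine h3.trans ((mul_le_mul_left (hA₂A ⟨h, hh⟩) _).trans ?_)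
        rw [← mul_assoc]
        exact mul_le_mul' hce (mul_le_of_le_one_left' (pow_le_one' hc1.le j))
  obtain ⟨t, ht⟩ := IsCompact.nonempty_iInter_of_sequence_nonempty_isCompact_isClosed T
    (fun j t ht => ⟨ht.1, fun h hh => (ht.2 h hh).trans
      (mul_le_mul_left (pow_le_pow_right_of_le_one' hc1.le j.le_succ) _)⟩) hTne
    (hball.of_isClosed_subset (hTclosed 0) fun t ht => ht.1) hTclosed
  rw [Set.mem_iInter] at ht
  refine ⟨t, (ht 0).1, fun q hq => ?_⟩
  have hker : I ≤ RingHom.ker (aeval (R := F) (Sum.elim y t)) := by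
    rw [← hs, Ideal.span_le]
    intro h hh
    exact tendsto_nhds_unique (tendsto_const_nhds (x := aeval (Sum.elim y t) h) (f := atTop))
      (tendsto_of_valuation_sub_le hc1 (γ := e₀) fun j => by
        rw [sub_zero]
        exact (ht j).2 h hh)
  exact hker hq

end MvPolynomial

/-! ### Compactness of `G / P` -/

namespace AlgGrp

open ValuativeRel IsNonarchimedeanLocalField

variable {F : Type u} [Field F] [ValuativeRel F] [TopologicalSpace F]
  [IsNonarchimedeanLocalField F] {n : ℕ}

namespace ProjectiveQuotient

variable {G P : AlgGrp F n} (X : ProjectiveQuotient G P)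

/-- The points `y` of the cone over the projective variety near a given point `w` are of the form
`c • g w` with `g` in a fixed compact set. -/
theorem eventually_exists_smul_rep {w : Fin X.dim → F} (hw : SolvesEqs X.eqs w) {i₀ : Fin X.dim}
    (hi₀ : w i₀ = 1) :
    ∀ᶠ y in 𝓝 w, (∀ i, valuation F (y i) ≤ 1) → SolvesEqs X.eqs y →
      ∃ (g : G.pts F) (c : Fˣ), ((g : GL (Fin n) F) : Matrix (Fin n) (Fin n) F).EntriesLE 1 ∧
        (((g : GL (Fin n) F)⁻¹ : GL (Fin n) F) : Matrix (Fin n) (Fin n) F).EntriesLE 1 ∧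
        y = c • ((X.rep F g : Matrix (Fin X.dim) (Fin X.dim) F) *ᵥ w) := by
  obtain ⟨τ, h1, h2⟩ := X.exists_transIdeal_lift hw hi₀
  have hone : Matrix.EntriesLE 1 (1 : Matrix (Fin n) (Fin n) F) := .one le_rfl
  -- The iteration starts at the identity of the group and the unit `1`, which solve the equation
  -- exactly for `y = w`.
  have := MvPolynomial.eventually_exists_aeval_eq_zero h1 h2 (y₀ := w)
    (t₀ := transCoord ((1 : G.pts F) : GL (Fin n) F) 1) (by
      rintro ((ij | ij) | b)
      · exact hone ij.1 ij.2
      · simpa [transCoord, ptCoord] using hone ij.1 ij.2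
      · cases b <;> simp [transCoord])
    fun q hq => aeval_transIdeal_eq_zero 1 1 (by
      rw [map_one, Units.val_one, Matrix.one_mulVec, one_smul]
      rfl) hq
  filter_upwards [this] with y hy hy1 hye
  obtain ⟨t, ht, htI⟩ := hy hy1 fun t q hq => by
    refine (Ideal.span_le (I := RingHom.ker (MvPolynomial.aeval (R := F) (Sum.elim y t)))).2 ?_ hq
    rintro _ ⟨f, hf, rfl⟩
    rw [SetLike.mem_coe, RingHom.mem_ker, MvPolynomial.aeval_rename]
    exact hye f hf
  obtain ⟨g, c, hg, hgc⟩ := exists_of_aeval_transIdeal htI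
  refine ⟨g, c, fun i j => ?_, fun i j => ?_, hgc⟩
  · have h3 := ht (Sum.inl (Sum.inl (i, j)))
    have h4 := congrFun hg (Sum.inl (Sum.inl (i, j)))
    exact (congrArg (valuation F) h4).symm.trans_le h3
  · have h3 := ht (Sum.inl (Sum.inr (i, j)))
    have h4 := congrFun hg (Sum.inl (Sum.inr (i, j)))
    exact (congrArg (valuation F) h4).symm.trans_le h3

/-- Normalised representatives of the points of the projective variety. -/
def normalizedPoints : Set (Fin X.dim → F) :=
  {w | ((∀ i, valuation F (w i) ≤ 1) ∧ ∃ i, w i = 1) ∧ SolvesEqs X.eqs w}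

theorem isCompact_normalizedPoints : IsCompact X.normalizedPoints := by
  have := t2Space F
  have hball : IsCompact {w : Fin X.dim → F | ∀ i, valuation F (w i) ≤ 1} := by
    have := isCompact_univ_pi fun _ : Fin X.dim => isCompact_closedBall F 1
    convert this using 1
    ext t
    exact ⟨fun h i _ => h i, fun h i => h i trivial⟩
  have h1 : IsClosed {w : Fin X.dim → F | ∃ i, w i = 1} := by
    have : {w : Fin X.dim → F | ∃ i, w i = 1} = ⋃ i, (fun w : Fin X.dim → F => w i) ⁻¹' {1} := by
      ext w
      simp
    rw [this]
    exact isClosed_iUnion_of_finite fun i => isClosed_singleton.preimage (continuous_apply i)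
  have h2 : IsClosed {w : Fin X.dim → F | SolvesEqs X.eqs w} := by
    have : {w : Fin X.dim → F | SolvesEqs X.eqs w} =
        ⋂ f ∈ X.eqs, (fun w : Fin X.dim → F => MvPolynomial.aeval w f) ⁻¹' {0} := by
      ext w
      simp only [Set.mem_iInter]
      exact Iff.rfl
    rw [this]
    exact isClosed_biInter fun f _ => isClosed_singleton.preimage (MvPolynomial.continuous_aeval f)
  exact (hball.inter_right h1).inter_right h2

theorem _root_.AlgGrp.SolvesEqs.smul {K : Type u} [Field K] {m : ℕ}
    {E : Set (MvPolynomial (Fin m) K)} (hE : ∀ f ∈ E, ∃ d : ℕ, f.IsHomogeneous d) {w : Fin m → K}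
    (hw : SolvesEqs E w) (c : K) : SolvesEqs E (c • w) := by
  intro f hf
  obtain ⟨d, hd⟩ := hE f hf
  have h1 := hw f hf
  rw [MvPolynomial.aeval_eq_eval] at h1 ⊢
  have h2 : MvPolynomial.eval (c • w) f = c ^ d * MvPolynomial.eval w f := by
    rw [MvPolynomial.eval_eq', MvPolynomial.eval_eq', Finset.mul_sum]
    refine Finset.sum_congr rfl fun e he => ?_
    have h3 : ∑ i, e i = d := by
      rw [← Finsupp.degree_eq_sum, Finsupp.degree_eq_weight_one]
      exact hd (MvPolynomial.mem_support_iff.1 he)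
    simp only [Pi.smul_apply, smul_eq_mul, mul_pow, Finset.prod_mul_distrib,
      Finset.prod_pow_eq_pow_sum, h3]
    ring
  rw [h2, h1, mul_zero]

/-- Every non-zero solution can be normalised. -/
theorem exists_smul_mem_normalizedPoints {w : Fin X.dim → F} (hw : SolvesEqs X.eqs w)
    (h0 : w ≠ 0) : ∃ c : Fˣ, c • w ∈ X.normalizedPoints := by
  obtain ⟨j, hj⟩ := Function.ne_iff.1 h0
  have : Nonempty (Fin X.dim) := ⟨j⟩
  obtain ⟨i, hi⟩ := Finite.exists_max fun i => valuation F (w i)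
  have hwi : w i ≠ 0 := fun h => hj (by
    have := hi j
    rw [h, map_zero, le_zero_iff, map_eq_zero] at this
    exact this)
  refine ⟨(Units.mk0 _ hwi)⁻¹, ⟨fun k => ?_, i, ?_⟩, ?_⟩
  · change valuation F ((w i)⁻¹ * w k) ≤ 1
    rw [map_mul, map_inv₀]
    exact inv_mul_le_one_of_le₀ (hi k) zero_le
  · exact inv_mul_cancel₀ hwi
  · exact hw.smul X.homogeneous _

-- Every point of the variety has a neighbourhood of normalised points that are translates of it by
-- a compact subset of the group. Finitely many such neighbourhoods cover the compact set of
-- normalised points. Those whose centre is in the orbit of the base point contribute a compact set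
-- of group elements, and the others do not meet the orbit. The rational points need not form a
-- single orbit.
include X in
theorem exists_isCompact : ∃ C : Set (G.pts F), IsCompact C ∧ ∀ g, ∃ c ∈ C, c⁻¹ * g ∈ G.sub P := by
  have key : ∃ C : Set (G.pts F), IsCompact C ∧ ∀ y ∈ X.normalizedPoints,
      (∃ (g : G.pts F) (c : Fˣ), y = c • ((X.rep F g : Matrix _ _ F) *ᵥ X.base)) →
      ∃ g ∈ C, ∃ c : Fˣ, y = c • ((X.rep F g : Matrix _ _ F) *ᵥ X.base) := by
    refine X.isCompact_normalizedPoints.induction_on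
      (p := fun s => ∃ C : Set (G.pts F), IsCompact C ∧ ∀ y ∈ s,
      (∃ (g : G.pts F) (c : Fˣ), y = c • ((X.rep F g : Matrix _ _ F) *ᵥ X.base)) →
      ∃ g ∈ C, ∃ c : Fˣ, y = c • ((X.rep F g : Matrix _ _ F) *ᵥ X.base))
      ⟨∅, isCompact_empty, by simp⟩ ?_ ?_ ?_
    · rintro s t hst ⟨C, hC, h⟩
      exact ⟨C, hC, fun y hy => h y (hst hy)⟩
    · rintro s t ⟨C, hC, h⟩ ⟨C', hC', h'⟩
      refine ⟨C ∪ C', hC.union hC', ?_⟩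
      rintro y (hy | hy) ho
      · obtain ⟨g, hg, c, hc⟩ := h y hy ho
        exact ⟨g, Or.inl hg, c, hc⟩
      · obtain ⟨g, hg, c, hc⟩ := h' y hy ho
        exact ⟨g, Or.inr hg, c, hc⟩
    · rintro w ⟨⟨-, i₀, hi₀⟩, hw⟩
      refine ⟨_, inter_mem self_mem_nhdsWithin (mem_nhdsWithin_of_mem_nhds
        (X.eventually_exists_smul_rep hw hi₀)), ?_⟩
      by_cases ho : ∃ (g : G.pts F) (c : Fˣ), w = c • ((X.rep F g : Matrix _ _ F) *ᵥ X.base)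
      · obtain ⟨g₁, c₁, rfl⟩ := ho
        refine ⟨_, (G.isCompact_setOf_entriesLE 1).image (continuous_mul_const g₁), ?_⟩
        rintro y ⟨⟨⟨hy1, -⟩, hy⟩, hy2⟩ -
        obtain ⟨g, c, hg, hg', rfl⟩ := hy2 hy1 hy
        refine ⟨g * g₁, ⟨g, ⟨hg, hg'⟩, rfl⟩, c * c₁, ?_⟩
        rw [map_mul, Units.val_mul, ← Matrix.mulVec_mulVec, Matrix.mulVec_smul, smul_smul]
      -- A point `y` of the orbit in this neighbourhood would be a translate of the centre `w`, and
      -- then `w` would lie in the orbit as well.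
      · refine ⟨∅, isCompact_empty, ?_⟩
        rintro y ⟨⟨⟨hy1, -⟩, hy⟩, hy2⟩ ⟨g₁, c₁, h₁⟩
        obtain ⟨g, c, -, -, h₂⟩ := hy2 hy1 hy
        refine (ho ⟨g⁻¹ * g₁, c⁻¹ * c₁, ?_⟩).elim
        rw [map_mul, Units.val_mul, ← Matrix.mulVec_mulVec, ← smul_smul, ← Matrix.mulVec_smul,
          ← h₁, h₂, Matrix.mulVec_smul, inv_smul_smul, Matrix.mulVec_mulVec, ← Units.val_mul,
          ← map_mul, inv_mul_cancel, map_one, Units.val_one, Matrix.one_mulVec]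
  obtain ⟨C, hC, hCX⟩ := key
  refine ⟨C, hC, fun g => ?_⟩
  have h0 : (X.rep F g : Matrix (Fin X.dim) (Fin X.dim) F) *ᵥ X.base ≠ 0 := fun h => X.base_ne_zero (by
    have := congrArg (fun w => (((X.rep F g)⁻¹ : GL (Fin X.dim) F) : Matrix (Fin X.dim) (Fin X.dim) F) *ᵥ w) h
    simpa [Matrix.mulVec_mulVec] using this)
  obtain ⟨a, ha⟩ := X.exists_smul_mem_normalizedPoints (X.stable F g _ X.base_mem) h0
  obtain ⟨g₁, hg₁, c, hc⟩ := hCX _ ha ⟨g, a, rfl⟩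
  refine ⟨g₁, hg₁, ?_⟩
  -- The elements `g` and `g₁` send the base point to the same projective point, so `g₁⁻¹ * g`
  -- stabilises it.
  refine (X.stabilizer F (g₁⁻¹ * g)).2 ⟨a⁻¹ * c, ?_⟩
  change (X.rep F (g₁⁻¹ * g) : Matrix (Fin X.dim) (Fin X.dim) F) *ᵥ X.base = (a⁻¹ * c) • X.base
  have h1 := congrArg (fun w => (a⁻¹ : Fˣ) • ((X.rep F g₁⁻¹ : Matrix (Fin X.dim) (Fin X.dim) F) *ᵥ w)) hc
  simp only [Matrix.mulVec_smul, Matrix.mulVec_mulVec, ← Units.val_mul, ← map_mul, inv_mul_cancel, map_one, Units.val_one, Matrix.one_mulVec, smul_smul, one_smul] at h1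
  exact h1

end ProjectiveQuotient

theorem IsParabolic.exists_isCompact {G P : AlgGrp F n} (h : G.IsParabolic P) :
    ∃ C : Set (G.pts F), IsCompact C ∧ ∀ g, ∃ c ∈ C, c⁻¹ * g ∈ G.sub P := by
  obtain ⟨X⟩ := h.projective
  exact X.exists_isCompact

end AlgGrp

namespace AlgGrp

variable {F : Type u} [Field F] [ValuativeRel F]
    [TopologicalSpace F] [IsNonarchimedeanLocalField F] {n : ℕ}

theorem IsUnipotent.exists_isCompactOpenProP_sub (p : ℕ) [CharP 𝓀[F] p] {G U : AlgGrp F n}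
    (hUG : U.IsSubgroup G) (hU : U.IsUnipotent) (C : Set (G.sub U)) (hC : IsCompact C) :
    ∃ K : Subgroup (G.sub U), IsCompactOpenProP p K ∧ C ⊆ K := by
  let e : G.sub U ≃ₜ* U.pts F :=
    { Subgroup.subgroupOfEquivOfLe (hUG F) with
      continuous_toFun := by
        refine Continuous.subtype_mk ?_ _
        fun_prop
      continuous_invFun := by
        refine Continuous.subtype_mk (Continuous.subtype_mk ?_ _) _
        fun_prop }
  obtain ⟨K, hK, hCK⟩ := hU.exists_isCompactOpenProP p (e '' C) (hC.image e.continuous)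
  refine ⟨_, hK.map_equiv e.symm, fun x hx => Subgroup.mem_map.2 ⟨e x, hCK ⟨x, hx, rfl⟩, ?_⟩⟩
  exact e.symm_apply_apply x

end AlgGrp

/-! ### The main theorem. -/

theorem mainTheorem10
    {F : Type u} [Field F] [ValuativeRel F] [TopologicalSpace F] [IsNonarchimedeanLocalField F]
    (p : ℕ) [CharP 𝓀[F] p]
    {R : Type u} [Ring R] (hp : IsUnit (p : R))
    {n : ℕ} (G P P' M U U' : AlgGrp F n)
    (hG : G.IsConnectedReductive)
    (hP : AlgGrp.IsOppositeParabolicPair G P P' M U U')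
    (μG : @Measure (G.pts F) (borel (G.pts F))) (hμG : IsNormalizedHaar p μG)
    (μM : @Measure (G.sub M) (borel (G.sub M))) (hμM : IsNormalizedHaar p μM)
    (δ : SmoothChar R (G.sub M)) (hδ : Jacquet.IsModulusSqrt (hP.levi.normalizes G) δ)
    (δ' : SmoothChar R (G.sub M)) (hδ' : Jacquet.IsModulusSqrt (hP.levi'.normalizes G) δ') :
    (IntegrationIsEquivalence R μG ∧ IntegrationIsEquivalence R μM) ∧
    ((Jacquet.restrictionBimodule (hP.levi'.normalizes G) δ').IsSmoothBimodule μM μG ∧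
      (Jacquet.restrictionBimodule (hP.levi'.normalizes G) δ').IsTensorFunctor μM μG
        (Jacquet.restriction (hP.levi'.normalizes G) δ')) ∧
    ((Jacquet.inductionBimodule (hP.levi.normalizes G) δ).IsSmoothBimodule μG μM ∧
      (Jacquet.inductionBimodule (hP.levi.normalizes G) δ).IsTensorFunctor μG μM
        (Jacquet.induction (G.sub U) δ)) := by
  have : T1Space F := AlgGrp.t1Space_localField
  have : Fact p.Prime := ⟨IsNonarchimedeanLocalField.prime_of_charP F p⟩
  have hGp : LocallyProP p (G.pts F) := (locallyProP_GL p n).subgroup G.isClosed_pts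
  have hcl : ∀ H : AlgGrp F n, IsClosed (G.sub H : Set (G.pts F)) := fun H =>
    H.isClosed_pts.preimage continuous_subtype_val
  have hMp : LocallyProP p (G.sub M) := hGp.subgroup (hcl M)
  have hUp' : LocallyProP p (G.sub U') := hGp.subgroup (hcl U')
  obtain ⟨ν, hν, hνr⟩ := hUp'.exists_isNormalizedHaar
  have hMP : G.sub M ≤ G.sub P := fun m hm => hP.levi.levi_subgroup F hm
  have hUP : G.sub U ≤ G.sub P := fun m hm => hP.levi.unip_subgroup F hm
  obtain ⟨C, hC, hCP⟩ := hP.parabolic.exists_isCompact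
  refine ⟨⟨integrationIsEquivalence hp hμG hGp, integrationIsEquivalence hp hμM hMp⟩, ⟨?_, ?_⟩,
    ?_, ?_⟩
  · exact (Jacquet.isSmooth_restrictionBimodule hGp hMp _ δ').isSmoothBimodule hp hμG hGp hμM hMp
  · exact Jacquet.isTensorFunctor_restriction (hcl U') hp hν hμG hUp' hGp hMp
      (hP.levi'.unip_unipotent.exists_isCompactOpenProP_sub p fun S _ _ =>
        (hP.levi'.unip_subgroup S).trans (hP.parabolic'.subgroup S)) _ δ' hμM hνr hδ'
  · exact (Jacquet.isSmooth_inductionBimodule _ δ hGp hMp).isSmoothBimodule hp hμM hMp hμG hGp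
  · refine Jacquet.isTensorFunctor_induction _ hp hμM hMp hGp
      (hP.levi.isClosedEmbedding hP.parabolic.subgroup) hMP hUP (fun y hy => ?_) hC hCP hμG
    obtain ⟨m, hm, x, hx, h⟩ := hP.levi.exists_mul F _ hy
    have hG' : ∀ z ∈ P.pts F, z ∈ G.pts F := hP.parabolic.subgroup F
    exact ⟨⟨⟨m, hG' _ (hP.levi.levi_subgroup F hm)⟩, hm⟩,
      ⟨x, hG' _ (hP.levi.unip_subgroup F hx)⟩, hx, Subtype.ext h⟩
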